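/- For a real-valued $f\in L^2(\mathbb R^2)$ put $\hat f(\xi)=\int_{\mathbb R^2}e^{-ix\cdot\xi}f(x)\,dx$ (in the $L^2$ sense), $\widehat{(-\Delta)^{s}f}(\xi)=|\xi|^{2s}\hat f(\xi)$, $\Lambda=(-\Delta)^{1/2}$ and $\nabla^\perp=(\partial_2,-\partial_1)$, and consider the Cauchy problem for the surface quasi-geostrophic equation $$\partial_t\theta+u\cdot\nabla\theta+\mu(-\Delta)^\alpha\theta=0,\qquad u=\nabla^\perp(-\Delta)^{-1/2}\theta,\qquad \theta|_{t=0}=\theta_0 \qquad(x\in\mathbb R^2,\ t>0). \tag{1}$$ There is a universal constant $C>1$ such that for every $\mu>0$ there is $\epsilon_0=\epsilon_0(\mu)\in(0,e^{-100}]$ with the following property. Let $0\le\alpha<\frac12$ and $0<\epsilon\le\epsilon_0$, let $\Theta_0,g_0\in L^2(\mathbb R^2)$ be real-valued with $$\operatorname{supp}\hat\Theta_0\subset\{\xi:\tfrac43\le|\xi|\le\tfrac32\},$$ let $\Theta$ be the solution in $L^2$ of the linear equation $\partial_t\Theta+\mu(-\Delta)^\alpha\Theta=0$, $\Theta|_{t=0}=\Theta_0$,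 and let $U=\nabla^\perp(-\Delta)^{-1/2}\Theta$. If $$\Big(\|g_0\|_{H^3}^2+\int_0^\infty\|U\cdot\nabla\Theta\|_{H^3}\,dt\Big)\exp\Big(C\Big(\int_0^\infty\big(\|U\|_{L^\infty}+\|\Theta\|_{L^\infty}\big)dt+\int_0^\infty\|U\cdot\nabla\Theta\|_{H^3}\,dt\Big)\Big)\le\epsilon,$$ then $\Theta(t)=e^{-\mu t(-\Delta)^\alpha}\Theta_0$ for all $t\ge0$, the problem (1) with $\theta_0=\Theta_0+g_0$ has a unique global solution $\theta\in C([0,\infty);H^3(\mathbb R^2))$, and $g=\theta-\Theta$ satisfies $$\|g(t)\|_{H^3}^2+\frac{\mu}{2}\int_0^t\|\Lambda^\alpha g(\tau)\|_{H^3}^2\,d\tau\le C\epsilon\qquad\text{for all }t\ge0.$$ -/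

import Mathlib

open MeasureTheory Filter Topology Set
open scoped ENNReal FourierTransform

noncomputable section

namespace SQG

/-- The plane `ℝ²` with its Euclidean norm and Lebesgue measure. -/
abbrev Plane : Type := EuclideanSpace ℝ (Fin 2)

/-- Real-valued square integrable functions on the plane. -/
abbrev L2 : Type := Lp ℝ 2 (volume : Measure Plane)

/-- Complex-valued square integrable functions on the plane. -/
abbrev L2C : Type := Lp ℂ 2 (volume : Measure Plane)

/-- The (unitary) Fourier transform of a real `L²` function, in Mathlib's normalization
`𝓕 f ξ = ∫ exp (-2πi x·ξ) f x dx`. The frequency variable of the convention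
`∫ exp (-i x·ξ) f x dx` is `2πξ` in terms of this `ξ`. -/
def fhat (f : L2) : L2C :=
  𝓕 (Complex.ofRealCLM.compLp f : L2C)

/-- `f` belongs to the `L²`-domain of the Fourier multiplier with symbol `m`. -/
def InDomain (m : Plane → ℂ) (f : L2) : Prop :=
  MemLp (fun ξ => m ξ * fhat f ξ) 2 (volume : Measure Plane)

open scoped Classical in
/-- The Fourier multiplier with symbol `m` on real `L²` functions, `f ↦ 𝓕⁻¹ (m · 𝓕 f)` on its
`L²`-domain (and `0` outside it). All symbols below satisfy `m (-ξ) = conj (m ξ)`, so that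
`𝓕⁻¹ (m · 𝓕 f)` is real-valued and taking the real part only changes the codomain. -/
def fourierMul (m : Plane → ℂ) (f : L2) : L2 :=
  if h : InDomain m f then Complex.reCLM.compLp (𝓕⁻ (MemLp.toLp _ h : L2C)) else 0

/-- The symbol of `(-Δ)^s`, that is `|2πξ|^{2s}`. -/
def lapSymbol (s : ℝ) (ξ : Plane) : ℂ := (((2 * Real.pi * ‖ξ‖) ^ (2 * s) : ℝ) : ℂ)

/-- The fractional Laplacian `(-Δ)^s`. -/
def fracLap (s : ℝ) (f : L2) : L2 := fourierMul (lapSymbol s) f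

/-- The semigroup `e^{-μ t (-Δ)^α}`. -/
def heat (μ α t : ℝ) (f : L2) : L2 :=
  fourierMul (fun ξ => ((Real.exp (-(μ * t * (2 * Real.pi * ‖ξ‖) ^ (2 * α))) : ℝ) : ℂ)) f

/-- The partial derivative `∂_j`, with symbol `2πi ξ_j`. -/
def partialD (j : Fin 2) (f : L2) : L2 :=
  fourierMul (fun ξ => 2 * Real.pi * Complex.I * ((ξ j : ℝ) : ℂ)) f

/-- The operator `∂_j (-Δ)^{-1/2}`, with symbol `i ξ_j / |ξ|`. -/
def riesz (j : Fin 2) (f : L2) : L2 :=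
  fourierMul (fun ξ => Complex.I * ((ξ j / ‖ξ‖ : ℝ) : ℂ)) f

/-- The gradient `∇f`. -/
def grad (f : L2) : Plane → Plane := fun x => !₂[partialD 0 f x, partialD 1 f x]

/-- The velocity `∇^⊥ (-Δ)^{-1/2} f`, where `∇^⊥ = (∂₂, -∂₁)`. -/
def velocity (f : L2) : Plane → Plane := fun x => !₂[riesz 1 f x, -riesz 0 f x]

/-- The nonlinear term `u · ∇f` with `u = ∇^⊥ (-Δ)^{-1/2} f`. -/
def advection (f : L2) : Plane → ℝ := fun x => inner ℝ (velocity f x) (grad f x)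

open scoped Classical in
/-- The norm of the Sobolev space `H^s`, `s ≥ 0`:
`‖f‖_{H^s}² = ∫ (1 + |2πξ|²)^s |𝓕 f ξ|² dξ`, infinite for functions outside `H^s`. -/
def hNorm (s : ℝ) (f : Plane → ℝ) : ℝ≥0∞ :=
  if h : MemLp f 2 (volume : Measure Plane) then
    (∫⁻ ξ : Plane, ENNReal.ofReal ((1 + (2 * Real.pi * ‖ξ‖) ^ 2) ^ s) *
      ‖fhat (MemLp.toLp f h) ξ‖ₑ ^ 2) ^ (1 / 2 : ℝ)
  else ⊤

/-- `Θ` solves `∂_t Θ + μ (-Δ)^α Θ = 0` for `t > 0` with `Θ|_{t=0} = Θ₀`, in `L²`. Only the values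
`Θ t` with `t ≥ 0` matter. -/
structure IsLinearSolution (μ α : ℝ) (Θ₀ : L2) (Θ : ℝ → L2) : Prop where
  initial : Θ 0 = Θ₀
  continuousOn : ContinuousOn Θ (Ici 0)
  domain : ∀ t, 0 < t → InDomain (lapSymbol α) (Θ t)
  equation : ∀ t, 0 < t → HasDerivAt Θ (-(μ • fracLap α (Θ t))) t

/-- `θ` is a global solution of the SQG equation
`∂_t θ + u · ∇θ + μ (-Δ)^α θ = 0`, `u = ∇^⊥ (-Δ)^{-1/2} θ`, `θ|_{t=0} = θ₀`,
in the class `C([0,∞); H³)`: the time derivative exists in `L²` and the equation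
holds almost everywhere, for every `t > 0`. Only the values `θ t` with `t ≥ 0` matter. -/
structure IsGlobalSolution (μ α : ℝ) (θ₀ : L2) (θ : ℝ → L2) : Prop where
  initial : θ 0 = θ₀
  regular : ∀ t, 0 ≤ t → hNorm 3 (θ t) < ⊤
  continuous : ∀ t, 0 ≤ t → Tendsto (fun s => hNorm 3 (θ s - θ t : L2)) (𝓝[Ici 0] t) (𝓝 0)
  equation : ∀ t, 0 < t → ∃ dθ : L2, HasDerivAt θ dθ t ∧
    ∀ᵐ x : Plane, dθ x + advection (θ t) x + μ * fracLap α (θ t) x = 0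

/-- The Fourier transform of `f` (in the convention `∫ exp (-i x·ξ) f x dx`) is supported in the
annulus `4/3 ≤ |ξ| ≤ 3/2`. -/
def AnnulusSupported (f : L2) : Prop :=
  ∀ᵐ ξ : Plane, fhat f ξ ≠ 0 → 4 / 3 ≤ 2 * Real.pi * ‖ξ‖ ∧ 2 * Real.pi * ‖ξ‖ ≤ 3 / 2

/-- `∫_0^∞ ‖U, Θ‖_{L^∞} dt` with `U = ∇^⊥ (-Δ)^{-1/2} Θ`. -/
def supIntegral (Θ : ℝ → L2) : ℝ≥0∞ :=
  ∫⁻ t in Ioi (0 : ℝ), (eLpNorm (velocity (Θ t)) ⊤ volume + eLpNorm (Θ t) ⊤ volume)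

/-- `∫_0^∞ ‖U · ∇Θ‖_{H³} dt` with `U = ∇^⊥ (-Δ)^{-1/2} Θ`. -/
def forcingIntegral (Θ : ℝ → L2) : ℝ≥0∞ :=
  ∫⁻ t in Ioi (0 : ℝ), hNorm 3 (advection (Θ t))

/-- The smallness condition on the data, with constant `C` and threshold `ε`. -/
def SmallnessCondition (C ε : ℝ) (g₀ : L2) (Θ : ℝ → L2) : Prop :=
  (hNorm 3 g₀ ^ 2 + forcingIntegral Θ) *
      EReal.exp ((ENNReal.ofReal C * (supIntegral Θ + forcingIntegral Θ) : ℝ≥0∞) : EReal)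
    ≤ ENNReal.ofReal ε

end SQG

end

open MeasureTheory Filter Topology Set
open scoped ENNReal FourierTransform
noncomputable section
namespace SQG
open scoped SchwartzMap ComplexConjugate ContDiff

/-! Write θ = Θ + g. Then g solves the dissipative equation with four quadratic terms: the
self-interaction u_g·∇g, the transport U·∇g, the stretching u_g·∇Θ and the forcing U·∇Θ. Everything
rests on the H³ energy inequality `energy_le`, whose constants do not depend on α.

The self-interaction is the term that Gronwall alone cannot treat: a bound by ‖g‖³ in H³ would not
be integrable over all times. On the Fourier side transport has a real kernel, odd under exchange of
its two frequencies (`ker_swap`), so pairing against a weight m only produces differences m ξ − m η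
(`two_mul_inner_adv_le`). For the H³ weight, `kernel_bound` puts one derivative on one factor, which
H³ controls in L¹ of frequency, and the weight `sw` on the other two. This weight has order 3 but
vanishes like |ξ|^{1/2} at the origin, so for α ≤ 1/2 it is at most |2πξ|^α⟨ξ⟩³ (`sw_le_dw`). Hence
the cubic term is bounded by ‖g‖_{H³}‖Λ^α g‖²_{H³} and is absorbed by the dissipation as long as g
is small compared with μ.

The terms with Θ use that its spectrum stays in a fixed ball: Bernstein's inequality
`abs_partialD_le` turns derivatives of Θ and U into sup norms. In U·∇g the term with all derivatives
on g cancels because U is divergence free (`abs_inner_J3_adv_le`), u_g·∇Θ costs no additional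
derivative of g (`norm_J3_adv_le`), and the forcing is handled by Cauchy–Schwarz. The resulting
rate, ‖U‖_∞ + ‖Θ‖_∞ + ‖U·∇Θ‖_{H³}, is integrable in time. `gronwall_dissipation` and the barrier
argument `le_of_bootstrap` then close the estimate for all times (`galerkin_bound`).

Existence comes from truncating the equation to |ξ| ≤ n + 2, where it is a dissipative, locally
Lipschitz ODE in L². The energy bound is uniform in n, the truncated solutions are Cauchy in L²
uniformly on compact time intervals, and interpolation with the H³ bound passes to the limit in the
equation (`exists_limit`). Continuity in H³ follows from L² continuity together with continuity of
the H³ norm, whose variation is controlled by the integrable dissipation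
(`continuousOn_J3_of_solution`). Uniqueness is an L² energy estimate in which only one of the two
solutions has to be bounded in H³. -/

/-! ### The Fourier transform of real L² functions -/

theorem integral_mul_fourier (F : L2C) (φ : 𝓢(Plane, ℂ)) :
    ∫ ξ, φ ξ * (𝓕 F : L2C) ξ = ∫ x, (𝓕 φ) x * F x := by
  have h := congrArg (fun T : 𝓢'(Plane, ℂ) => T φ) (Lp.fourier_toTemperedDistribution_eq F)
  simpa [Lp.toTemperedDistribution_apply] using h.symm

theorem integral_mul_fourierInv (F : L2C) (φ : 𝓢(Plane, ℂ)) :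
    ∫ ξ, φ ξ * (𝓕⁻ F : L2C) ξ = ∫ x, (𝓕⁻ φ) x * F x := by
  have h := congrArg (fun T : 𝓢'(Plane, ℂ) => T φ) (Lp.fourierInv_toTemperedDistribution_eq F)
  simpa [Lp.toTemperedDistribution_apply] using h.symm

/-- A smooth compactly supported real function as a complex Schwartz function. -/
def testFun (g : Plane → ℝ) (hg : ContDiff ℝ ∞ g) (hc : HasCompactSupport g) : 𝓢(Plane, ℂ) :=
  HasCompactSupport.toSchwartzMap (f := fun x => (g x : ℂ))
    (hc.comp_left (g := fun r : ℝ => (r : ℂ)) Complex.ofReal_zero)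
    (Complex.ofRealCLM.contDiff.comp hg)

@[simp] theorem testFun_apply (g : Plane → ℝ) (hg : ContDiff ℝ ∞ g) (hc : HasCompactSupport g)
    (x : Plane) : testFun g hg hc x = (g x : ℂ) := rfl

theorem locallyIntegrable_L2C (F : L2C) : LocallyIntegrable F volume :=
  (Lp.memLp F).locallyIntegrable one_le_two

theorem continuous_fourierInv_of_integrable {a : Plane → ℂ} (ha : Integrable a) :
    Continuous (𝓕⁻ a) := by
  have h := (Real.Lp.fourierTransformInv (memLp_one_iff_integrable.2 ha).toLp).continuous
  rwa [Real.Lp.fourierTransformInv_toLp] at h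

/-- On `L¹ ∩ L²` the inverse Fourier transform is given by the integral formula. -/
theorem fourierInv_ae_eq (a : L2C) (ha : Integrable a) :
    (𝓕⁻ a : L2C) =ᵐ[volume] fun x => 𝓕⁻ (a : Plane → ℂ) x := by
  refine ae_eq_of_integral_contDiff_smul_eq (locallyIntegrable_L2C _) ?_ ?_
  · exact (continuous_fourierInv_of_integrable ha).locallyIntegrable
  · intro g hg hc
    have h1 := integral_mul_fourierInv a (testFun g hg hc)
    have h2 : ∫ x, (𝓕⁻ (testFun g hg hc)) x * a x = ∫ x, testFun g hg hc x * 𝓕⁻ (a : Plane → ℂ) x := by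
      have h := VectorFourier.integral_fourierIntegral_smul_eq_flip (L := -innerₗ Plane)
        (μ := volume) (ν := volume) Real.continuous_fourierChar
        (continuous_inner (𝕜 := ℝ) (E := Plane)).neg
        (testFun g hg hc).integrable ha
      rw [SchwartzMap.fourierInv_coe]
      have hflip : (-innerₗ Plane).flip = -innerₗ Plane := by
        ext x y; simp [real_inner_comm]
      rw [hflip] at h
      exact h
    simpa using h1.trans h2

theorem integral_comp_neg' (f : Plane → ℂ) : ∫ x, f (-x) = ∫ x, f x :=
  integral_neg_eq_self f volume

/-- Tested against a real φ: reflecting φ conjugates its transform, and f is real, so the two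
pairings are conjugate to each other. -/
theorem fhat_neg_ae (f : L2) : ∀ᵐ ξ : Plane, conj (fhat f (-ξ)) = fhat f ξ := by
  have hq : Measure.QuasiMeasurePreserving (fun ξ : Plane => -ξ) volume volume :=
    (Measure.measurePreserving_neg volume).quasiMeasurePreserving
  refine ae_eq_of_integral_contDiff_smul_eq (f := fun ξ => conj (fhat f (-ξ))) ?_
    (locallyIntegrable_L2C _) ?_
  · have h1 : MemLp (fun ξ : Plane => fhat f (-ξ)) 2 volume :=
      (Lp.memLp (fhat f)).comp_measurePreserving (Measure.measurePreserving_neg volume)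
    exact (h1.star).locallyIntegrable one_le_two
  · intro g hg hc
    set φ := testFun g hg hc
    set ψ := testFun (fun x => g (-x)) (hg.comp contDiff_neg)
      (hc.comp_homeomorph (Homeomorph.neg Plane))
    have hψ : ∀ x, ψ x = (g (-x) : ℂ) := fun _ => rfl
    have h1 := integral_mul_fourier (Complex.ofRealCLM.compLp f : L2C) φ
    have h2 := integral_mul_fourier (Complex.ofRealCLM.compLp f : L2C) ψ
    have h3 : ∀ x, (𝓕 ψ) x = conj ((𝓕 φ) x) := by
      intro x
      rw [SchwartzMap.fourier_coe, SchwartzMap.fourier_coe, Real.fourier_eq', Real.fourier_eq',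
        ← integral_conj, ← integral_comp_neg']
      refine integral_congr_ae (Eventually.of_forall fun v => ?_)
      simp [φ, hψ, testFun_apply, ← Complex.exp_conj, map_ofNat]
    have h4 : ∫ x, (𝓕 ψ) x * (Complex.ofRealCLM.compLp f : L2C) x
        = conj (∫ x, (𝓕 φ) x * (Complex.ofRealCLM.compLp f : L2C) x) := by
      rw [← integral_conj]
      refine integral_congr_ae ?_
      filter_upwards [Complex.ofRealCLM.coeFn_compLp f] with x hx
      simp [hx, h3]
    rw [← h1, ← h2] at h4
    have h5 : ∫ ξ, g ξ • conj (fhat f (-ξ)) = conj (∫ ξ, ψ ξ * fhat f ξ) := by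
      rw [← integral_conj, ← integral_comp_neg']
      refine integral_congr_ae (Eventually.of_forall fun ξ => ?_)
      simp [hψ]
    rw [h5]
    change conj (∫ ξ, ψ ξ * (𝓕 (Complex.ofRealCLM.compLp f : L2C) : L2C) ξ) = _
    rw [h4]
    simp [φ, fhat]

/-- The converse symmetry. It guarantees that the real part taken in `fourierMul` and `ofHat`
discards nothing. -/
theorem conj_fourierInv_of_hermitian (a : L2C) (ha : ∀ᵐ ξ : Plane, conj (a (-ξ)) = a ξ) :
    ∀ᵐ x : Plane, conj ((𝓕⁻ a : L2C) x) = (𝓕⁻ a : L2C) x := by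
  refine ae_eq_of_integral_contDiff_smul_eq (f := fun ξ => conj ((𝓕⁻ a : L2C) ξ)) ?_
    (locallyIntegrable_L2C _) ?_
  · exact ((Lp.memLp (𝓕⁻ a : L2C)).star).locallyIntegrable one_le_two
  · intro g hg hc
    set φ := testFun g hg hc
    have h1 := integral_mul_fourierInv a φ
    have h3 : ∀ x, conj ((𝓕⁻ φ) (-x)) = (𝓕⁻ φ) x := by
      intro x
      rw [SchwartzMap.fourierInv_coe, Real.fourierInv_eq', Real.fourierInv_eq',
        ← integral_conj]
      refine integral_congr_ae (Eventually.of_forall fun v => ?_)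
      simp [φ, testFun_apply, ← Complex.exp_conj, map_ofNat]
    have h4 : conj (∫ x, (𝓕⁻ φ) x * a x) = ∫ x, (𝓕⁻ φ) x * a x := by
      rw [← integral_conj, ← integral_comp_neg']
      refine integral_congr_ae ?_
      filter_upwards [ha] with x hx
      simp only [map_mul, hx, h3]
    have h5 : ∫ ξ, g ξ • conj ((𝓕⁻ a : L2C) ξ) = conj (∫ ξ, φ ξ * (𝓕⁻ a : L2C) ξ) := by
      rw [← integral_conj]
      refine integral_congr_ae (Eventually.of_forall fun ξ => ?_)
      simp [φ]
    rw [h5, h1, h4, ← h1]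
    simp [φ]

/-- The Fourier transform of real `L²` functions as a real-linear isometry. -/
def fhatL : L2 →ₗᵢ[ℝ] L2C where
  toFun := fhat
  map_add' f g := by
    have h : (Complex.ofRealCLM.compLp (f + g) : L2C)
        = Complex.ofRealCLM.compLp f + Complex.ofRealCLM.compLp g :=
      (Complex.ofRealCLM.compLpL 2 volume).map_add f g
    simp only [fhat, h]
    exact FourierTransform.fourier_add _ _
  map_smul' c f := by
    have h : (Complex.ofRealCLM.compLp (c • f) : L2C) = (c : ℂ) • Complex.ofRealCLM.compLp f := by
      have := (Complex.ofRealCLM.compLpL 2 volume).map_smul c f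
      refine this.trans ?_
      ext1
      filter_upwards [Lp.coeFn_smul c (Complex.ofRealCLM.compLpL 2 volume f),
        Lp.coeFn_smul (c : ℂ) (Complex.ofRealCLM.compLp f : L2C)] with x h1 h2
      rw [h1, h2]
      exact (Complex.real_smul (x := c)).trans rfl
    simp only [fhat, h]
    refine (FourierTransform.fourier_smul (c : ℂ) (Complex.ofRealCLM.compLp f : L2C)).trans ?_
    ext1
    filter_upwards [Lp.coeFn_smul c (𝓕 (Complex.ofRealCLM.compLp f : L2C) : L2C),
      Lp.coeFn_smul (c : ℂ) (𝓕 (Complex.ofRealCLM.compLp f : L2C) : L2C)] with x h1 h2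
    rw [h2]
    exact (Complex.real_smul (x := c)).symm.trans h1.symm
  norm_map' f := by
    change ‖(𝓕 (Complex.ofRealCLM.compLp f : L2C) : L2C)‖ = ‖f‖
    rw [Lp.norm_fourier_eq, Lp.norm_def, Lp.norm_def]
    congr 1
    refine eLpNorm_congr_norm_ae ?_
    filter_upwards [Complex.ofRealCLM.coeFn_compLp f] with x hx
    simp [hx]

theorem fhatL_apply (f : L2) : fhatL f = fhat f := rfl

theorem fhat_add (f g : L2) : fhat (f + g) = fhat f + fhat g := fhatL.map_add f g
theorem fhat_sub (f g : L2) : fhat (f - g) = fhat f - fhat g := fhatL.map_sub f g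
theorem fhat_smul (c : ℝ) (f : L2) : fhat (c • f) = c • fhat f := fhatL.map_smul c f
theorem fhat_zero : fhat 0 = 0 := fhatL.map_zero
theorem norm_fhat (f : L2) : ‖fhat f‖ = ‖f‖ := fhatL.norm_map f

/-- A representative of the Fourier transform which is Hermitian at every point. -/
def fh (f : L2) (ξ : Plane) : ℂ := (fhat f ξ + conj (fhat f (-ξ))) / 2

theorem fh_ae (f : L2) : fh f =ᵐ[volume] fhat f := by
  filter_upwards [fhat_neg_ae f] with ξ hξ
  simp [fh, hξ]

/-- Valid at every point, so that reflections and exchanges of variables under integral signs need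
no bookkeeping of null sets. -/
theorem fh_neg (f : L2) (ξ : Plane) : fh f (-ξ) = conj (fh f ξ) := by
  simp [fh, add_comm, map_ofNat]

theorem measurable_fh (f : L2) : Measurable (fh f) := by
  have h : Measurable (fhat f) := (Lp.stronglyMeasurable (fhat f)).measurable
  have h2 : Measurable fun ξ : Plane => fhat f (-ξ) := h.comp measurable_neg
  have h3 : Measurable fun ξ : Plane => conj (fhat f (-ξ)) :=
    Complex.continuous_conj.measurable.comp h2
  exact (h.add h3).div_const 2

theorem memLp_fh (f : L2) : MemLp (fh f) 2 volume :=
  (memLp_congr_ae (fh_ae f)).2 (Lp.memLp (fhat f))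

theorem fhat_injective : Function.Injective fhat := fhatL.injective

theorem ext_fh {f g : L2} (h : fh f =ᵐ[volume] fh g) : f = g :=
  fhat_injective (Lp.ext ((fh_ae f).symm.trans (h.trans (fh_ae g))))

theorem fh_add (f g : L2) : fh (f + g) =ᵐ[volume] fun ξ => fh f ξ + fh g ξ := by
  filter_upwards [fh_ae (f + g), fh_ae f, fh_ae g, Lp.coeFn_add (fhat f) (fhat g)] with ξ h1 h2 h3 h4
  rw [h1, h2, h3, fhat_add, h4]; rfl

theorem fh_sub (f g : L2) : fh (f - g) =ᵐ[volume] fun ξ => fh f ξ - fh g ξ := by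
  filter_upwards [fh_ae (f - g), fh_ae f, fh_ae g, Lp.coeFn_sub (fhat f) (fhat g)] with ξ h1 h2 h3 h4
  rw [h1, h2, h3, fhat_sub, h4]; rfl

theorem fh_smul (c : ℝ) (f : L2) : fh (c • f) =ᵐ[volume] fun ξ => c * fh f ξ := by
  filter_upwards [fh_ae (c • f), fh_ae f, Lp.coeFn_smul c (fhat f)] with ξ h1 h2 h4
  rw [h1, h2, fhat_smul, h4]; simp

theorem fh_zero : fh 0 =ᵐ[volume] fun _ => 0 := by
  filter_upwards [fh_ae 0, Lp.coeFn_zero ℂ 2 (volume : Measure Plane)] with ξ h1 h2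
  rw [h1, fhat_zero, h2]; rfl

/-- The real part of the inverse Fourier transform. -/
def ofHat (a : Plane → ℂ) (ha : MemLp a 2 volume) : L2 :=
  Complex.reCLM.compLp (𝓕⁻ (ha.toLp a : L2C))

theorem fhat_ofHat {a : Plane → ℂ} (ha : MemLp a 2 volume)
    (h : ∀ᵐ ξ : Plane, conj (a (-ξ)) = a ξ) : fhat (ofHat a ha) = ha.toLp a := by
  have hq : Measure.QuasiMeasurePreserving (fun ξ : Plane => -ξ) volume volume :=
    (Measure.measurePreserving_neg volume).quasiMeasurePreserving
  have h1 : ∀ᵐ ξ : Plane, conj ((ha.toLp a : L2C) (-ξ)) = (ha.toLp a : L2C) ξ := by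
    filter_upwards [h, ha.coeFn_toLp, hq.ae ha.coeFn_toLp] with ξ h1 h2 h3
    rw [h2, h3, h1]
  have h2 : (Complex.ofRealCLM.compLp (ofHat a ha) : L2C) = 𝓕⁻ (ha.toLp a : L2C) := by
    ext1
    filter_upwards [Complex.ofRealCLM.coeFn_compLp (ofHat a ha),
      Complex.reCLM.coeFn_compLp (𝓕⁻ (ha.toLp a : L2C)),
      conj_fourierInv_of_hermitian _ h1] with x e1 e2 e3
    rw [e1, ofHat, e2]
    exact Complex.conj_eq_iff_re.1 e3
  rw [fhat, h2]
  exact FourierTransform.fourier_fourierInv_eq _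

theorem fh_ofHat {a : Plane → ℂ} (ha : MemLp a 2 volume)
    (h : ∀ᵐ ξ : Plane, conj (a (-ξ)) = a ξ) : fh (ofHat a ha) =ᵐ[volume] a := by
  filter_upwards [fh_ae (ofHat a ha), ha.coeFn_toLp] with ξ h1 h2
  rw [h1, fhat_ofHat ha h, h2]

theorem inDomain_iff {m : Plane → ℂ} {f : L2} :
    InDomain m f ↔ MemLp (fun ξ => m ξ * fh f ξ) 2 volume := by
  refine memLp_congr_ae ?_
  filter_upwards [fh_ae f] with ξ h
  rw [h]

theorem fh_fourierMul {m : Plane → ℂ} (hm : ∀ ξ, conj (m (-ξ)) = m ξ) {f : L2}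
    (h : InDomain m f) : fh (fourierMul m f) =ᵐ[volume] fun ξ => m ξ * fh f ξ := by
  have e : fourierMul m f = ofHat _ h := by rw [fourierMul, dif_pos h]; rfl
  rw [e]
  have h2 : ∀ᵐ ξ : Plane, conj (m (-ξ) * fhat f (-ξ)) = m ξ * fhat f ξ := by
    filter_upwards [fhat_neg_ae f] with ξ hξ
    rw [map_mul, hm, hξ]
  filter_upwards [fh_ofHat h h2, fh_ae f] with ξ h3 h4
  rw [h3, h4]

/-- Fourier inversion for `L²` functions with integrable Fourier transform. -/
theorem ofReal_ae_eq_fourierInv (f : L2) (hf : Integrable (fh f)) :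
    ∀ᵐ x : Plane, ((f x : ℝ) : ℂ) = 𝓕⁻ (fh f) x := by
  have hf' : Integrable (fhat f) := hf.congr (fh_ae f)
  have h2 : (𝓕⁻ (fhat f) : L2C) = Complex.ofRealCLM.compLp f :=
    FourierTransform.fourierInv_fourier_eq _
  filter_upwards [fourierInv_ae_eq _ hf', Complex.ofRealCLM.coeFn_compLp f] with x h1 h3
  rw [h2, h3] at h1
  rw [Real.fourierInv_congr_ae (fh_ae f)]
  exact h1

theorem norm_fourierInv_le (a : Plane → ℂ) (x : Plane) : ‖𝓕⁻ a x‖ ≤ ∫ ξ, ‖a ξ‖ := by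
  rw [Real.fourierInv_eq]
  refine (norm_integral_le_integral_norm _).trans (le_of_eq ?_)
  simp [Circle.smul_def, Circle.norm_coe]

theorem abs_le_integral_fh (f : L2) (hf : Integrable (fh f)) :
    ∀ᵐ x : Plane, |f x| ≤ ∫ ξ, ‖fh f ξ‖ := by
  filter_upwards [ofReal_ae_eq_fourierInv f hf] with x hx
  have := norm_fourierInv_le (fh f) x
  rwa [← hx, Complex.norm_real, Real.norm_eq_abs] at this

/-- The integrals defining the convolution of an integrable function with a square integrable one
converge absolutely, in the form tested against a square integrable function. -/
theorem lintegral_trilinear_le {A B D : Plane → ℝ≥0∞} (hA : Measurable A) (hB : Measurable B)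
    (hD : Measurable D) :
    ∫⁻ ξ, ∫⁻ η, A (ξ - η) * B η * D ξ ≤
      (∫⁻ ζ, A ζ) * ((∫⁻ η, B η ^ 2) ^ (1 / 2 : ℝ) * (∫⁻ ξ, D ξ ^ 2) ^ (1 / 2 : ℝ)) := by
  -- With ζ = ξ − η as inner variable and the order of integration exchanged, each fixed ζ leaves a
  -- Cauchy–Schwarz pairing of a translate of B with D.
  have h1 : ∫⁻ ξ, ∫⁻ η, A (ξ - η) * B η * D ξ = ∫⁻ ξ, ∫⁻ ζ, A ζ * (B (ξ - ζ) * D ξ) := by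
    refine lintegral_congr fun ξ => ?_
    rw [← lintegral_sub_left_eq_self _ ξ]
    refine lintegral_congr fun η => ?_
    simp [mul_assoc]
  rw [h1, lintegral_lintegral_swap (by fun_prop), ← lintegral_mul_const _ hA]
  refine lintegral_mono fun ζ => ?_
  rw [lintegral_const_mul _ (by fun_prop)]
  gcongr
  have h2 := ENNReal.lintegral_mul_le_Lp_mul_Lq volume Real.HolderConjugate.two_two
    (f := fun ξ => B (ξ - ζ)) (g := D) (by fun_prop) (by fun_prop)
  have h3 : ∫⁻ ξ, B (ξ - ζ) ^ (2 : ℝ) = ∫⁻ η, B η ^ 2 := by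
    rw [lintegral_sub_right_eq_self (fun ξ => B ξ ^ (2 : ℝ)) ζ]
    simp
  rw [h3] at h2
  simpa using h2

theorem enorm_sq_eq (f : L2) : ‖f‖ₑ ^ 2 = ∫⁻ ξ, ‖fh f ξ‖ₑ ^ 2 := by
  have h1 : ‖f‖ₑ = ‖fhat f‖ₑ := by
    rw [← ofReal_norm, ← ofReal_norm, norm_fhat]
  rw [h1, Lp.enorm_def, eLpNorm_eq_lintegral_rpow_enorm_toReal (by norm_num) (by norm_num)]
  rw [← ENNReal.rpow_natCast, ← ENNReal.rpow_mul]
  norm_num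
  refine lintegral_congr_ae ?_
  filter_upwards [fh_ae f] with ξ h
  rw [h]

theorem lintegral_fh_rpow (f : L2) : (∫⁻ ξ, ‖fh f ξ‖ₑ ^ 2) ^ (1 / 2 : ℝ) = ‖f‖ₑ := by
  rw [← enorm_sq_eq, ← ENNReal.rpow_natCast, ← ENNReal.rpow_mul]
  norm_num

theorem inner_eq_integral (f g : L2) :
    inner ℝ f g = ∫ ξ, (conj (fh f ξ) * fh g ξ).re := by
  rw [← fhatL.inner_map_map, L2.inner_def]
  refine integral_congr_ae ?_
  filter_upwards [fh_ae f, fh_ae g] with ξ h1 h2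
  rw [h1, h2, fhatL_apply, fhatL_apply, Complex.inner, mul_comm]

/-! ### Fourier multipliers with Hermitian symbols -/

/-- Symbols of Fourier multipliers acting on real functions. -/
structure HSym (m : Plane → ℂ) : Prop where
  meas : Measurable m
  herm : ∀ ξ, conj (m (-ξ)) = m ξ

/-- Real even symbols. -/
structure RSym (m : Plane → ℝ) : Prop where
  meas : Measurable m
  even : ∀ ξ, m (-ξ) = m ξ

theorem RSym.hSym {m : Plane → ℝ} (h : RSym m) : HSym (fun ξ => (m ξ : ℂ)) where
  meas := Complex.measurable_ofReal.comp h.meas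
  herm ξ := by simp [h.even]

theorem RSym.mul {m m' : Plane → ℝ} (h : RSym m) (h' : RSym m') : RSym (fun ξ => m ξ * m' ξ) where
  meas := h.meas.mul h'.meas
  even ξ := by simp [h.even, h'.even]

theorem RSym.pow {m : Plane → ℝ} (h : RSym m) (k : ℕ) : RSym (fun ξ => m ξ ^ k) where
  meas := h.meas.pow_const k
  even ξ := by simp [h.even]

theorem RSym.const (c : ℝ) : RSym (fun _ => c) := ⟨measurable_const, fun _ => rfl⟩

theorem RSym.of_norm {F : ℝ → ℝ} (hF : Measurable F) : RSym (fun ξ => F ‖ξ‖) :=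
  ⟨hF.comp measurable_norm, fun ξ => by simp⟩

theorem memLp_two_iff {a : Plane → ℂ} (ha : Measurable a) :
    MemLp a 2 volume ↔ ∫⁻ ξ, ‖a ξ‖ₑ ^ 2 < ⊤ := by
  have h := eLpNorm_lt_top_iff_lintegral_rpow_enorm_lt_top (μ := volume) (f := a) (p := 2)
    (by norm_num) (by norm_num)
  simp only [ENNReal.toReal_ofNat, ENNReal.rpow_ofNat] at h
  rw [← h]
  exact ⟨fun h => h.2, fun h => ⟨ha.aestronglyMeasurable, h⟩⟩

theorem HSym.inDomain_iff {m : Plane → ℂ} (h : HSym m) {f : L2} :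
    InDomain m f ↔ ∫⁻ ξ, ‖m ξ * fh f ξ‖ₑ ^ 2 < ⊤ := by
  rw [SQG.inDomain_iff]
  exact memLp_two_iff (h.meas.mul (measurable_fh f))

theorem HSym.fh_fourierMul {m : Plane → ℂ} (h : HSym m) {f : L2} (hf : InDomain m f) :
    fh (fourierMul m f) =ᵐ[volume] fun ξ => m ξ * fh f ξ := SQG.fh_fourierMul h.herm hf

theorem HSym.enorm_fourierMul_sq {m : Plane → ℂ} (h : HSym m) {f : L2} (hf : InDomain m f) :
    ‖fourierMul m f‖ₑ ^ 2 = ∫⁻ ξ, ‖m ξ * fh f ξ‖ₑ ^ 2 := by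
  rw [enorm_sq_eq]
  refine lintegral_congr_ae ?_
  filter_upwards [h.fh_fourierMul hf] with ξ e
  rw [e]

theorem HSym.inDomain_of_le {m m' : Plane → ℂ} (h : HSym m) {C : ℝ} {f : L2}
    (hle : ∀ ξ, ‖m ξ‖ ≤ C * ‖m' ξ‖) (hf : InDomain m' f) : InDomain m f := by
  rw [SQG.inDomain_iff] at hf ⊢
  refine MemLp.of_le_mul (c := C) hf (h.meas.mul (measurable_fh f)).aestronglyMeasurable
    (Eventually.of_forall fun ξ => ?_)
  rw [norm_mul, norm_mul, ← mul_assoc]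
  exact mul_le_mul_of_nonneg_right (hle ξ) (norm_nonneg _)

theorem HSym.norm_fourierMul_le {m m' : Plane → ℂ} (h : HSym m) (h' : HSym m') {C : ℝ} {f : L2}
    (hle : ∀ ξ, ‖m ξ‖ ≤ C * ‖m' ξ‖) (hf : InDomain m' f) :
    ‖fourierMul m f‖ ≤ C * ‖fourierMul m' f‖ := by
  rw [← norm_fhat, ← norm_fhat (fourierMul m' f)]
  refine Lp.norm_le_mul_norm_of_ae_le_mul ?_
  filter_upwards [fh_ae (fourierMul m f), fh_ae (fourierMul m' f), h'.fh_fourierMul hf,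
    h.fh_fourierMul (h.inDomain_of_le hle hf)] with ξ h1 h2 h3 h4
  rw [← h1, ← h2, h3, h4, norm_mul, norm_mul, ← mul_assoc]
  exact mul_le_mul_of_nonneg_right (hle ξ) (norm_nonneg _)

theorem HSym.one : HSym (fun _ => (1 : ℂ)) := ⟨measurable_const, by simp⟩

theorem inDomain_one (f : L2) : InDomain (fun _ => (1 : ℂ)) f := by
  rw [SQG.inDomain_iff]; simpa using memLp_fh f

theorem fourierMul_one (f : L2) : fourierMul (fun _ => (1 : ℂ)) f = f := by
  refine ext_fh ?_
  filter_upwards [HSym.one.fh_fourierMul (inDomain_one f)] with ξ h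
  simpa using h

theorem HSym.inDomain_of_bounded {m : Plane → ℂ} (h : HSym m) {C : ℝ} (hle : ∀ ξ, ‖m ξ‖ ≤ C)
    (f : L2) : InDomain m f :=
  h.inDomain_of_le (C := C) (by simpa using hle) (inDomain_one f)

theorem HSym.norm_fourierMul_le_of_bounded {m : Plane → ℂ} (h : HSym m) {C : ℝ}
    (hle : ∀ ξ, ‖m ξ‖ ≤ C) (f : L2) : ‖fourierMul m f‖ ≤ C * ‖f‖ := by
  have := h.norm_fourierMul_le HSym.one (by simpa using hle) (inDomain_one f)
  rwa [fourierMul_one] at this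

theorem HSym.inDomain_add {m : Plane → ℂ} {f g : L2} (hf : InDomain m f)
    (hg : InDomain m g) : InDomain m (f + g) := by
  rw [SQG.inDomain_iff] at *
  refine (memLp_congr_ae ?_).2 (hf.add hg)
  filter_upwards [fh_add f g] with ξ e
  simp [e, mul_add]

theorem HSym.fourierMul_add {m : Plane → ℂ} (h : HSym m) {f g : L2} (hf : InDomain m f)
    (hg : InDomain m g) : fourierMul m (f + g) = fourierMul m f + fourierMul m g := by
  refine ext_fh ?_
  filter_upwards [h.fh_fourierMul (HSym.inDomain_add hf hg), h.fh_fourierMul hf, h.fh_fourierMul hg,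
    fh_add f g, fh_add (fourierMul m f) (fourierMul m g)] with ξ h1 h2 h3 h4 h5
  rw [h1, h5, h2, h3, h4, mul_add]

theorem HSym.inDomain_smul {m : Plane → ℂ} {f : L2} (c : ℝ) (hf : InDomain m f) :
    InDomain m (c • f) := by
  rw [SQG.inDomain_iff] at *
  refine (memLp_congr_ae ?_).2 (hf.const_mul (c : ℂ))
  filter_upwards [fh_smul c f] with ξ e
  simp [e]; ring

theorem HSym.fourierMul_smul {m : Plane → ℂ} (h : HSym m) {f : L2} (c : ℝ) (hf : InDomain m f) :
    fourierMul m (c • f) = c • fourierMul m f := by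
  refine ext_fh ?_
  filter_upwards [h.fh_fourierMul (HSym.inDomain_smul c hf), h.fh_fourierMul hf,
    fh_smul c f, fh_smul c (fourierMul m f)] with ξ h1 h2 h3 h4
  rw [h1, h4, h2, h3]; ring

theorem HSym.inDomain_sub {m : Plane → ℂ} {f g : L2} (hf : InDomain m f)
    (hg : InDomain m g) : InDomain m (f - g) := by
  have := HSym.inDomain_add hf (HSym.inDomain_smul (-1) hg)
  simpa [sub_eq_add_neg] using this

theorem HSym.fourierMul_sub {m : Plane → ℂ} (h : HSym m) {f g : L2} (hf : InDomain m f)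
    (hg : InDomain m g) : fourierMul m (f - g) = fourierMul m f - fourierMul m g := by
  have := h.fourierMul_add hf (HSym.inDomain_smul (-1) hg)
  rw [h.fourierMul_smul _ hg] at this
  simpa [sub_eq_add_neg] using this

theorem RSym.inner_fourierMul_left {m : Plane → ℝ} (h : RSym m) {f g : L2}
    (hf : InDomain (fun ξ => (m ξ : ℂ)) f) (hg : InDomain (fun ξ => (m ξ : ℂ)) g) :
    inner ℝ (fourierMul (fun ξ => (m ξ : ℂ)) f) g
      = inner ℝ f (fourierMul (fun ξ => (m ξ : ℂ)) g) := by
  rw [inner_eq_integral, inner_eq_integral]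
  refine integral_congr_ae ?_
  filter_upwards [h.hSym.fh_fourierMul hf, h.hSym.fh_fourierMul hg] with ξ h1 h2
  rw [h1, h2, map_mul, Complex.conj_ofReal]
  congr 1; ring

/-- The Fourier multiplier with a bounded real even symbol, as a bounded operator. -/
def bmul (m : Plane → ℝ) (h : RSym m) (hb : ∃ C, ∀ ξ, |m ξ| ≤ C) : L2 →L[ℝ] L2 :=
  LinearMap.mkContinuousOfExistsBound
    { toFun := fourierMul (fun ξ => (m ξ : ℂ))
      map_add' := fun f g => h.hSym.fourierMul_add
        (h.hSym.inDomain_of_bounded (by simpa using hb.choose_spec) f)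
        (h.hSym.inDomain_of_bounded (by simpa using hb.choose_spec) g)
      map_smul' := fun c f => h.hSym.fourierMul_smul c
        (h.hSym.inDomain_of_bounded (by simpa using hb.choose_spec) f) }
    (by
      obtain ⟨C, hC⟩ := hb
      exact ⟨C, h.hSym.norm_fourierMul_le_of_bounded
        (by simpa using hC)⟩)

theorem bmul_apply (m : Plane → ℝ) (h : RSym m) (hb : ∃ C, ∀ ξ, |m ξ| ≤ C) (f : L2) :
    bmul m h hb f = fourierMul (fun ξ => (m ξ : ℂ)) f := rfl

theorem RSym.inDomain_of_bounded {m : Plane → ℝ} (h : RSym m) (hb : ∃ C, ∀ ξ, |m ξ| ≤ C) (f : L2) :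
    InDomain (fun ξ => (m ξ : ℂ)) f := by
  obtain ⟨C, hC⟩ := hb
  exact h.hSym.inDomain_of_bounded (C := C) (by simpa using hC) f

theorem fh_bmul (m : Plane → ℝ) (h : RSym m) (hb : ∃ C, ∀ ξ, |m ξ| ≤ C) (f : L2) :
    fh (bmul m h hb f) =ᵐ[volume] fun ξ => m ξ * fh f ξ :=
  h.hSym.fh_fourierMul (h.inDomain_of_bounded hb f)

theorem norm_bmul_le {m : Plane → ℝ} (h : RSym m) (hb : ∃ C, ∀ ξ, |m ξ| ≤ C) {C : ℝ}
    (hC : ∀ ξ, |m ξ| ≤ C) (f : L2) : ‖bmul m h hb f‖ ≤ C * ‖f‖ :=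
  h.hSym.norm_fourierMul_le_of_bounded (by simpa using hC) f

theorem inner_bmul_left {m : Plane → ℝ} (h : RSym m) (hb : ∃ C, ∀ ξ, |m ξ| ≤ C) (f g : L2) :
    inner ℝ (bmul m h hb f) g = inner ℝ f (bmul m h hb g) :=
  h.inner_fourierMul_left (h.inDomain_of_bounded hb f) (h.inDomain_of_bounded hb g)

/-! ### The bracket, the space H³ and its embedding into integrable transforms -/

/-- The Japanese bracket `(1 + |2πξ|²)^{1/2}`. -/
def jp (ξ : Plane) : ℝ := Real.sqrt (1 + (2 * Real.pi * ‖ξ‖) ^ 2)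

theorem jp_sq (ξ : Plane) : jp ξ ^ 2 = 1 + (2 * Real.pi * ‖ξ‖) ^ 2 := Real.sq_sqrt (by positivity)

theorem one_le_jp (ξ : Plane) : 1 ≤ jp ξ := Real.one_le_sqrt.2 (by nlinarith [sq_nonneg (2 * Real.pi * ‖ξ‖)])

theorem jp_pos (ξ : Plane) : 0 < jp ξ := zero_lt_one.trans_le (one_le_jp ξ)

theorem norm_le_jp (ξ : Plane) : 2 * Real.pi * ‖ξ‖ ≤ jp ξ := Real.le_sqrt_of_sq_le (by linarith)

theorem rSym_jp : RSym jp := by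
  refine RSym.of_norm (F := fun r => Real.sqrt (1 + (2 * Real.pi * r) ^ 2)) ?_
  fun_prop

/-- The squares of the brackets differ by the same amount as the squares of 2π|ξ| and 2π|η|.
Factoring both differences and using 2π|ξ| ≤ ⟨ξ⟩ cancels the sum of the brackets. -/
theorem abs_jp_sub_le (ξ η : Plane) : |jp ξ - jp η| ≤ 2 * Real.pi * ‖ξ - η‖ := by
  have h1 : |‖ξ‖ - ‖η‖| ≤ ‖ξ - η‖ := abs_norm_sub_norm_le ξ η
  have h2 := jp_sq ξ
  have h3 := jp_sq η
  have h4 := norm_le_jp ξ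
  have h5 := norm_le_jp η
  have h6 := jp_pos ξ
  have h7 := jp_pos η
  have hpi := Real.pi_pos
  have h8 : (jp ξ - jp η) * (jp ξ + jp η)
      = (2 * Real.pi * ‖ξ‖ - 2 * Real.pi * ‖η‖) * (2 * Real.pi * ‖ξ‖ + 2 * Real.pi * ‖η‖) := by
    linear_combination h2 - h3
  have h9 : |jp ξ - jp η| * (jp ξ + jp η)
      = (2 * Real.pi * |‖ξ‖ - ‖η‖|) * (2 * Real.pi * ‖ξ‖ + 2 * Real.pi * ‖η‖) := by
    have := congrArg abs h8
    rw [abs_mul, abs_mul, abs_of_pos (by linarith : 0 < jp ξ + jp η),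
      abs_of_nonneg (by positivity : 0 ≤ 2 * Real.pi * ‖ξ‖ + 2 * Real.pi * ‖η‖), ← mul_sub, abs_mul,
      abs_of_pos (by positivity : 0 < 2 * Real.pi)] at this
    exact this
  have h10 : |jp ξ - jp η| * (jp ξ + jp η) ≤ (2 * Real.pi * ‖ξ - η‖) * (jp ξ + jp η) := by
    rw [h9]; gcongr
  exact le_of_mul_le_mul_right h10 (by linarith)

/-- Membership in the Sobolev space `H³`. -/
def H3 (f : L2) : Prop := InDomain (fun ξ => ((jp ξ ^ 3 : ℝ) : ℂ)) f

/-- The isomorphism `(1 - Δ)^{3/2}` from `H³` to `L²`. -/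
def J3 (f : L2) : L2 := fourierMul (fun ξ => ((jp ξ ^ 3 : ℝ) : ℂ)) f

theorem hSym_jp3 : HSym (fun ξ => ((jp ξ ^ 3 : ℝ) : ℂ)) := (rSym_jp.pow 3).hSym

theorem fh_J3 {f : L2} (hf : H3 f) : fh (J3 f) =ᵐ[volume] fun ξ => ((jp ξ ^ 3 : ℝ) : ℂ) * fh f ξ :=
  hSym_jp3.fh_fourierMul hf

theorem H3.add {f g : L2} (hf : H3 f) (hg : H3 g) : H3 (f + g) := HSym.inDomain_add hf hg
theorem H3.sub {f g : L2} (hf : H3 f) (hg : H3 g) : H3 (f - g) := HSym.inDomain_sub hf hg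
theorem H3.smul {f : L2} (c : ℝ) (hf : H3 f) : H3 (c • f) := HSym.inDomain_smul c hf
theorem J3_add {f g : L2} (hf : H3 f) (hg : H3 g) : J3 (f + g) = J3 f + J3 g :=
  hSym_jp3.fourierMul_add hf hg
theorem J3_sub {f g : L2} (hf : H3 f) (hg : H3 g) : J3 (f - g) = J3 f - J3 g :=
  hSym_jp3.fourierMul_sub hf hg

theorem hNorm_coe_sq (f : L2) :
    hNorm 3 f ^ 2 = ∫⁻ ξ, ‖((jp ξ ^ 3 : ℝ) : ℂ) * fh f ξ‖ₑ ^ 2 := by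
  have h : MemLp f 2 (volume : Measure Plane) := Lp.memLp f
  rw [hNorm, dif_pos h, ← ENNReal.rpow_natCast, ← ENNReal.rpow_mul]
  norm_num
  refine lintegral_congr_ae ?_
  filter_upwards [fh_ae f] with ξ e
  have hj : ‖(jp ξ : ℂ)‖ₑ = ENNReal.ofReal (jp ξ) := by
    rw [← ofReal_norm, Complex.norm_real, Real.norm_eq_abs, abs_of_pos (jp_pos ξ)]
  rw [← e, ← jp_sq, hj, ← ENNReal.ofReal_pow (jp_pos ξ).le, mul_pow,
    ← ENNReal.ofReal_pow (pow_nonneg (jp_pos ξ).le 3)]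
  congr 2
  ring

theorem hNorm_lt_top_iff (f : L2) : hNorm 3 f < ⊤ ↔ H3 f := by
  rw [H3, hSym_jp3.inDomain_iff, ← hNorm_coe_sq, ENNReal.pow_lt_top_iff]
  simp

theorem hNorm_eq_enorm_J3 {f : L2} (hf : H3 f) : hNorm 3 f = ‖J3 f‖ₑ := by
  have h : hNorm 3 f ^ 2 = ‖J3 f‖ₑ ^ 2 := by
    rw [hNorm_coe_sq, J3, hSym_jp3.enorm_fourierMul_sq hf]
  exact (ENNReal.pow_right_strictMono two_ne_zero).injective h

/-- Young's inequality for the convolution of an integrable and a square integrable function. -/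
theorem lintegral_convolution_sq_le {A B : Plane → ℝ≥0∞} (hA : Measurable A) (hB : Measurable B) :
    ∫⁻ ξ, (∫⁻ η, A (ξ - η) * B η) ^ 2 ≤ (∫⁻ ζ, A ζ) ^ 2 * ∫⁻ η, B η ^ 2 := by
  -- Cauchy–Schwarz for the splitting A B = A^{1/2} · (A^{1/2} B); one full factor ∫ A comes out,
  -- and Tonelli then produces the second.
  have hpt : ∀ ξ, (∫⁻ η, A (ξ - η) * B η) ^ 2 ≤ (∫⁻ ζ, A ζ) * ∫⁻ η, A (ξ - η) * B η ^ 2 := by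
    intro ξ
    have h := ENNReal.lintegral_mul_le_Lp_mul_Lq volume Real.HolderConjugate.two_two
      (f := fun η => A (ξ - η) ^ (1 / 2 : ℝ)) (g := fun η => A (ξ - η) ^ (1 / 2 : ℝ) * B η)
      (by fun_prop) (by fun_prop)
    have e1 : ∀ x : ℝ≥0∞, (x ^ (1 / 2 : ℝ)) ^ (2 : ℝ) = x := fun x => by
      rw [← ENNReal.rpow_mul]; norm_num
    have e2 : ∀ x : ℝ≥0∞, x ^ (1 / 2 : ℝ) * x ^ (1 / 2 : ℝ) = x := fun x => by
      rw [← ENNReal.rpow_add_of_nonneg _ _ (by norm_num) (by norm_num)]; norm_num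
    have e3 : ∀ x y : ℝ≥0∞, (x ^ (1 / 2 : ℝ) * y) ^ (2 : ℝ) = x * y ^ 2 := fun x y => by
      rw [ENNReal.mul_rpow_of_nonneg _ _ (by norm_num), e1]; norm_num
    simp only [Pi.mul_apply, ← mul_assoc, e1, e2, e3] at h
    rw [lintegral_sub_left_eq_self A ξ] at h
    calc (∫⁻ η, A (ξ - η) * B η) ^ 2
        ≤ ((∫⁻ ζ, A ζ) ^ (1 / 2 : ℝ) * (∫⁻ η, A (ξ - η) * B η ^ 2) ^ (1 / 2 : ℝ)) ^ 2 := by gcongr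
      _ = _ := by
        rw [mul_pow]
        congr 1 <;> · rw [← ENNReal.rpow_natCast, ← ENNReal.rpow_mul]; norm_num
  calc ∫⁻ ξ, (∫⁻ η, A (ξ - η) * B η) ^ 2
      ≤ ∫⁻ ξ, (∫⁻ ζ, A ζ) * ∫⁻ η, A (ξ - η) * B η ^ 2 := lintegral_mono hpt
    _ = (∫⁻ ζ, A ζ) * ∫⁻ ξ, ∫⁻ η, A (ξ - η) * B η ^ 2 :=
        lintegral_const_mul _ (Measurable.lintegral_prod_right (by fun_prop))
    _ = (∫⁻ ζ, A ζ) * ∫⁻ η, ∫⁻ ξ, A (ξ - η) * B η ^ 2 := by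
        rw [lintegral_lintegral_swap (by fun_prop)]
    _ = (∫⁻ ζ, A ζ) * ∫⁻ η, (∫⁻ ζ, A ζ) * B η ^ 2 := by
        congr 1
        refine lintegral_congr fun η => ?_
        rw [lintegral_mul_const _ (by fun_prop), lintegral_sub_right_eq_self A η]
    _ = _ := by
        rw [lintegral_const_mul _ (by fun_prop)]; ring

/-- ⟨ξ⟩⁻⁴ is integrable in the plane. These are the two powers of the bracket by which H³ exceeds
the weight ⟨ξ⟩ needed for one derivative. -/
theorem lintegral_jp_lt_top : ∫⁻ ξ : Plane, ENNReal.ofReal ((jp ξ)⁻¹ ^ 2) ^ 2 < ⊤ := by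
  have h : Integrable (fun ξ : Plane => ((1 : ℝ) + ‖ξ‖ ^ 2) ^ (-(4 : ℝ) / 2)) volume :=
    integrable_rpow_neg_one_add_norm_sq (by simp; norm_num)
  refine lt_of_le_of_lt (lintegral_mono fun ξ => ?_) h.lintegral_lt_top
  rw [← ENNReal.ofReal_pow (by positivity)]
  refine ENNReal.ofReal_le_ofReal ?_
  have h1 : ((1 : ℝ) + ‖ξ‖ ^ 2) ^ (-(4 : ℝ) / 2) = ((1 + ‖ξ‖ ^ 2) ^ 2)⁻¹ := by
    rw [show (-(4 : ℝ) / 2) = -((2 : ℕ) : ℝ) by norm_num, Real.rpow_neg (by positivity),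
      Real.rpow_natCast]
  rw [h1, inv_pow, inv_pow, jp_sq]
  have hp : (1 : ℝ) ≤ 2 * Real.pi := by linarith [Real.pi_gt_three]
  have h2 : ‖ξ‖ ≤ 2 * Real.pi * ‖ξ‖ := le_mul_of_one_le_left (norm_nonneg _) hp
  gcongr

/-- The constant of the embedding of `H³` into the functions with integrable
`(1 + |2πξ|²)^{1/2} |f̂|`. -/
def wC : ℝ := ((∫⁻ ξ : Plane, ENNReal.ofReal ((jp ξ)⁻¹ ^ 2) ^ 2) ^ (1 / 2 : ℝ)).toReal

theorem wC_nonneg : 0 ≤ wC := ENNReal.toReal_nonneg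

theorem ofReal_wC : ENNReal.ofReal wC = (∫⁻ ξ : Plane, ENNReal.ofReal ((jp ξ)⁻¹ ^ 2) ^ 2) ^ (1 / 2 : ℝ) :=
  ENNReal.ofReal_toReal (ENNReal.rpow_lt_top_of_nonneg (by norm_num) lintegral_jp_lt_top.ne).ne

theorem measurable_jp : Measurable jp := rSym_jp.meas

/-- Cauchy–Schwarz with ⟨ξ⟩ = ⟨ξ⟩⁻²⟨ξ⟩³. It puts the transforms of f and of its gradient in L¹,
which is the only form of Sobolev embedding needed. -/
theorem lintegral_jp_fh_le {f : L2} (hf : H3 f) :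
    ∫⁻ ξ, ENNReal.ofReal (jp ξ) * ‖fh f ξ‖ₑ ≤ ENNReal.ofReal wC * ‖J3 f‖ₑ := by
  have hm := measurable_jp
  have hm2 := measurable_fh f
  have hm3 := measurable_fh (J3 f)
  have h := ENNReal.lintegral_mul_le_Lp_mul_Lq volume Real.HolderConjugate.two_two
      (f := fun ξ => ENNReal.ofReal ((jp ξ)⁻¹ ^ 2)) (g := fun ξ => ‖fh (J3 f) ξ‖ₑ)
      (by fun_prop) (by fun_prop)
  simp only [ENNReal.rpow_ofNat] at h
  rw [← ofReal_wC, lintegral_fh_rpow] at h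
  refine le_trans (le_of_eq ?_) h
  refine lintegral_congr_ae ?_
  filter_upwards [fh_J3 hf] with ξ e
  have hj := jp_pos ξ
  simp only [Pi.mul_apply]
  rw [e, enorm_mul, ← mul_assoc]
  congr 1
  rw [← ofReal_norm, Complex.norm_real, Real.norm_eq_abs, abs_of_pos (by positivity),
    ← ENNReal.ofReal_mul (by positivity)]
  congr 1
  field_simp

theorem lintegral_fh_le {f : L2} (hf : H3 f) :
    ∫⁻ ξ, ‖fh f ξ‖ₑ ≤ ENNReal.ofReal wC * ‖J3 f‖ₑ := by
  refine le_trans (lintegral_mono fun ξ => ?_) (lintegral_jp_fh_le hf)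
  exact le_mul_of_one_le_left zero_le (by simpa using one_le_jp ξ)

theorem H3.integrable_fh {f : L2} (hf : H3 f) : Integrable (fh f) :=
  ⟨(measurable_fh f).aestronglyMeasurable,
    (lintegral_fh_le hf).trans_lt (ENNReal.mul_lt_top (by simp) (by simp))⟩

theorem lintegral_norm_fh_le {f : L2} (hf : H3 f) :
    ∫⁻ ξ, ENNReal.ofReal (2 * Real.pi * ‖ξ‖) * ‖fh f ξ‖ₑ ≤ ENNReal.ofReal wC * ‖J3 f‖ₑ := by
  refine le_trans (lintegral_mono fun ξ => ?_) (lintegral_jp_fh_le hf)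
  gcongr
  exact norm_le_jp ξ

/-! ### The nonlinearity as a bilinear form on the Fourier side -/

/-- The planar cross product. -/
def cross (ξ η : Plane) : ℝ := ξ 0 * η 1 - ξ 1 * η 0

theorem norm_sq_plane (ξ : Plane) : ‖ξ‖ ^ 2 = ξ 0 ^ 2 + ξ 1 ^ 2 := by
  rw [EuclideanSpace.norm_sq_eq]; simp [Fin.sum_univ_two]

theorem abs_cross_le (ξ η : Plane) : |cross ξ η| ≤ ‖ξ‖ * ‖η‖ := by
  refine abs_le_of_sq_le_sq ?_ (by positivity)
  rw [mul_pow, norm_sq_plane, norm_sq_plane, cross]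
  nlinarith [sq_nonneg (ξ 0 * η 0 + ξ 1 * η 1)]

theorem cross_sub_left (ξ η : Plane) : cross (ξ - η) η = cross ξ η := by simp [cross]; ring

theorem measurable_cross : Measurable fun p : Plane × Plane => cross p.1 p.2 := by
  unfold cross; fun_prop

/-- The kernel of the bilinear form `(f, h) ↦ ∇^⊥ (-Δ)^{-1/2} f · ∇ h` on the Fourier side. -/
def ker (ξ η : Plane) : ℝ := 2 * Real.pi * cross ξ η / ‖ξ - η‖

theorem measurable_ker : Measurable fun p : Plane × Plane => ker p.1 p.2 := by
  unfold ker
  exact (measurable_cross.const_mul _).div (by fun_prop)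

/-- The cross product ignores the component of ξ along η, so ξ may be replaced by ξ − η, whose
length cancels the denominator: the velocity operator has order zero. -/
theorem abs_ker_le (ξ η : Plane) : |ker ξ η| ≤ 2 * Real.pi * ‖η‖ := by
  rw [ker, abs_div, abs_mul, abs_norm, abs_of_pos (by positivity), ← cross_sub_left]
  refine div_le_of_le_mul₀ (norm_nonneg _) (by positivity) ?_
  have := abs_cross_le (ξ - η) η
  calc 2 * Real.pi * |cross (ξ - η) η| ≤ 2 * Real.pi * (‖ξ - η‖ * ‖η‖) := by gcongr
    _ = _ := by ring

/-- Incompressibility of the velocity in Fourier form; every cancellation in the energy estimates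
comes from this sign. -/
theorem ker_swap (ξ η : Plane) : ker η ξ = -ker ξ η := by
  rw [ker, ker, norm_sub_rev]; simp [cross]; ring

theorem ker_neg (ξ η : Plane) : ker (-ξ) (-η) = ker ξ η := by
  have h : -ξ - -η = -(ξ - η) := by abel
  rw [ker, ker, h, norm_neg]; simp [cross]

/-- The Fourier transform of `∇^⊥ (-Δ)^{-1/2} f · ∇ h`. -/
def advHat (f h : L2) (ξ : Plane) : ℂ := ∫ η, (ker ξ η : ℂ) * (fh f (ξ - η) * fh h η)

theorem measurable_advIntegrand (f h : L2) :
    Measurable fun p : Plane × Plane => (ker p.1 p.2 : ℂ) * (fh f (p.1 - p.2) * fh h p.2) := by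
  have h1 := measurable_fh f
  have h2 := measurable_fh h
  have h3 := measurable_ker
  exact (Complex.measurable_ofReal.comp h3).mul
    ((h1.comp (measurable_fst.sub measurable_snd)).mul (h2.comp measurable_snd))

theorem measurable_advHat (f h : L2) : Measurable (advHat f h) :=
  ((measurable_advIntegrand f h).stronglyMeasurable.integral_prod_right).measurable

theorem enorm_advIntegrand_le (f h : L2) (ξ η : Plane) :
    ‖(ker ξ η : ℂ) * (fh f (ξ - η) * fh h η)‖ₑ ≤
      ‖fh f (ξ - η)‖ₑ * (ENNReal.ofReal (2 * Real.pi * ‖η‖) * ‖fh h η‖ₑ) := by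
  rw [enorm_mul, enorm_mul, mul_left_comm]
  gcongr
  rw [← ofReal_norm, Complex.norm_real]
  exact ENNReal.ofReal_le_ofReal (abs_ker_le ξ η)

theorem enorm_advHat_le (f h : L2) (ξ : Plane) :
    ‖advHat f h ξ‖ₑ ≤
      ∫⁻ η, ‖fh f (ξ - η)‖ₑ * (ENNReal.ofReal (2 * Real.pi * ‖η‖) * ‖fh h η‖ₑ) :=
  (enorm_integral_le_lintegral_enorm _).trans (lintegral_mono fun η => enorm_advIntegrand_le f h ξ η)

/-- Young's inequality with the velocity factor in L¹ of frequency and the gradient in L². -/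
theorem lintegral_advHat_sq_le (f h : L2) :
    ∫⁻ ξ, ‖advHat f h ξ‖ₑ ^ 2 ≤ (∫⁻ ζ, ‖fh f ζ‖ₑ) ^ 2 *
      ∫⁻ η, (ENNReal.ofReal (2 * Real.pi * ‖η‖) * ‖fh h η‖ₑ) ^ 2 := by
  have h1 := measurable_fh f
  have h2 := measurable_fh h
  refine le_trans (lintegral_mono fun ξ => ?_) (lintegral_convolution_sq_le (by fun_prop) (by fun_prop))
  gcongr
  exact enorm_advHat_le f h ξ

/-- The opposite distribution: the gradient of h in L¹ of frequency and f only in L². It is what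
allows differences of solutions to be compared in L². -/
theorem lintegral_advHat_sq_le' (f h : L2) :
    ∫⁻ ξ, ‖advHat f h ξ‖ₑ ^ 2 ≤ (∫⁻ η, ENNReal.ofReal (2 * Real.pi * ‖η‖) * ‖fh h η‖ₑ) ^ 2 *
      ∫⁻ ζ, ‖fh f ζ‖ₑ ^ 2 := by
  have h1 := measurable_fh f
  have h2 := measurable_fh h
  refine le_trans (lintegral_mono fun ξ => ?_) (lintegral_convolution_sq_le (by fun_prop) (by fun_prop))
  gcongr
  refine (enorm_advHat_le f h ξ).trans (le_of_eq ?_)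
  rw [← lintegral_sub_left_eq_self _ ξ]
  refine lintegral_congr fun η => ?_
  rw [sub_sub_cancel, mul_comm]

theorem conj_advHat_neg (f h : L2) (ξ : Plane) : conj (advHat f h (-ξ)) = advHat f h ξ := by
  rw [advHat, advHat, ← integral_conj, ← integral_comp_neg']
  refine integral_congr_ae (Eventually.of_forall fun η => ?_)
  have : -ξ - -η = -(ξ - η) := by abel
  simp only [ker_neg, this, fh_neg, map_mul, Complex.conj_conj, Complex.conj_ofReal]

open scoped Classical in
/-- The bilinear form `∇^⊥ (-Δ)^{-1/2} f · ∇ h`, defined on the Fourier side. -/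
def adv (f h : L2) : L2 := if hm : MemLp (advHat f h) 2 volume then ofHat _ hm else 0

theorem norm_mul_fh_le_J3 {f : L2} (hf : H3 f) :
    ∫⁻ η, (ENNReal.ofReal (2 * Real.pi * ‖η‖) * ‖fh f η‖ₑ) ^ 2 ≤ ‖J3 f‖ₑ ^ 2 := by
  rw [enorm_sq_eq]
  refine lintegral_mono_ae ?_
  filter_upwards [fh_J3 hf] with ξ e
  rw [e, enorm_mul]
  gcongr
  rw [← ofReal_norm, Complex.norm_real, Real.norm_eq_abs, abs_of_pos (pow_pos (jp_pos ξ) 3)]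
  refine ENNReal.ofReal_le_ofReal ((norm_le_jp ξ).trans ?_)
  exact le_self_pow₀ (one_le_jp ξ) (by norm_num)

theorem memLp_advHat {f h : L2} (hf : H3 f) (hh : H3 h) : MemLp (advHat f h) 2 volume := by
  rw [memLp_two_iff (measurable_advHat f h)]
  refine (lintegral_advHat_sq_le f h).trans_lt (ENNReal.mul_lt_top ?_ ?_)
  · exact ENNReal.pow_lt_top hf.integrable_fh.2
  · exact (norm_mul_fh_le_J3 hh).trans_lt (ENNReal.pow_lt_top (by simp))

theorem fh_adv {f h : L2} (hf : H3 f) (hh : H3 h) : fh (adv f h) =ᵐ[volume] advHat f h := by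
  rw [adv, dif_pos (memLp_advHat hf hh)]
  exact fh_ofHat _ (Eventually.of_forall fun ξ => conj_advHat_neg f h ξ)

theorem enorm_adv_le' {f h : L2} (hf : H3 f) (hh : H3 h) :
    ‖adv f h‖ₑ ^ 2 ≤ (∫⁻ η, ENNReal.ofReal (2 * Real.pi * ‖η‖) * ‖fh h η‖ₑ) ^ 2 * ‖f‖ₑ ^ 2 := by
  rw [enorm_sq_eq, enorm_sq_eq f]
  refine le_trans (le_of_eq (lintegral_congr_ae ?_)) (lintegral_advHat_sq_le' f h)
  filter_upwards [fh_adv hf hh] with ξ e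
  rw [e]

theorem norm_adv_le' {f h : L2} (hf : H3 f) (hh : H3 h) : ‖adv f h‖ ≤ wC * ‖J3 h‖ * ‖f‖ := by
  have h1 : ‖adv f h‖ₑ ^ 2 ≤ (ENNReal.ofReal wC * ‖J3 h‖ₑ * ‖f‖ₑ) ^ 2 := by
    refine (enorm_adv_le' hf hh).trans ?_
    rw [mul_pow]
    gcongr
    exact lintegral_norm_fh_le hh
  have h2 := (ENNReal.pow_right_strictMono two_ne_zero).le_iff_le.1 h1
  rw [← ofReal_norm, ← ofReal_norm, ← ofReal_norm, ← ENNReal.ofReal_mul wC_nonneg,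
    ← ENNReal.ofReal_mul (mul_nonneg wC_nonneg (norm_nonneg _))] at h2
  exact (ENNReal.ofReal_le_ofReal_iff (mul_nonneg (mul_nonneg wC_nonneg (norm_nonneg _))
    (norm_nonneg _))).1 h2

/-- For `f ∈ H³` the integral defining `advHat f h ξ` converges for almost every `ξ`. -/
theorem integrable_advIntegrand {f h : L2} (hf : H3 f) (hh : H3 h) :
    ∀ᵐ ξ : Plane, Integrable fun η => (ker ξ η : ℂ) * (fh f (ξ - η) * fh h η) := by
  have h1 := measurable_fh f
  have h2 := measurable_fh h
  have h3 : ∫⁻ ξ, (∫⁻ η, ‖fh f (ξ - η)‖ₑ * (ENNReal.ofReal (2 * Real.pi * ‖η‖) * ‖fh h η‖ₑ)) ^ 2 < ⊤ := by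
    refine (lintegral_convolution_sq_le (by fun_prop) (by fun_prop)).trans_lt
      (ENNReal.mul_lt_top (ENNReal.pow_lt_top hf.integrable_fh.2)
        ((norm_mul_fh_le_J3 hh).trans_lt (ENNReal.pow_lt_top (by simp))))
  have h4 := ae_lt_top (Measurable.pow_const (Measurable.lintegral_prod_right (by fun_prop)) 2) h3.ne
  filter_upwards [h4] with ξ hξ
  refine ⟨((measurable_advIntegrand f h).comp measurable_prodMk_left).aestronglyMeasurable, ?_⟩
  refine (lintegral_mono fun η => enorm_advIntegrand_le f h ξ η).trans_lt ?_
  exact (ENNReal.pow_lt_top_iff.1 hξ).resolve_right (by norm_num)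

theorem adv_add_left {f f' h : L2} (hf : H3 f) (hf' : H3 f') (hh : H3 h) :
    adv (f + f') h = adv f h + adv f' h := by
  refine ext_fh ?_
  have hq := fun ξ : Plane => (Measure.measurePreserving_sub_left volume ξ).quasiMeasurePreserving
  filter_upwards [fh_adv (hf.add hf') hh, fh_adv hf hh, fh_adv hf' hh, fh_add (adv f h) (adv f' h),
    integrable_advIntegrand hf hh, integrable_advIntegrand hf' hh] with ξ h1 h2 h3 h4 h5 h6
  rw [h1, h4, h2, h3, advHat, advHat, advHat, ← integral_add h5 h6]
  refine integral_congr_ae ?_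
  filter_upwards [(hq ξ).ae (fh_add f f')] with η e
  rw [e]; ring

theorem adv_add_right {f h h' : L2} (hf : H3 f) (hh : H3 h) (hh' : H3 h') :
    adv f (h + h') = adv f h + adv f h' := by
  refine ext_fh ?_
  filter_upwards [fh_adv hf (hh.add hh'), fh_adv hf hh, fh_adv hf hh', fh_add (adv f h) (adv f h'),
    integrable_advIntegrand hf hh, integrable_advIntegrand hf hh'] with ξ h1 h2 h3 h4 h5 h6
  rw [h1, h4, h2, h3, advHat, advHat, advHat, ← integral_add h5 h6]
  refine integral_congr_ae ?_
  filter_upwards [fh_add h h'] with η e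
  rw [e]; ring

theorem adv_smul_left {f h : L2} (c : ℝ) (hf : H3 f) (hh : H3 h) :
    adv (c • f) h = c • adv f h := by
  refine ext_fh ?_
  have hq := fun ξ : Plane => (Measure.measurePreserving_sub_left volume ξ).quasiMeasurePreserving
  filter_upwards [fh_adv (hf.smul c) hh, fh_adv hf hh, fh_smul c (adv f h)] with ξ h1 h2 h4
  rw [h1, h4, h2, advHat, advHat, ← integral_const_mul]
  refine integral_congr_ae ?_
  filter_upwards [(hq ξ).ae (fh_smul c f)] with η e
  rw [e]; ring

theorem adv_smul_right {f h : L2} (c : ℝ) (hf : H3 f) (hh : H3 h) :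
    adv f (c • h) = c • adv f h := by
  refine ext_fh ?_
  filter_upwards [fh_adv hf (hh.smul c), fh_adv hf hh, fh_smul c (adv f h)] with ξ h1 h2 h4
  rw [h1, h4, h2, advHat, advHat, ← integral_const_mul]
  refine integral_congr_ae ?_
  filter_upwards [fh_smul c h] with η e
  rw [e]; ring

theorem adv_sub_left {f f' h : L2} (hf : H3 f) (hf' : H3 f') (hh : H3 h) :
    adv (f - f') h = adv f h - adv f' h := by
  rw [sub_eq_add_neg, ← neg_one_smul ℝ f', adv_add_left hf (hf'.smul _) hh, adv_smul_left _ hf' hh,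
    neg_one_smul, ← sub_eq_add_neg]

theorem adv_sub_right {f h h' : L2} (hf : H3 f) (hh : H3 h) (hh' : H3 h') :
    adv f (h - h') = adv f h - adv f h' := by
  rw [sub_eq_add_neg, ← neg_one_smul ℝ h', adv_add_right hf hh (hh'.smul _), adv_smul_right _ hf hh',
    neg_one_smul, ← sub_eq_add_neg]

/-! ### The bilinear form in physical space -/

theorem hSym_riesz (j : Fin 2) : HSym (fun ξ : Plane => Complex.I * ((ξ j / ‖ξ‖ : ℝ) : ℂ)) where
  meas := by fun_prop
  herm ξ := by simp; ring

theorem hSym_partialD (j : Fin 2) :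
    HSym (fun ξ : Plane => 2 * Real.pi * Complex.I * ((ξ j : ℝ) : ℂ)) where
  meas := by fun_prop
  herm ξ := by simp [map_ofNat]

theorem abs_coord_le (ξ : Plane) (j : Fin 2) : |ξ j| ≤ ‖ξ‖ := by
  simpa using PiLp.norm_apply_le ξ j

theorem norm_riesz_symbol_le (j : Fin 2) (ξ : Plane) :
    ‖Complex.I * ((ξ j / ‖ξ‖ : ℝ) : ℂ)‖ ≤ 1 := by
  rw [norm_mul, Complex.norm_I, one_mul, Complex.norm_real, norm_div, norm_norm, Real.norm_eq_abs]
  exact div_le_one_of_le₀ (abs_coord_le ξ j) (norm_nonneg _)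

theorem norm_partialD_symbol_le (j : Fin 2) (ξ : Plane) :
    ‖2 * Real.pi * Complex.I * ((ξ j : ℝ) : ℂ)‖ ≤ 2 * Real.pi * ‖ξ‖ := by
  have h := abs_coord_le ξ j
  simp only [norm_mul, Complex.norm_I, mul_one, Complex.norm_real, Real.norm_eq_abs,
    Complex.norm_ofNat, abs_of_pos Real.pi_pos]
  gcongr

theorem norm_jp3 (ξ : Plane) : ‖((jp ξ ^ 3 : ℝ) : ℂ)‖ = jp ξ ^ 3 := by
  rw [Complex.norm_real, Real.norm_eq_abs, abs_of_pos (pow_pos (jp_pos ξ) 3)]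

theorem jp_le_pow (ξ : Plane) : jp ξ ≤ jp ξ ^ 3 := le_self_pow₀ (one_le_jp ξ) (by norm_num)

theorem inDomain_riesz (j : Fin 2) (f : L2) :
    InDomain (fun ξ : Plane => Complex.I * ((ξ j / ‖ξ‖ : ℝ) : ℂ)) f :=
  (hSym_riesz j).inDomain_of_bounded (norm_riesz_symbol_le j) f

theorem H3.inDomain_partialD {f : L2} (hf : H3 f) (j : Fin 2) :
    InDomain (fun ξ : Plane => 2 * Real.pi * Complex.I * ((ξ j : ℝ) : ℂ)) f := by
  refine (hSym_partialD j).inDomain_of_le (C := 1) (fun ξ => ?_) hf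
  rw [norm_jp3, one_mul]
  exact (norm_partialD_symbol_le j ξ).trans ((norm_le_jp ξ).trans (jp_le_pow ξ))

theorem fh_riesz (j : Fin 2) (f : L2) :
    fh (riesz j f) =ᵐ[volume] fun ξ => Complex.I * ((ξ j / ‖ξ‖ : ℝ) : ℂ) * fh f ξ :=
  (hSym_riesz j).fh_fourierMul (inDomain_riesz j f)

theorem fh_partialD {f : L2} (hf : H3 f) (j : Fin 2) :
    fh (partialD j f) =ᵐ[volume] fun ξ => 2 * Real.pi * Complex.I * ((ξ j : ℝ) : ℂ) * fh f ξ :=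
  (hSym_partialD j).fh_fourierMul (hf.inDomain_partialD j)

theorem H3.integrable_fh_riesz {f : L2} (hf : H3 f) (j : Fin 2) : Integrable (fh (riesz j f)) := by
  refine hf.integrable_fh.mono (measurable_fh _).aestronglyMeasurable ?_
  filter_upwards [fh_riesz j f] with ξ e
  rw [e, norm_mul]
  exact mul_le_of_le_one_left (norm_nonneg _) (norm_riesz_symbol_le j ξ)

theorem H3.integrable_jp_fh {f : L2} (hf : H3 f) : Integrable (fun ξ => (jp ξ : ℂ) * fh f ξ) := by
  refine ⟨((Complex.measurable_ofReal.comp measurable_jp).mul (measurable_fh f)).aestronglyMeasurable, ?_⟩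
  refine lt_of_le_of_lt (le_of_eq (lintegral_congr fun ξ => ?_))
    ((lintegral_jp_fh_le hf).trans_lt (ENNReal.mul_lt_top (by simp) (by simp)))
  rw [enorm_mul, ← ofReal_norm, Complex.norm_real, Real.norm_eq_abs, abs_of_pos (jp_pos ξ)]

theorem H3.integrable_fh_partialD {f : L2} (hf : H3 f) (j : Fin 2) :
    Integrable (fh (partialD j f)) := by
  refine hf.integrable_jp_fh.mono (measurable_fh _).aestronglyMeasurable ?_
  filter_upwards [fh_partialD hf j] with ξ e
  rw [e, norm_mul _ (fh f ξ), norm_mul _ (fh f ξ)]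
  refine mul_le_mul_of_nonneg_right ?_ (norm_nonneg _)
  rw [Complex.norm_real, Real.norm_eq_abs, abs_of_pos (jp_pos ξ)]
  exact (norm_partialD_symbol_le j ξ).trans (norm_le_jp ξ)

open scoped Convolution in
-- The convolution theorem for the forward transform, read at −x.
theorem mul_ae_eq_fourierInv {p q : L2} (hp : Integrable (fh p)) (hq : Integrable (fh q)) :
    ∀ᵐ x : Plane, ((p x : ℝ) : ℂ) * ((q x : ℝ) : ℂ)
      = 𝓕⁻ (fh q ⋆[ContinuousLinearMap.mul ℂ ℂ] fh p) x := by
  filter_upwards [ofReal_ae_eq_fourierInv p hp, ofReal_ae_eq_fourierInv q hq] with x h1 h2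
  rw [h1, h2, Real.fourierInv_eq_fourier_neg, Real.fourierInv_eq_fourier_neg,
    Real.fourierInv_eq_fourier_neg, Real.fourier_mul_convolution_eq hq hp, mul_comm]

open scoped Convolution in
/-- The bilinear form `adv` is the pointwise product of the velocity and the gradient. -/
theorem adv_ae {f h : L2} (hf : H3 f) (hh : H3 h) :
    ∀ᵐ x : Plane, adv f h x = inner ℝ (velocity f x) (grad h x) := by
  have i1 := hf.integrable_fh_riesz 1
  have i0 := hf.integrable_fh_riesz 0
  have d0 := hh.integrable_fh_partialD 0
  have d1 := hh.integrable_fh_partialD 1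
  have c1 := d0.integrable_convolution (ContinuousLinearMap.mul ℂ ℂ) i1
  have c2 := d1.integrable_convolution (ContinuousLinearMap.mul ℂ ℂ) i0
  have key : fh (adv f h) =ᵐ[volume] fun ξ =>
      (fh (partialD 0 h) ⋆[ContinuousLinearMap.mul ℂ ℂ] fh (riesz 1 f)) ξ
      - (fh (partialD 1 h) ⋆[ContinuousLinearMap.mul ℂ ℂ] fh (riesz 0 f)) ξ := by
    filter_upwards [fh_adv hf hh, d0.ae_convolution_exists (ContinuousLinearMap.mul ℂ ℂ) i1,
      d1.ae_convolution_exists (ContinuousLinearMap.mul ℂ ℂ) i0] with ξ e1 e2 e3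
    rw [e1, advHat, convolution, convolution, ← integral_sub e2 e3]
    have hq := (Measure.measurePreserving_sub_left volume ξ).quasiMeasurePreserving
    refine integral_congr_ae ?_
    filter_upwards [hq.ae (fh_riesz 0 f), hq.ae (fh_riesz 1 f), fh_partialD hh 0,
      fh_partialD hh 1] with η h1 h2 h3 h4
    simp only [ContinuousLinearMap.mul_apply', h1, h2, h3, h4]
    rw [ker, ← cross_sub_left, cross]
    push_cast
    -- The factor i of the Riesz symbol and the factor i of the derivative multiply to −1, which
    -- gives the cross product its sign.
    linear_combination (-(2 * Real.pi * fh h η * fh f (ξ - η)) * ((((ξ - η) 1 : ℝ) : ℂ) * ((η 0 : ℝ) : ℂ)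
      - (((ξ - η) 0 : ℝ) : ℂ) * ((η 1 : ℝ) : ℂ)) / ((‖ξ - η‖ : ℝ) : ℂ)) * Complex.I_mul_I
  have hInt : Integrable (fh (adv f h)) := (c1.sub c2).congr key.symm
  filter_upwards [ofReal_ae_eq_fourierInv _ hInt, mul_ae_eq_fourierInv i1 d0,
    mul_ae_eq_fourierInv i0 d1] with x h1 h2 h3
  have h4 : 𝓕⁻ (fh (adv f h)) x
      = 𝓕⁻ (fh (partialD 0 h) ⋆[ContinuousLinearMap.mul ℂ ℂ] fh (riesz 1 f)) x
      - 𝓕⁻ (fh (partialD 1 h) ⋆[ContinuousLinearMap.mul ℂ ℂ] fh (riesz 0 f)) x := by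
    rw [Real.fourierInv_congr_ae key, Real.fourierInv_eq, Real.fourierInv_eq, Real.fourierInv_eq,
      ← integral_sub]
    · simp only [smul_sub]
    · simpa [inner_neg_right] using (Real.fourierIntegral_convergent_iff (-x)).2 c1
    · simpa [inner_neg_right] using (Real.fourierIntegral_convergent_iff (-x)).2 c2
  rw [← h2, ← h3, ← h1] at h4
  have h5 : adv f h x = riesz 1 f x * partialD 0 h x - riesz 0 f x * partialD 1 h x := by
    exact_mod_cast h4
  rw [h5, velocity, grad]
  simp [PiLp.inner_apply, Fin.sum_univ_two]
  ring

theorem advection_ae {f : L2} (hf : H3 f) : advection f =ᵐ[volume] adv f f := by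
  filter_upwards [adv_ae hf hf] with x hx
  rw [hx]; rfl

/-! ### Symmetrization and the commutator estimate -/

theorem enorm_ofReal_abs (r : ℝ) : ‖r‖ₑ = ENNReal.ofReal |r| := by
  rw [← ofReal_norm, Real.norm_eq_abs]

/-- The symmetrized energy form. -/
theorem two_mul_inner_adv_le {f h : L2} (hf : H3 f) (hh : H3 h) {m : Plane → ℝ} (hm : RSym m)
    (hb : ∃ C, ∀ ξ, |m ξ| ≤ C) :
    ‖2 * inner ℝ (adv f h) (bmul m hm hb h)‖ₑ ≤ ∫⁻ ξ, ∫⁻ η,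
      ENNReal.ofReal (|ker ξ η| * |m ξ - m η|) * (‖fh f (ξ - η)‖ₑ * ‖fh h η‖ₑ * ‖fh h ξ‖ₑ) := by
  set G : Plane × Plane → ℂ := fun p =>
    (ker p.1 p.2 : ℂ) * (fh f (p.1 - p.2) * fh h p.2) * conj (fh h p.1) with hG
  have mf := measurable_fh f
  have mh := measurable_fh h
  have mG : Measurable G := (measurable_advIntegrand f h).mul
    (Complex.continuous_conj.measurable.comp (mh.comp measurable_fst))
  -- Absolute convergence of the trilinear integral; it justifies Fubini and the exchange of the two
  -- frequencies below.
  have iG : Integrable G (volume.prod volume) := by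
    refine ⟨mG.aestronglyMeasurable, ?_⟩
    rw [HasFiniteIntegral, lintegral_prod _ mG.enorm.aemeasurable]
    have hle := lintegral_trilinear_le (A := fun ζ => ‖fh f ζ‖ₑ)
      (B := fun η => ENNReal.ofReal (2 * Real.pi * ‖η‖) * ‖fh h η‖ₑ) (D := fun ξ => ‖fh h ξ‖ₑ)
      (by fun_prop) (by fun_prop) (by fun_prop)
    refine lt_of_le_of_lt ((lintegral_mono fun ξ => lintegral_mono fun η => ?_).trans hle) ?_
    · rw [hG, enorm_mul, RCLike.enorm_conj]
      gcongr
      exact enorm_advIntegrand_le f h ξ η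
    · refine ENNReal.mul_lt_top hf.integrable_fh.2 (ENNReal.mul_lt_top ?_ ?_)
      · exact ENNReal.rpow_lt_top_of_nonneg (by norm_num)
          ((norm_mul_fh_le_J3 hh).trans_lt (ENNReal.pow_lt_top (by simp))).ne
      · rw [lintegral_fh_rpow]; simp
  have hbd : ∀ ξ, ‖(m ξ : ℂ)‖ ≤ hb.choose := by simpa using hb.choose_spec
  have i1 : Integrable (fun p => (m p.1 : ℂ) * G p) (volume.prod volume) :=
    iG.bdd_mul ((Complex.measurable_ofReal.comp (hm.meas.comp measurable_fst))).aestronglyMeasurable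
      (Eventually.of_forall fun p => hbd p.1)
  have i2 : Integrable (fun p => (m p.2 : ℂ) * G p) (volume.prod volume) :=
    iG.bdd_mul ((Complex.measurable_ofReal.comp (hm.meas.comp measurable_snd))).aestronglyMeasurable
      (Eventually.of_forall fun p => hbd p.2)
  have e1 : inner ℝ (adv f h) (bmul m hm hb h)
      = (∫ p, (m p.1 : ℂ) * G p ∂(volume.prod volume)).re := by
    rw [integral_prod _ i1, inner_eq_integral]
    have hre := integral_re (𝕜 := ℂ) i1.integral_prod_left
    simp only [RCLike.re_to_complex] at hre
    rw [← hre]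
    refine integral_congr_ae ?_
    filter_upwards [fh_adv hf hh, fh_bmul m hm hb h] with ξ h1 h2
    have h3 : ∫ η, (m ξ : ℂ) * G (ξ, η) = (m ξ : ℂ) * (advHat f h ξ * conj (fh h ξ)) := by
      rw [integral_const_mul, advHat, ← integral_mul_const]
    rw [h1, h2, h3, ← Complex.conj_re]
    congr 1
    simp only [map_mul, Complex.conj_conj, Complex.conj_ofReal]
    ring
  -- Exchanging the frequencies flips the sign of the kernel and conjugates the product of the
  -- transforms, so G is anti-Hermitian under the swap and the weight moves from ξ to η with a minus
  -- sign. Averaging both forms leaves m ξ − m η.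
  have e2 : (∫ p, (m p.1 : ℂ) * G p ∂(volume.prod volume)).re
      = -(∫ p, (m p.2 : ℂ) * G p ∂(volume.prod volume)).re := by
    rw [← integral_prod_swap]
    have : ∀ p : Plane × Plane, (m p.swap.1 : ℂ) * G p.swap = -conj ((m p.2 : ℂ) * G p) := by
      rintro ⟨ξ, η⟩
      have : η - ξ = -(ξ - η) := by abel
      simp only [hG, Prod.swap_prod_mk, ker_swap ξ η, this, fh_neg, map_mul, Complex.conj_conj,
        Complex.conj_ofReal]
      push_cast
      ring
    simp only [this]
    rw [integral_neg, integral_conj, Complex.neg_re, Complex.conj_re]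
  have e3 : 2 * inner ℝ (adv f h) (bmul m hm hb h)
      = (∫ p, ((m p.1 : ℂ) * G p - (m p.2 : ℂ) * G p) ∂(volume.prod volume)).re := by
    rw [integral_sub i1 i2, Complex.sub_re, e1]
    linarith
  have e4 : ‖2 * inner ℝ (adv f h) (bmul m hm hb h)‖ₑ
      ≤ ‖∫ p, ((m p.1 : ℂ) * G p - (m p.2 : ℂ) * G p) ∂(volume.prod volume)‖ₑ := by
    rw [e3, ← ofReal_norm, ← ofReal_norm]
    exact ENNReal.ofReal_le_ofReal (Complex.abs_re_le_norm _)
  refine (e4.trans (enorm_integral_le_lintegral_enorm _)).trans (le_of_eq ?_)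
  rw [lintegral_prod _ (by
    exact (((Complex.measurable_ofReal.comp (hm.meas.comp measurable_fst)).mul mG).sub
      ((Complex.measurable_ofReal.comp (hm.meas.comp measurable_snd)).mul mG)).enorm.aemeasurable)]
  refine lintegral_congr fun ξ => lintegral_congr fun η => ?_
  rw [← sub_mul, hG, enorm_mul, enorm_mul, enorm_mul, enorm_mul, RCLike.enorm_conj,
    ← Complex.ofReal_sub, ← ofReal_norm (((m ξ - m η : ℝ) : ℂ)), ← ofReal_norm ((ker ξ η : ℂ)),
    Complex.norm_real, Complex.norm_real, Real.norm_eq_abs, Real.norm_eq_abs,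
    ENNReal.ofReal_mul (abs_nonneg _)]
  ring

/-- For a constant weight the difference m ξ − m η in the symmetrized form vanishes: transport by a
divergence-free field is skew-symmetric. -/
theorem inner_adv_self {f h : L2} (hf : H3 f) (hh : H3 h) : inner ℝ (adv f h) h = 0 := by
  have hb : ∃ C, ∀ ξ : Plane, |(fun _ => (1 : ℝ)) ξ| ≤ C := ⟨1, by simp⟩
  have := two_mul_inner_adv_le hf hh (RSym.const 1) hb
  have e : bmul (fun _ => 1) (RSym.const 1) hb h = h := by
    rw [bmul_apply]; simpa using fourierMul_one h
  rw [e] at this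
  simpa using this

/-- The weight `(|2πξ| (1 + |2πξ|²)^{5/2})^{1/2}`. -/
def sw (ξ : Plane) : ℝ := Real.sqrt (2 * Real.pi * ‖ξ‖ * jp ξ ^ 5)

theorem sw_nonneg (ξ : Plane) : 0 ≤ sw ξ := Real.sqrt_nonneg _

theorem sw_neg (ξ : Plane) : sw (-ξ) = sw ξ := by rw [sw, sw, norm_neg, rSym_jp.even]

theorem measurable_sw : Measurable sw := by
  have := measurable_jp
  unfold sw
  fun_prop

theorem jp_le_two_mul {ξ η : Plane} (h : ‖ξ‖ ≤ 2 * ‖η‖) : jp ξ ≤ 2 * jp η := by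
  have h1 := jp_sq ξ
  have h2 := jp_sq η
  refine le_of_sq_le_sq ?_ (by have := jp_pos η; positivity)
  rw [mul_pow, h1, h2]
  have : ‖ξ‖ ^ 2 ≤ (2 * ‖η‖) ^ 2 := by gcongr
  have hp : 0 ≤ (2 * Real.pi) ^ 2 := by positivity
  nlinarith [mul_le_mul_of_nonneg_left this hp]

/-- Comparing squares removes the square roots in `sw`. -/
theorem le_mul_sw {x y : Plane} {a c : ℝ} (hc : 0 ≤ c)
    (h : a ^ 2 ≤ c ^ 2 * ((2 * Real.pi * ‖x‖ * jp x ^ 5) * (2 * Real.pi * ‖y‖ * jp y ^ 5))) :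
    a ≤ c * (sw x * sw y) := by
  have hx := jp_pos x
  have hy := jp_pos y
  refine le_of_sq_le_sq ?_ (mul_nonneg hc (mul_nonneg (sw_nonneg _) (sw_nonneg _)))
  rw [mul_pow, mul_pow, sw, sw, Real.sq_sqrt (by positivity), Real.sq_sqrt (by positivity)]
  exact h

/-- Among the three frequencies ξ, η, ξ − η two are always comparable and large. If |ξ| ≤ 2|η| these
are ξ and η, and |η|⟨ξ⟩⁵ splits evenly between them; otherwise they are ξ and ξ − η, with |ξ|/2 ≤ |ξ
− η| ≤ 3|ξ|/2. The third frequency keeps a single derivative. The constant satisfies 7² ≥ (3/2)·2⁵.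
-/
theorem kernel_bound_of_le {ξ η : Plane} (h : ‖η‖ ≤ ‖ξ‖) :
    (2 * Real.pi * ‖η‖) * (2 * Real.pi * ‖ξ - η‖) * jp ξ ^ 5 ≤
      7 * (2 * Real.pi * ‖ξ - η‖ * (sw ξ * sw η) + 2 * Real.pi * ‖η‖ * (sw (ξ - η) * sw ξ)) := by
  have hX := jp_pos ξ
  have hY := jp_pos η
  have hZ := jp_pos (ξ - η)
  have hs1 := mul_nonneg (sw_nonneg ξ) (sw_nonneg η)
  have hs2 := mul_nonneg (sw_nonneg (ξ - η)) (sw_nonneg ξ)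
  have hp : 0 < 2 * Real.pi := by positivity
  rcases le_total ‖ξ‖ (2 * ‖η‖) with hc | hc
  · have h1 : (2 * Real.pi * ‖η‖) * jp ξ ^ 5 ≤ 7 * (sw ξ * sw η) := by
      refine le_mul_sw (by norm_num) ?_
      have h2 : jp ξ ^ 5 ≤ (2 * jp η) ^ 5 := by gcongr; exact jp_le_two_mul hc
      have h3 : 2 * Real.pi * ‖η‖ * jp ξ ^ 5 ≤ 2 * Real.pi * ‖ξ‖ * (2 * jp η) ^ 5 := by gcongr
      have h4 : 0 ≤ 2 * Real.pi * ‖η‖ * jp ξ ^ 5 := by positivity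
      have h5 : 0 ≤ 2 * Real.pi * ‖η‖ * jp ξ ^ 5 * (2 * Real.pi * ‖ξ‖ * jp η ^ 5) := by positivity
      nlinarith [mul_le_mul_of_nonneg_left h3 h4]
    have h2 : 0 ≤ 2 * Real.pi * ‖ξ - η‖ := by positivity
    have h3 : 0 ≤ 2 * Real.pi * ‖η‖ * (sw (ξ - η) * sw ξ) := by positivity
    nlinarith [mul_le_mul_of_nonneg_left h1 h2]
  · have t1 : ‖ξ - η‖ ≤ ‖ξ‖ + ‖η‖ := norm_sub_le _ _
    have t2 : ‖ξ‖ - ‖η‖ ≤ ‖ξ - η‖ := norm_sub_norm_le _ _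
    have h1 : (2 * Real.pi * ‖ξ - η‖) * jp ξ ^ 5 ≤ 7 * (sw (ξ - η) * sw ξ) := by
      refine le_mul_sw (by norm_num) ?_
      have h2 : jp ξ ^ 5 ≤ (2 * jp (ξ - η)) ^ 5 := by
        gcongr; exact jp_le_two_mul (by linarith)
      have h3 : 2 * Real.pi * ‖ξ - η‖ * jp ξ ^ 5
          ≤ 2 * Real.pi * (3 / 2 * ‖ξ‖) * (2 * jp (ξ - η)) ^ 5 := by gcongr; linarith
      have h4 : 0 ≤ 2 * Real.pi * ‖ξ - η‖ * jp ξ ^ 5 := by positivity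
      have h5 : 0 ≤ 2 * Real.pi * ‖ξ - η‖ * jp ξ ^ 5 * (2 * Real.pi * ‖ξ‖ * jp (ξ - η) ^ 5) := by
        positivity
      nlinarith [mul_le_mul_of_nonneg_left h3 h4]
    have h2 : 0 ≤ 2 * Real.pi * ‖η‖ := by positivity
    have h3 : 0 ≤ 2 * Real.pi * ‖ξ - η‖ * (sw ξ * sw η) := by positivity
    nlinarith [mul_le_mul_of_nonneg_left h1 h2]

/-- The truncated weight `min ((1 + |2πξ|²)^{1/2}) N`. -/
def jpN (N : ℝ) (ξ : Plane) : ℝ := min (jp ξ) N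

theorem rSym_jpN (N : ℝ) : RSym (jpN N) :=
  ⟨measurable_jp.min measurable_const, fun ξ => by rw [jpN, jpN, rSym_jp.even]⟩

theorem abs_pow_six_sub_le {a b M : ℝ} (ha : 0 ≤ a) (hb : 0 ≤ b) (haM : a ≤ M) (hbM : b ≤ M) :
    |a ^ 6 - b ^ 6| ≤ 6 * |a - b| * M ^ 5 := by
  have e : a ^ 6 - b ^ 6 = (a - b) * (a ^ 5 + a ^ 4 * b + a ^ 3 * b ^ 2 + a ^ 2 * b ^ 3 + a * b ^ 4 + b ^ 5) := by
    ring
  have hM : 0 ≤ M := ha.trans haM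
  have h1 : a ^ 5 + a ^ 4 * b + a ^ 3 * b ^ 2 + a ^ 2 * b ^ 3 + a * b ^ 4 + b ^ 5
      ≤ M ^ 5 + M ^ 4 * M + M ^ 3 * M ^ 2 + M ^ 2 * M ^ 3 + M * M ^ 4 + M ^ 5 := by gcongr
  rw [e, abs_mul, abs_of_nonneg (a := a ^ 5 + _ + _ + _ + _ + _) (by positivity)]
  nlinarith [mul_le_mul_of_nonneg_left h1 (abs_nonneg (a - b))]

/-- For |η| ≤ |ξ| the kernel costs |η| and the difference of sixth powers costs |ξ − η|⟨ξ⟩⁵, whence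
42 = 6 · 7. Truncating the bracket at N is 1-Lipschitz, so N does not appear in the bound. The last
summand serves the case |ξ| ≤ |η|, obtained by exchanging the frequencies. -/
theorem kernel_bound {N : ℝ} (hN : 0 ≤ N) (ξ η : Plane) :
    |ker ξ η| * |jpN N ξ ^ 6 - jpN N η ^ 6| ≤
      42 * (2 * Real.pi * ‖ξ - η‖ * (sw ξ * sw η) + 2 * Real.pi * ‖η‖ * (sw (ξ - η) * sw ξ)
        + 2 * Real.pi * ‖ξ‖ * (sw (ξ - η) * sw η)) := by
  wlog h : ‖η‖ ≤ ‖ξ‖ generalizing ξ η with H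
  · have := H η ξ (le_of_not_ge h)
    rw [← abs_neg, ← ker_swap, abs_sub_comm]
    refine this.trans (le_of_eq ?_)
    have e : η - ξ = -(ξ - η) := by abel
    rw [e, sw_neg, norm_neg]; ring
  have hX := jp_pos ξ
  have hY := jp_pos η
  have hYX : jp η ≤ jp ξ := by
    unfold jp; gcongr
  have h1 : |jpN N ξ ^ 6 - jpN N η ^ 6| ≤ 6 * |jpN N ξ - jpN N η| * jp ξ ^ 5 :=
    abs_pow_six_sub_le (le_min hX.le hN) (le_min hY.le hN) (min_le_left _ _)
      ((min_le_left _ _).trans hYX)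
  have h2 : |jpN N ξ - jpN N η| ≤ 2 * Real.pi * ‖ξ - η‖ :=
    (abs_min_sub_min_le_max _ _ _ _).trans (by simpa using abs_jp_sub_le ξ η)
  have h3 := abs_ker_le ξ η
  have h4 := kernel_bound_of_le h
  have h5 : 0 ≤ 2 * Real.pi * ‖ξ‖ * (sw (ξ - η) * sw η) := by
    have := sw_nonneg (ξ - η); have := sw_nonneg η; positivity
  calc |ker ξ η| * |jpN N ξ ^ 6 - jpN N η ^ 6|
      ≤ (2 * Real.pi * ‖η‖) * (6 * (2 * Real.pi * ‖ξ - η‖) * jp ξ ^ 5) := by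
        gcongr
        exact h1.trans (by gcongr)
    _ = 6 * ((2 * Real.pi * ‖η‖) * (2 * Real.pi * ‖ξ - η‖) * jp ξ ^ 5) := by ring
    _ ≤ _ := by nlinarith

/-- The integrable factor may occupy any of the three slots; here and in the next lemma a change of
variables moves it. -/
theorem lintegral_trilinear_sub_le {A B D : Plane → ℝ≥0∞} (hA : Measurable A) (hB : Measurable B)
    (hD : Measurable D) :
    ∫⁻ ξ, ∫⁻ η, B (ξ - η) * A η * D ξ ≤
      (∫⁻ ζ, A ζ) * ((∫⁻ η, B η ^ 2) ^ (1 / 2 : ℝ) * (∫⁻ ξ, D ξ ^ 2) ^ (1 / 2 : ℝ)) := by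
  refine le_trans (le_of_eq ?_) (lintegral_trilinear_le hA hB hD)
  refine lintegral_congr fun ξ => ?_
  rw [← lintegral_sub_left_eq_self _ ξ]
  refine lintegral_congr fun η => ?_
  rw [sub_sub_cancel]; ring

theorem lintegral_trilinear_left_le {A B D : Plane → ℝ≥0∞} (hA : Measurable A) (hB : Measurable B)
    (hD : Measurable D) (hB' : ∀ ξ, B (-ξ) = B ξ) :
    ∫⁻ ξ, ∫⁻ η, B (ξ - η) * D η * A ξ ≤
      (∫⁻ ζ, A ζ) * ((∫⁻ η, B η ^ 2) ^ (1 / 2 : ℝ) * (∫⁻ ξ, D ξ ^ 2) ^ (1 / 2 : ℝ)) := by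
  refine le_trans (le_of_eq ?_) (lintegral_trilinear_sub_le hA hB hD)
  rw [lintegral_lintegral_swap (by fun_prop)]
  refine lintegral_congr fun ξ => lintegral_congr fun η => ?_
  rw [← hB', neg_sub]; ring

theorem rpow_half_mul_self (x : ℝ≥0∞) : x ^ (1 / 2 : ℝ) * x ^ (1 / 2 : ℝ) = x := by
  rw [← ENNReal.rpow_add_of_nonneg _ _ (by norm_num) (by norm_num)]; norm_num

theorem bdd_jpN_pow {N : ℝ} (hN : 0 ≤ N) (k : ℕ) : ∃ C, ∀ ξ, |jpN N ξ ^ k| ≤ C :=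
  ⟨N ^ k, fun ξ => by
    have h : 0 ≤ jpN N ξ := le_min (jp_pos ξ).le hN
    rw [abs_pow, abs_of_nonneg h]
    exact pow_le_pow_left₀ h (min_le_right _ _) k⟩

/-- The commutator estimate for the quadratic nonlinearity. -/
theorem two_mul_inner_adv_self_le {g : L2} (hg : H3 g) {N : ℝ} (hN : 0 ≤ N) :
    ‖2 * inner ℝ (adv g g) (bmul _ ((rSym_jpN N).pow 6) (bdd_jpN_pow hN 6) g)‖ₑ ≤
      ENNReal.ofReal 126 * (ENNReal.ofReal wC * ‖J3 g‖ₑ) *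
        ∫⁻ ξ, (ENNReal.ofReal (sw ξ) * ‖fh g ξ‖ₑ) ^ 2 := by
  have mg := measurable_fh g
  have ms := measurable_sw
  -- A carries one derivative and is measured in L¹, S carries `sw` and is measured in L². Each of
  -- the three terms of `kernel_bound` contains one A and two S, which gives 126 = 3 · 42.
  set A : Plane → ℝ≥0∞ := fun ξ => ENNReal.ofReal (2 * Real.pi * ‖ξ‖) * ‖fh g ξ‖ₑ with hA
  set S : Plane → ℝ≥0∞ := fun ξ => ENNReal.ofReal (sw ξ) * ‖fh g ξ‖ₑ with hS
  have mA : Measurable A := by fun_prop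
  have mS : Measurable S := by fun_prop
  have hSn : ∀ ξ, S (-ξ) = S ξ := fun ξ => by
    simp only [hS, sw_neg, fh_neg, RCLike.enorm_conj]
  have t1 := lintegral_trilinear_le mA mS mS
  have t2 := lintegral_trilinear_sub_le mA mS mS
  have t3 := lintegral_trilinear_left_le mA mS mS hSn
  rw [rpow_half_mul_self] at t1 t2 t3
  have hpt : ∀ ξ η, ENNReal.ofReal (|ker ξ η| * |jpN N ξ ^ 6 - jpN N η ^ 6|) *
      (‖fh g (ξ - η)‖ₑ * ‖fh g η‖ₑ * ‖fh g ξ‖ₑ) ≤ ENNReal.ofReal 42 *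
        (A (ξ - η) * S η * S ξ + S (ξ - η) * A η * S ξ + S (ξ - η) * S η * A ξ) := by
    intro ξ η
    have h1 := sw_nonneg ξ
    have h2 := sw_nonneg η
    have h3 := sw_nonneg (ξ - η)
    calc _ ≤ ENNReal.ofReal (42 * (2 * Real.pi * ‖ξ - η‖ * (sw ξ * sw η)
            + 2 * Real.pi * ‖η‖ * (sw (ξ - η) * sw ξ) + 2 * Real.pi * ‖ξ‖ * (sw (ξ - η) * sw η))) *
          (‖fh g (ξ - η)‖ₑ * ‖fh g η‖ₑ * ‖fh g ξ‖ₑ) := by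
          exact mul_le_mul_left (ENNReal.ofReal_le_ofReal (kernel_bound hN ξ η)) _
      _ = _ := by
        rw [ENNReal.ofReal_mul (by norm_num), ENNReal.ofReal_add (by positivity) (by positivity),
          ENNReal.ofReal_add (by positivity) (by positivity),
          ENNReal.ofReal_mul (p := 2 * Real.pi * ‖ξ - η‖) (by positivity),
          ENNReal.ofReal_mul (p := 2 * Real.pi * ‖ξ‖) (by positivity),
          ENNReal.ofReal_mul (p := 2 * Real.pi * ‖η‖) (by positivity),
          ENNReal.ofReal_mul h1, ENNReal.ofReal_mul h3, ENNReal.ofReal_mul h3]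
        simp only [hA, hS]
        ring
  have hA1 : ∫⁻ ζ, A ζ ≤ ENNReal.ofReal wC * ‖J3 g‖ₑ := lintegral_norm_fh_le hg
  calc _ ≤ ∫⁻ ξ, ∫⁻ η, ENNReal.ofReal 42 *
        (A (ξ - η) * S η * S ξ + S (ξ - η) * A η * S ξ + S (ξ - η) * S η * A ξ) :=
        (two_mul_inner_adv_le hg hg _ _).trans
          (lintegral_mono fun ξ => lintegral_mono fun η => hpt ξ η)
    _ = ENNReal.ofReal 42 * ((∫⁻ ξ, ∫⁻ η, A (ξ - η) * S η * S ξ) +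
          (∫⁻ ξ, ∫⁻ η, S (ξ - η) * A η * S ξ) + ∫⁻ ξ, ∫⁻ η, S (ξ - η) * S η * A ξ) := by
        have e : ∀ ξ, ∫⁻ η, ENNReal.ofReal 42 *
            (A (ξ - η) * S η * S ξ + S (ξ - η) * A η * S ξ + S (ξ - η) * S η * A ξ)
            = ENNReal.ofReal 42 * ((∫⁻ η, A (ξ - η) * S η * S ξ) + (∫⁻ η, S (ξ - η) * A η * S ξ)
              + ∫⁻ η, S (ξ - η) * S η * A ξ) := fun ξ => by
          rw [lintegral_const_mul _ (by fun_prop), lintegral_add_left (by fun_prop),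
            lintegral_add_left (by fun_prop)]
        have m2 : Measurable fun ξ => ∫⁻ η, S (ξ - η) * A η * S ξ :=
          Measurable.lintegral_prod_right (f := fun ξ η => S (ξ - η) * A η * S ξ)
            (by fun_prop)
        have m3 : Measurable fun ξ => ∫⁻ η, S (ξ - η) * S η * A ξ :=
          Measurable.lintegral_prod_right (f := fun ξ η => S (ξ - η) * S η * A ξ)
            (by fun_prop)
        simp only [e]
        rw [lintegral_const_mul' _ _ ENNReal.ofReal_ne_top, lintegral_add_right _ m3,
          lintegral_add_right _ m2]
    _ ≤ ENNReal.ofReal 42 * ((∫⁻ ζ, A ζ) * (∫⁻ ξ, S ξ ^ 2) + (∫⁻ ζ, A ζ) * (∫⁻ ξ, S ξ ^ 2)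
          + (∫⁻ ζ, A ζ) * (∫⁻ ξ, S ξ ^ 2)) := by gcongr
    _ = ENNReal.ofReal 126 * (∫⁻ ζ, A ζ) * ∫⁻ ξ, S ξ ^ 2 := by
        rw [show (126 : ℝ) = 3 * 42 by norm_num, ENNReal.ofReal_mul (by norm_num)]
        simp; ring
    _ ≤ _ := by gcongr

/-- The symbol of `Λ^α (1 - Δ)^{3/2}`. -/
def dw (α : ℝ) (ξ : Plane) : ℝ := (2 * Real.pi * ‖ξ‖) ^ α * jp ξ ^ 3

theorem rSym_pow_norm (α : ℝ) : RSym (fun ξ => (2 * Real.pi * ‖ξ‖) ^ α) :=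
  RSym.of_norm (F := fun r => (2 * Real.pi * r) ^ α) (by fun_prop)

theorem rSym_dw (α : ℝ) : RSym (dw α) := (rSym_pow_norm α).mul (rSym_jp.pow 3)

theorem dw_nonneg (α : ℝ) (ξ : Plane) : 0 ≤ dw α ξ :=
  mul_nonneg (Real.rpow_nonneg (by positivity) _) (pow_nonneg (jp_pos ξ).le 3)

/-- The place where α ≤ 1/2 matters. After squaring, the claim is |2πξ| ≤ |2πξ|^{2α}⟨ξ⟩: at low
frequency because 2α ≤ 1, at high frequency because |2πξ|^{2α} ≥ 1 and |2πξ| ≤ ⟨ξ⟩. -/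
theorem sw_le_dw {α : ℝ} (h0 : 0 ≤ α) (h1 : α ≤ 1 / 2) (ξ : Plane) : sw ξ ≤ dw α ξ := by
  have hX := jp_pos ξ
  have hx : 0 ≤ 2 * Real.pi * ‖ξ‖ := by positivity
  refine Real.sqrt_le_iff.2 ⟨dw_nonneg α ξ, ?_⟩
  have e : dw α ξ ^ 2 = ((2 * Real.pi * ‖ξ‖) ^ α) ^ 2 * jp ξ * jp ξ ^ 5 := by rw [dw]; ring
  rw [e]
  refine mul_le_mul_of_nonneg_right ?_ (by positivity)
  have e2 : ((2 * Real.pi * ‖ξ‖) ^ α) ^ 2 = (2 * Real.pi * ‖ξ‖) ^ (2 * α) := by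
    rw [← Real.rpow_natCast, ← Real.rpow_mul hx, mul_comm α]; norm_num
  rw [e2]
  rcases le_total (2 * Real.pi * ‖ξ‖) 1 with h | h
  · rcases hx.eq_or_lt with h0' | h0'
    · rw [← h0']; positivity
    · have : (2 * Real.pi * ‖ξ‖) ^ (1 : ℝ) ≤ (2 * Real.pi * ‖ξ‖) ^ (2 * α) :=
        Real.rpow_le_rpow_of_exponent_ge h0' h (by linarith)
      rw [Real.rpow_one] at this
      nlinarith [one_le_jp ξ, Real.rpow_nonneg hx (2 * α)]
  · have : 1 ≤ (2 * Real.pi * ‖ξ‖) ^ (2 * α) := Real.one_le_rpow h (by linarith)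
    nlinarith [norm_le_jp ξ]

theorem sw_le_jp (ξ : Plane) : sw ξ ≤ jp ξ ^ 3 := by
  have := sw_le_dw le_rfl (by norm_num) ξ
  simpa [dw] using this

theorem lintegral_sw_le_J3 {g : L2} (hg : H3 g) :
    ∫⁻ ξ, (ENNReal.ofReal (sw ξ) * ‖fh g ξ‖ₑ) ^ 2 ≤ ‖J3 g‖ₑ ^ 2 := by
  rw [enorm_sq_eq]
  refine lintegral_mono_ae ?_
  filter_upwards [fh_J3 hg] with ξ e
  rw [e, enorm_mul, ← ofReal_norm (((jp ξ ^ 3 : ℝ) : ℂ)), norm_jp3]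
  gcongr
  exact sw_le_jp ξ

theorem lintegral_sw_le_dw {α : ℝ} (h0 : 0 ≤ α) (h1 : α ≤ 1 / 2) {g : L2}
    (hg : InDomain (fun ξ => (dw α ξ : ℂ)) g) :
    ∫⁻ ξ, (ENNReal.ofReal (sw ξ) * ‖fh g ξ‖ₑ) ^ 2 ≤ ‖fourierMul (fun ξ => (dw α ξ : ℂ)) g‖ₑ ^ 2 := by
  rw [(rSym_dw α).hSym.enorm_fourierMul_sq hg]
  refine lintegral_mono fun ξ => ?_
  rw [enorm_mul, ← ofReal_norm ((dw α ξ : ℂ)), Complex.norm_real, Real.norm_eq_abs,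
    abs_of_nonneg (dw_nonneg α ξ)]
  gcongr
  exact sw_le_dw h0 h1 ξ

/-- The version without dissipation and uniform in N, used for the variation in time of the H³ norm.
-/
theorem abs_inner_adv_self_le_J3 {g : L2} (hg : H3 g) {N : ℝ} (hN : 0 ≤ N) :
    |2 * inner ℝ (adv g g) (bmul _ ((rSym_jpN N).pow 6) (bdd_jpN_pow hN 6) g)| ≤
      126 * wC * ‖J3 g‖ ^ 3 := by
  have h := (two_mul_inner_adv_self_le hg hN).trans (mul_le_mul_right (lintegral_sw_le_J3 hg) _)
  rw [enorm_ofReal_abs, ← ofReal_norm, ← ENNReal.ofReal_pow (norm_nonneg _),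
    ← ENNReal.ofReal_mul wC_nonneg, ← ENNReal.ofReal_mul (by norm_num),
    ← ENNReal.ofReal_mul (mul_nonneg (by norm_num) (mul_nonneg wC_nonneg (norm_nonneg _))),
    ENNReal.ofReal_le_ofReal_iff (mul_nonneg (mul_nonneg (by norm_num)
      (mul_nonneg wC_nonneg (norm_nonneg _))) (by positivity))] at h
  linarith

/-- The version that the dissipation absorbs when g is small in H³. -/
theorem abs_inner_adv_self_le_dw {α : ℝ} (h0 : 0 ≤ α) (h1 : α ≤ 1 / 2) {g : L2} (hg : H3 g)
    (hg' : InDomain (fun ξ => (dw α ξ : ℂ)) g) {N : ℝ} (hN : 0 ≤ N) :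
    |2 * inner ℝ (adv g g) (bmul _ ((rSym_jpN N).pow 6) (bdd_jpN_pow hN 6) g)| ≤
      126 * wC * ‖J3 g‖ * ‖fourierMul (fun ξ => (dw α ξ : ℂ)) g‖ ^ 2 := by
  have h := (two_mul_inner_adv_self_le hg hN).trans
    (mul_le_mul_right (lintegral_sw_le_dw h0 h1 hg') _)
  rw [enorm_ofReal_abs, ← ofReal_norm, ← ofReal_norm, ← ENNReal.ofReal_pow (norm_nonneg _),
    ← ENNReal.ofReal_mul wC_nonneg, ← ENNReal.ofReal_mul (by norm_num),
    ← ENNReal.ofReal_mul (mul_nonneg (by norm_num) (mul_nonneg wC_nonneg (norm_nonneg _))),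
    ENNReal.ofReal_le_ofReal_iff (mul_nonneg (mul_nonneg (by norm_num)
      (mul_nonneg wC_nonneg (norm_nonneg _))) (by positivity))] at h
  linarith

/-! ### Band-limited functions and the Leibniz rule -/

/-- The Fourier transform of `f` vanishes outside the ball of radius `R`. -/
def BL (R : ℝ) (f : L2) : Prop := ∀ᵐ ξ : Plane, R < ‖ξ‖ → fh f ξ = 0

theorem BL.mono {R R' : ℝ} {f : L2} (h : BL R f) (hR : R ≤ R') : BL R' f := by
  filter_upwards [h] with ξ e h2 using e (hR.trans_lt h2)

theorem BL.inDomain {R : ℝ} {f : L2} (hf : BL R f) {m : Plane → ℂ} (hm : HSym m) {C : ℝ}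
    (hC : ∀ ξ, ‖ξ‖ ≤ R → ‖m ξ‖ ≤ C) : InDomain m f := by
  rw [SQG.inDomain_iff]
  refine MemLp.of_le_mul (c := C) (memLp_fh f) (hm.meas.mul (measurable_fh f)).aestronglyMeasurable ?_
  filter_upwards [hf] with ξ e
  rcases le_or_gt ‖ξ‖ R with h | h
  · rw [norm_mul]
    exact mul_le_mul_of_nonneg_right (hC ξ h) (norm_nonneg _)
  · simp [e h]

theorem jp_le_of_norm_le {R : ℝ} {ξ : Plane} (h : ‖ξ‖ ≤ R) :
    jp ξ ≤ Real.sqrt (1 + (2 * Real.pi * R) ^ 2) := by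
  unfold jp; gcongr

theorem BL.inDomain_of_le_jp {R : ℝ} {f : L2} (hf : BL R f) {m : Plane → ℂ} (hm : HSym m) {k : ℕ}
    (hC : ∀ ξ, ‖m ξ‖ ≤ jp ξ ^ k) : InDomain m f := by
  refine hf.inDomain hm (C := Real.sqrt (1 + (2 * Real.pi * R) ^ 2) ^ k) fun ξ h => (hC ξ).trans ?_
  exact pow_le_pow_left₀ (jp_pos ξ).le (jp_le_of_norm_le h) k

theorem BL.h3 {R : ℝ} {f : L2} (hf : BL R f) : H3 f :=
  hf.inDomain_of_le_jp hSym_jp3 fun ξ => (norm_jp3 ξ).le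

theorem BL.fourierMul {R : ℝ} {f : L2} (hf : BL R f) {m : Plane → ℂ} (hm : HSym m)
    (h : InDomain m f) : BL R (fourierMul m f) := by
  filter_upwards [hf, hm.fh_fourierMul h] with ξ e1 e2 e3
  rw [e2, e1 e3, mul_zero]

theorem BL.add {R : ℝ} {f g : L2} (hf : BL R f) (hg : BL R g) : BL R (f + g) := by
  filter_upwards [hf, hg, fh_add f g] with ξ e1 e2 e3 e4
  rw [e3, e1 e4, e2 e4, add_zero]

theorem BL.sub {R : ℝ} {f g : L2} (hf : BL R f) (hg : BL R g) : BL R (f - g) := by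
  filter_upwards [hf, hg, fh_sub f g] with ξ e1 e2 e3 e4
  rw [e3, e1 e4, e2 e4, sub_zero]

theorem BL.smul {R : ℝ} {f : L2} (hf : BL R f) (c : ℝ) : BL R (c • f) := by
  filter_upwards [hf, fh_smul c f] with ξ e1 e3 e4
  rw [e3, e1 e4, mul_zero]

theorem BL.zero (R : ℝ) : BL R 0 := by
  filter_upwards [fh_zero] with ξ e _ using e

/-- Supports add under convolution. -/
theorem BL.adv {R R' : ℝ} {f h : L2} (hf : BL R f) (hh : BL R' h) : BL (R + R') (adv f h) := by
  filter_upwards [fh_adv hf.h3 hh.h3] with ξ e1 e2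
  have hq := (Measure.measurePreserving_sub_left volume ξ).quasiMeasurePreserving
  rw [e1, advHat]
  refine integral_eq_zero_of_ae ?_
  filter_upwards [hq.ae hf, hh] with η h1 h2
  rcases lt_or_ge R' ‖η‖ with h | h
  · simp [h2 h]
  · have : ‖ξ‖ - ‖η‖ ≤ ‖ξ - η‖ := norm_sub_norm_le _ _
    simp [h1 (by linarith)]

/-- The symbols of the identity and of the partial derivatives. -/
def dsym : Option (Fin 2) → Plane → ℂ
  | none => fun _ => 1
  | some j => fun ξ => 2 * Real.pi * Complex.I * ((ξ j : ℝ) : ℂ)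

theorem hSym_dsym (i : Option (Fin 2)) : HSym (dsym i) := by
  rcases i with _ | j
  · exact HSym.one
  · exact hSym_partialD j

theorem norm_dsym_le (i : Option (Fin 2)) (ξ : Plane) : ‖dsym i ξ‖ ≤ jp ξ := by
  rcases i with _ | j
  · simpa [dsym] using one_le_jp ξ
  · exact (norm_partialD_symbol_le j ξ).trans (norm_le_jp ξ)

/-- The reason for the index type `Option (Fin 2)`: summing over 27 triples gives exactly ⟨ξ⟩⁶,
without multinomial coefficients. -/
theorem sum_norm_dsym_sq (ξ : Plane) : ∑ i, ‖dsym i ξ‖ ^ 2 = jp ξ ^ 2 := by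
  rw [Fintype.sum_option, Fin.sum_univ_two, jp_sq, mul_pow, norm_sq_plane]
  simp only [dsym, norm_one, norm_mul, Complex.norm_I, Complex.norm_real, Real.norm_eq_abs,
    Complex.norm_ofNat, mul_pow, sq_abs]
  ring

/-- The identity or a partial derivative. -/
def dd (i : Option (Fin 2)) (f : L2) : L2 := fourierMul (dsym i) f

/-- Zero or a partial derivative. -/
def dl : Option (Fin 2) → L2 → L2
  | none => fun _ => 0
  | some j => fun f => partialD j f

theorem BL.inDomain_dsym {R : ℝ} {f : L2} (hf : BL R f) (i : Option (Fin 2)) :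
    InDomain (dsym i) f :=
  hf.inDomain_of_le_jp (hSym_dsym i) (k := 1) (by simpa using norm_dsym_le i)

theorem BL.fh_dd {R : ℝ} {f : L2} (hf : BL R f) (i : Option (Fin 2)) :
    fh (dd i f) =ᵐ[volume] fun ξ => dsym i ξ * fh f ξ :=
  (hSym_dsym i).fh_fourierMul (hf.inDomain_dsym i)

theorem BL.dd {R : ℝ} {f : L2} (hf : BL R f) (i : Option (Fin 2)) : BL R (dd i f) :=
  hf.fourierMul (hSym_dsym i) (hf.inDomain_dsym i)

theorem BL.dl {R : ℝ} {f : L2} (hf : BL R f) (i : Option (Fin 2)) : BL R (dl i f) := by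
  rcases i with _ | j
  · exact BL.zero R
  · exact hf.dd (some j)

theorem dd_add {R : ℝ} {f g : L2} (hf : BL R f) (hg : BL R g) (i : Option (Fin 2)) :
    dd i (f + g) = dd i f + dd i g :=
  (hSym_dsym i).fourierMul_add (hf.inDomain_dsym i) (hg.inDomain_dsym i)

theorem dd_none (f : L2) : dd none f = f := fourierMul_one f

theorem adv_zero_left {h : L2} (hh : H3 h) : adv 0 h = 0 := by
  have h0 : H3 0 := (BL.zero 0).h3
  simpa using adv_smul_left 0 h0 hh

/-- The Leibniz rule. -/
theorem dd_adv {R R' : ℝ} {f h : L2} (hf : BL R f) (hh : BL R' h) (i : Option (Fin 2)) :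
    dd i (adv f h) = adv (dl i f) h + adv f (dd i h) := by
  rcases i with _ | j
  -- For the identity there is no derivative to distribute, which is why `dl none` is zero.
  · simp only [dd_none, dl, adv_zero_left hh.h3, zero_add]
  refine ext_fh ?_
  filter_upwards [(hf.adv hh).fh_dd (some j), fh_adv hf.h3 hh.h3,
    fh_add (adv (dl (some j) f) h) (adv f (dd (some j) h)),
    fh_adv (hf.dl (some j)).h3 hh.h3, fh_adv hf.h3 (hh.dd (some j)).h3,
    integrable_advIntegrand (hf.dl (some j)).h3 hh.h3,
    integrable_advIntegrand hf.h3 (hh.dd (some j)).h3] with ξ h1 h2 h3 h4 h5 h6 h7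
  rw [h1, h2, h3, h4, h5, advHat, advHat, advHat, ← integral_add h6 h7, ← integral_const_mul]
  have hq := (Measure.measurePreserving_sub_left volume ξ).quasiMeasurePreserving
  refine integral_congr_ae ?_
  filter_upwards [hq.ae (hf.fh_dd (some j)), hh.fh_dd (some j)] with η e1 e2
  have e3 : fh (dl (some j) f) (ξ - η) = dsym (some j) (ξ - η) * fh f (ξ - η) := e1
  rw [e3, e2]
  -- The symbol of a derivative is additive: ξ_j = (ξ − η)_j + η_j.
  simp only [dsym, PiLp.sub_apply]
  push_cast
  ring

/-- Third order derivatives. -/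
def ddd (i j k : Option (Fin 2)) (f : L2) : L2 := dd i (dd j (dd k f))

theorem BL.ddd {R : ℝ} {f : L2} (hf : BL R f) (i j k : Option (Fin 2)) : BL R (ddd i j k f) :=
  ((hf.dd k).dd j).dd i

theorem BL.fh_ddd {R : ℝ} {f : L2} (hf : BL R f) (i j k : Option (Fin 2)) :
    fh (SQG.ddd i j k f) =ᵐ[volume] fun ξ => dsym i ξ * dsym j ξ * dsym k ξ * fh f ξ := by
  filter_upwards [((hf.dd k).dd j).fh_dd i, (hf.dd k).fh_dd j, hf.fh_dd k] with ξ h1 h2 h3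
  rw [SQG.ddd, h1, h2, h3]; ring

theorem integrable_inner_fh (f g : L2) : Integrable fun ξ => (conj (fh f ξ) * fh g ξ).re := by
  have h := L2.integrable_inner (𝕜 := ℝ) (fhatL f) (fhatL g)
  refine h.congr ?_
  filter_upwards [fh_ae f, fh_ae g] with ξ h1 h2
  rw [h1, h2, fhatL_apply, fhatL_apply, Complex.inner, mul_comm]

/-- Trades the nonlocal weight ⟨ξ⟩⁶ for genuine derivatives, to which the Leibniz rule and sup-norm
bounds apply. -/
theorem inner_J3_eq_sum {R : ℝ} {f g : L2} (hf : BL R f) (hg : BL R g) :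
    inner ℝ (J3 f) (J3 g) = ∑ i, ∑ j, ∑ k, inner ℝ (ddd i j k f) (ddd i j k g) := by
  simp only [inner_eq_integral]
  have hi := fun i j k => integrable_inner_fh (ddd i j k f) (ddd i j k g)
  have e1 : ∀ i j, ∑ k, ∫ ξ, (conj (fh (ddd i j k f) ξ) * fh (ddd i j k g) ξ).re
      = ∫ ξ, ∑ k, (conj (fh (ddd i j k f) ξ) * fh (ddd i j k g) ξ).re := fun i j =>
    (integral_finsetSum _ fun k _ => hi i j k).symm
  have e2 : ∀ i, ∑ j, ∫ ξ, ∑ k, (conj (fh (ddd i j k f) ξ) * fh (ddd i j k g) ξ).re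
      = ∫ ξ, ∑ j, ∑ k, (conj (fh (ddd i j k f) ξ) * fh (ddd i j k g) ξ).re := fun i =>
    (integral_finsetSum _ fun j _ => integrable_finsetSum _ fun k _ => hi i j k).symm
  simp only [e1, e2]
  rw [← integral_finsetSum _ fun i _ => integrable_finsetSum _ fun j _ =>
    integrable_finsetSum _ fun k _ => hi i j k]
  refine integral_congr_ae ?_
  have hF : ∀ᵐ ξ : Plane, ∀ i j k, fh (ddd i j k f) ξ = dsym i ξ * dsym j ξ * dsym k ξ * fh f ξ :=
    ae_all_iff.2 fun i => ae_all_iff.2 fun j => ae_all_iff.2 fun k => hf.fh_ddd i j k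
  have hG : ∀ᵐ ξ : Plane, ∀ i j k, fh (ddd i j k g) ξ = dsym i ξ * dsym j ξ * dsym k ξ * fh g ξ :=
    ae_all_iff.2 fun i => ae_all_iff.2 fun j => ae_all_iff.2 fun k => hg.fh_ddd i j k
  filter_upwards [fh_J3 hf.h3, fh_J3 hg.h3, hF, hG] with ξ h1 h2 h3 h4
  simp only [h1, h2, h3, h4]
  have e : ∀ i j k, (conj (dsym i ξ * dsym j ξ * dsym k ξ * fh f ξ)
      * (dsym i ξ * dsym j ξ * dsym k ξ * fh g ξ)).re
      = ‖dsym i ξ‖ ^ 2 * (‖dsym j ξ‖ ^ 2 * (‖dsym k ξ‖ ^ 2 * (conj (fh f ξ) * fh g ξ).re)) := by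
    intro i j k
    have : conj (dsym i ξ * dsym j ξ * dsym k ξ * fh f ξ) * (dsym i ξ * dsym j ξ * dsym k ξ * fh g ξ)
      = ((‖dsym i ξ‖ ^ 2 * (‖dsym j ξ‖ ^ 2 * ‖dsym k ξ‖ ^ 2) : ℝ) : ℂ) * (conj (fh f ξ) * fh g ξ) := by
      push_cast
      rw [← Complex.conj_mul', ← Complex.conj_mul', ← Complex.conj_mul']
      simp only [map_mul]
      ring
    rw [this, Complex.re_ofReal_mul]
    ring
  simp only [e, ← Finset.mul_sum, ← Finset.sum_mul, sum_norm_dsym_sq]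
  have e2 : conj (((jp ξ ^ 3 : ℝ) : ℂ) * fh f ξ) * (((jp ξ ^ 3 : ℝ) : ℂ) * fh g ξ)
      = ((jp ξ ^ 6 : ℝ) : ℂ) * (conj (fh f ξ) * fh g ξ) := by
    simp only [map_mul, Complex.conj_ofReal]; push_cast; ring
  rw [e2, Complex.re_ofReal_mul]
  ring

theorem norm_fourierMul_le_J3 {f : L2} (hf : H3 f) {m : Plane → ℂ} (hm : HSym m)
    (h : ∀ ξ, ‖m ξ‖ ≤ jp ξ ^ 3) : ‖fourierMul m f‖ ≤ ‖J3 f‖ := by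
  have := hm.norm_fourierMul_le (C := 1) hSym_jp3 (fun ξ => by
    rw [norm_jp3, one_mul]; exact h ξ) hf
  rwa [one_mul] at this

theorem norm_le_norm_of_fh_le {f g : L2} (h : ∀ᵐ ξ : Plane, ‖fh f ξ‖ ≤ ‖fh g ξ‖) : ‖f‖ ≤ ‖g‖ := by
  rw [← norm_fhat, ← norm_fhat g]
  refine Lp.norm_le_norm_of_ae_le ?_
  filter_upwards [fh_ae f, fh_ae g, h] with ξ h1 h2 h3
  rwa [← h1, ← h2]

theorem norm_le_J3 {f : L2} (hf : H3 f) : ‖f‖ ≤ ‖J3 f‖ := by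
  have := norm_fourierMul_le_J3 hf HSym.one fun ξ => by
    simpa using one_le_pow₀ (one_le_jp ξ)
  rwa [fourierMul_one] at this

/-! ### Products with one factor in the supremum norm -/

/-- `Λ = (-Δ)^{1/2}`. -/
def Lam (f : L2) : L2 := fourierMul (fun ξ => ((2 * Real.pi * ‖ξ‖ : ℝ) : ℂ)) f

theorem rSym_Lam : RSym (fun ξ : Plane => 2 * Real.pi * ‖ξ‖) :=
  RSym.of_norm (F := fun r => 2 * Real.pi * r) (by fun_prop)

theorem norm_Lam_symbol (ξ : Plane) : ‖((2 * Real.pi * ‖ξ‖ : ℝ) : ℂ)‖ = 2 * Real.pi * ‖ξ‖ := by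
  rw [Complex.norm_real, Real.norm_eq_abs, abs_of_nonneg (by positivity)]

theorem H3.inDomain_Lam {f : L2} (hf : H3 f) :
    InDomain (fun ξ => ((2 * Real.pi * ‖ξ‖ : ℝ) : ℂ)) f := by
  refine rSym_Lam.hSym.inDomain_of_le (C := 1) (fun ξ => ?_) hf
  rw [norm_jp3, one_mul, norm_Lam_symbol]
  exact (norm_le_jp ξ).trans (jp_le_pow ξ)

theorem H3.fh_Lam {f : L2} (hf : H3 f) :
    fh (Lam f) =ᵐ[volume] fun ξ => ((2 * Real.pi * ‖ξ‖ : ℝ) : ℂ) * fh f ξ :=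
  rSym_Lam.hSym.fh_fourierMul hf.inDomain_Lam

theorem norm_sq_velocity (f : L2) (x : Plane) :
    ‖velocity f x‖ ^ 2 = riesz 0 f x ^ 2 + riesz 1 f x ^ 2 := by
  rw [norm_sq_plane]; simp [velocity]; ring

theorem norm_sq_grad (f : L2) (x : Plane) :
    ‖grad f x‖ ^ 2 = partialD 0 f x ^ 2 + partialD 1 f x ^ 2 := by
  rw [norm_sq_plane]; simp [grad]

theorem integral_sq_eq (f : L2) : ∫ x, f x ^ 2 = ‖f‖ ^ 2 := by
  rw [← real_inner_self_eq_norm_sq, L2.inner_def]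
  refine integral_congr_ae (Eventually.of_forall fun x => ?_)
  simp [sq]

theorem integrable_sq (f : L2) : Integrable fun x => f x ^ 2 := (Lp.memLp f).integrable_sq

theorem norm_sq_eq_integral_fh (f : L2) : ‖f‖ ^ 2 = ∫ ξ, ‖fh f ξ‖ ^ 2 := by
  rw [← real_inner_self_eq_norm_sq, inner_eq_integral]
  refine integral_congr_ae (Eventually.of_forall fun ξ => ?_)
  simp only [Complex.conj_mul']
  norm_cast

theorem integrable_fh_sq (f : L2) : Integrable fun ξ => ‖fh f ξ‖ ^ 2 :=
  (memLp_fh f).norm.integrable_sq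

theorem norm_riesz_sq_add (f : L2) : ‖riesz 0 f‖ ^ 2 + ‖riesz 1 f‖ ^ 2 ≤ ‖f‖ ^ 2 := by
  rw [norm_sq_eq_integral_fh, norm_sq_eq_integral_fh, norm_sq_eq_integral_fh,
    ← integral_add (integrable_fh_sq _) (integrable_fh_sq _)]
  refine integral_mono_ae ((integrable_fh_sq _).add (integrable_fh_sq _)) (integrable_fh_sq _) ?_
  filter_upwards [fh_riesz 0 f, fh_riesz 1 f] with ξ h1 h2
  simp only [h1, h2, norm_mul, Complex.norm_I, one_mul, Complex.norm_real, norm_div,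
    mul_pow, div_pow, Real.norm_eq_abs, sq_abs]
  rw [← add_mul, ← add_div, ← norm_sq_plane]
  exact mul_le_of_le_one_left (by positivity) (div_self_le_one _)

theorem norm_partialD_sq_add {f : L2} (hf : H3 f) :
    ‖partialD 0 f‖ ^ 2 + ‖partialD 1 f‖ ^ 2 = ‖Lam f‖ ^ 2 := by
  rw [norm_sq_eq_integral_fh, norm_sq_eq_integral_fh, norm_sq_eq_integral_fh,
    ← integral_add (integrable_fh_sq _) (integrable_fh_sq _)]
  refine integral_congr_ae ?_
  filter_upwards [fh_partialD hf 0, fh_partialD hf 1, hf.fh_Lam] with ξ h1 h2 h3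
  simp only [h1, h2, h3, norm_mul _ (fh f ξ), norm_Lam_symbol]
  simp only [norm_mul, Complex.norm_I, mul_one, Complex.norm_real,
    mul_pow, Real.norm_eq_abs, sq_abs, norm_sq_plane, Complex.norm_ofNat]
  ring

theorem sq_inner_le (a b : Plane) : (inner ℝ a b) ^ 2 ≤ ‖a‖ ^ 2 * ‖b‖ ^ 2 := by
  rw [← mul_pow, ← sq_abs]
  exact pow_le_pow_left₀ (abs_nonneg _) (abs_real_inner_le_norm a b) 2

/-- Done in physical space through `adv_ae`, since a sup norm of the velocity is not visible on the
Fourier side. -/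
theorem norm_adv_le_velocity {f h : L2} (hf : H3 f) (hh : H3 h) {c : ℝ} (hc : 0 ≤ c)
    (hv : ∀ᵐ x : Plane, ‖velocity f x‖ ≤ c) : ‖adv f h‖ ≤ c * ‖Lam h‖ := by
  refine le_of_sq_le_sq ?_ (by positivity)
  rw [mul_pow, ← norm_partialD_sq_add hh, ← integral_sq_eq, ← integral_sq_eq, ← integral_sq_eq,
    ← integral_add (integrable_sq _) (integrable_sq _), ← integral_const_mul]
  refine integral_mono_ae (integrable_sq _) (((integrable_sq _).add (integrable_sq _)).const_mul _) ?_
  filter_upwards [hv, adv_ae hf hh] with x h1 h2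
  rw [h2, ← norm_sq_grad]
  exact (sq_inner_le _ _).trans (by gcongr)

/-- The companion with the gradient bounded; the velocity of f has L² norm at most that of f. -/
theorem norm_adv_le_grad {f h : L2} (hf : H3 f) (hh : H3 h) {c : ℝ} (hc : 0 ≤ c)
    (hv : ∀ᵐ x : Plane, ‖grad h x‖ ≤ c) : ‖adv f h‖ ≤ c * ‖f‖ := by
  refine le_of_sq_le_sq ?_ (by positivity)
  rw [mul_pow]
  refine le_trans ?_ (mul_le_mul_of_nonneg_left (norm_riesz_sq_add f) (sq_nonneg c))
  rw [← integral_sq_eq, ← integral_sq_eq, ← integral_sq_eq,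
    ← integral_add (integrable_sq _) (integrable_sq _), ← integral_const_mul]
  refine integral_mono_ae (integrable_sq _) (((integrable_sq _).add (integrable_sq _)).const_mul _) ?_
  filter_upwards [hv, adv_ae hf hh] with x h1 h2
  rw [h2, ← norm_sq_velocity]
  exact (sq_inner_le _ _).trans (by rw [mul_comm]; gcongr)

/-! ### Bernstein's inequality -/

/-- A smooth cutoff equal to one on the unit ball. -/
def cutoff : ContDiffBump (0 : Plane) := ⟨1, 2, one_pos, one_lt_two⟩

/-- The symbol `e^{2πi x·ξ} 2πi ξ_j χ(ξ)`, with a smooth cutoff `χ`. -/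
def bernSymbol (j : Fin 2) (x : Plane) : 𝓢(Plane, ℂ) :=
  HasCompactSupport.toSchwartzMap
    (f := fun ξ => (cutoff ξ : ℂ) *
      (Complex.exp (((2 * Real.pi * inner ℝ ξ x : ℝ) : ℂ) * Complex.I) * dsym (some j) ξ))
    (HasCompactSupport.mul_right (f := fun ξ => (cutoff ξ : ℂ))
      (cutoff.hasCompactSupport.comp_left (g := fun r : ℝ => (r : ℂ)) Complex.ofReal_zero))
    (by
      have h1 : ContDiff ℝ ∞ (fun ξ : Plane => (cutoff ξ : ℂ)) :=
        Complex.ofRealCLM.contDiff.comp cutoff.contDiff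
      have h2 : ContDiff ℝ ∞ (fun ξ : Plane => ((2 * Real.pi * inner ℝ ξ x : ℝ) : ℂ)) :=
        Complex.ofRealCLM.contDiff.comp (contDiff_const.mul (contDiff_id.inner ℝ contDiff_const))
      have h3 : ContDiff ℝ ∞ (dsym (some j)) := by
        have : ContDiff ℝ ∞ (fun ξ : Plane => ((ξ j : ℝ) : ℂ)) :=
          Complex.ofRealCLM.contDiff.comp (EuclideanSpace.proj (𝕜 := ℝ) j).contDiff
        exact contDiff_const.mul this
      exact h1.mul ((h2.mul contDiff_const).cexp.mul h3))

theorem bernSymbol_apply (j : Fin 2) (x ξ : Plane) : bernSymbol j x ξ = (cutoff ξ : ℂ) *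
      (Complex.exp (((2 * Real.pi * inner ℝ ξ x : ℝ) : ℂ) * Complex.I) * dsym (some j) ξ) := rfl

/-- Modulation becomes translation, so the L¹ norm of the kernel, and with it the constant, does not
depend on x. -/
theorem fourier_bernSymbol (j : Fin 2) (x y : Plane) :
    (𝓕 (bernSymbol j x)) y = (𝓕 (bernSymbol j 0)) (y - x) := by
  rw [SchwartzMap.fourier_coe, SchwartzMap.fourier_coe, Real.fourier_eq', Real.fourier_eq']
  refine integral_congr_ae (Eventually.of_forall fun v => ?_)
  simp only [bernSymbol_apply, smul_eq_mul, inner_zero_right, mul_zero, Complex.ofReal_zero,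
    zero_mul, Complex.exp_zero, one_mul, inner_sub_right]
  have : Complex.exp (((-2 * Real.pi * (inner ℝ v y - inner ℝ v x) : ℝ) : ℂ) * Complex.I)
    = Complex.exp (((-2 * Real.pi * inner ℝ v y : ℝ) : ℂ) * Complex.I) *
      Complex.exp (((2 * Real.pi * inner ℝ v x : ℝ) : ℂ) * Complex.I) := by
    rw [← Complex.exp_add]; congr 1; push_cast; ring
  rw [this]; ring

/-- The constant in Bernstein's inequality. -/
def bernC : ℝ := 1 + ∑ j, ∫ y, ‖(𝓕 (bernSymbol j 0)) y‖

theorem one_le_bernC : 1 ≤ bernC :=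
  le_add_of_nonneg_right (Finset.sum_nonneg fun _ _ => integral_nonneg fun _ => norm_nonneg _)

theorem bernC_pos : 0 < bernC := zero_lt_one.trans_le one_le_bernC

theorem integral_bernSymbol_le (j : Fin 2) : ∫ y, ‖(𝓕 (bernSymbol j 0)) y‖ ≤ bernC := by
  have := Finset.single_le_sum (f := fun j => ∫ y, ‖(𝓕 (bernSymbol j 0)) y‖)
    (fun _ _ => integral_nonneg fun _ => norm_nonneg _) (Finset.mem_univ j)
  have h2 : bernC = 1 + ∑ j, ∫ y, ‖(𝓕 (bernSymbol j 0)) y‖ := rfl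
  linarith

/-- Bernstein's inequality. -/
theorem abs_partialD_le {f : L2} (hf : BL 1 f) {c : ℝ} (hc : ∀ᵐ x : Plane, |f x| ≤ c) (j : Fin 2) :
    ∀ᵐ x : Plane, |partialD j f x| ≤ bernC * c := by
  have hc0 : 0 ≤ c := by
    obtain ⟨x, hx⟩ := hc.exists
    exact (abs_nonneg _).trans hx
  filter_upwards [ofReal_ae_eq_fourierInv _ (hf.h3.integrable_fh_partialD j)] with x hx
  -- Fourier inversion at x followed by the multiplication formula writes the derivative as a
  -- pairing of f with a translated Schwartz kernel. The cutoff can be inserted because it equals 1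
  -- on the spectrum of f.
  have e1 : ((partialD j f x : ℝ) : ℂ) = ∫ y, (𝓕 (bernSymbol j x)) y *
      (Complex.ofRealCLM.compLp f : L2C) y := by
    rw [hx, ← integral_mul_fourier, Real.fourierInv_eq']
    refine integral_congr_ae ?_
    filter_upwards [fh_partialD hf.h3 j, fh_ae f, hf] with ξ h1 h2 h3
    rw [h1, bernSymbol_apply, smul_eq_mul]
    change _ = _ * fhat f ξ
    rw [← h2]
    rcases le_or_gt ‖ξ‖ 1 with h | h
    · have : cutoff ξ = 1 := cutoff.one_of_mem_closedBall (by simpa [cutoff] using h)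
      rw [this]; simp only [dsym]; push_cast; ring
    · simp [h3 h]
  have hi : Integrable fun y => ‖(𝓕 (bernSymbol j 0)) y‖ := (𝓕 (bernSymbol j 0)).integrable.norm
  have hi' : Integrable fun y => ‖(𝓕 (bernSymbol j 0)) (y - x)‖ * c :=
    (hi.comp_sub_right x).mul_const c
  calc |partialD j f x| = ‖((partialD j f x : ℝ) : ℂ)‖ := by
        rw [Complex.norm_real, Real.norm_eq_abs]
    _ ≤ ∫ y, ‖(𝓕 (bernSymbol j 0)) (y - x)‖ * c := by
        rw [e1]
        refine norm_integral_le_of_norm_le hi' ?_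
        filter_upwards [hc, Complex.ofRealCLM.coeFn_compLp f] with y h1 h2
        rw [norm_mul, h2, fourier_bernSymbol]
        gcongr
        simpa using h1
    _ = (∫ y, ‖(𝓕 (bernSymbol j 0)) y‖) * c := by
        rw [integral_mul_const]
        congr 1
        exact integral_sub_right_eq_self (μ := volume) (fun y : Plane => ‖(𝓕 (bernSymbol j 0)) y‖) x
    _ ≤ bernC * c := by gcongr; exact integral_bernSymbol_le j

theorem abs_dd_le {f : L2} (hf : BL 1 f) {c : ℝ} (hc : ∀ᵐ x : Plane, |f x| ≤ c)
    (i : Option (Fin 2)) : ∀ᵐ x : Plane, |dd i f x| ≤ bernC * c := by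
  rcases i with _ | j
  · rw [dd_none]
    filter_upwards [hc] with x hx
    exact hx.trans (le_mul_of_one_le_left ((abs_nonneg _).trans hx) one_le_bernC)
  · exact abs_partialD_le hf hc j

theorem BL.riesz {R : ℝ} {f : L2} (hf : BL R f) (j : Fin 2) : BL R (riesz j f) :=
  hf.fourierMul (hSym_riesz j) (inDomain_riesz j f)

theorem riesz_partialD {R : ℝ} {f : L2} (hf : BL R f) (i j : Fin 2) :
    riesz i (partialD j f) = partialD j (riesz i f) := by
  refine ext_fh ?_
  filter_upwards [fh_riesz i (partialD j f), fh_partialD hf.h3 j,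
    fh_partialD (hf.riesz i).h3 j, fh_riesz i f] with ξ h1 h2 h3 h4
  rw [h1, h2, h3, h4]; ring

theorem abs_riesz_le_norm_velocity (f : L2) (x : Plane) (j : Fin 2) :
    |riesz j f x| ≤ ‖velocity f x‖ := by
  refine abs_le_of_sq_le_sq ?_ (norm_nonneg _)
  rw [norm_sq_velocity]
  fin_cases j
  · exact le_add_of_nonneg_right (sq_nonneg _)
  · exact le_add_of_nonneg_left (sq_nonneg _)

theorem norm_velocity_le {f : L2} {x : Plane} {c : ℝ} (h : ∀ j, |riesz j f x| ≤ c) :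
    ‖velocity f x‖ ≤ 2 * c := by
  have h0 : 0 ≤ c := (abs_nonneg _).trans (h 0)
  refine le_of_sq_le_sq ?_ (by positivity)
  rw [norm_sq_velocity]
  nlinarith [sq_le_sq' (neg_le_of_abs_le (h 0)) (le_of_abs_le (h 0)),
    sq_le_sq' (neg_le_of_abs_le (h 1)) (le_of_abs_le (h 1))]

theorem norm_grad_le {f : L2} {x : Plane} {c : ℝ} (h : ∀ j, |partialD j f x| ≤ c) :
    ‖grad f x‖ ≤ 2 * c := by
  have h0 : 0 ≤ c := (abs_nonneg _).trans (h 0)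
  refine le_of_sq_le_sq ?_ (by positivity)
  rw [norm_sq_grad]
  nlinarith [sq_le_sq' (neg_le_of_abs_le (h 0)) (le_of_abs_le (h 0)),
    sq_le_sq' (neg_le_of_abs_le (h 1)) (le_of_abs_le (h 1))]

theorem riesz_zero (j : Fin 2) : riesz j 0 = 0 := by
  refine ext_fh ?_
  filter_upwards [fh_riesz j 0, fh_zero] with ξ h1 h2
  rw [h1, h2, mul_zero]

/-- Riesz transforms commute with derivatives, so Bernstein applies to each component of the
velocity; the factor 2 passes from components back to the Euclidean norm. -/
theorem norm_velocity_dl_le {f : L2} (hf : BL 1 f) {c : ℝ}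
    (hc : ∀ᵐ x : Plane, ‖velocity f x‖ ≤ c) (i : Option (Fin 2)) :
    ∀ᵐ x : Plane, ‖velocity (dl i f) x‖ ≤ 2 * bernC * c := by
  have hp := bernC_pos
  rcases i with _ | j
  · filter_upwards [hc, Lp.coeFn_zero ℝ 2 (volume : Measure Plane)] with x hx h0
    have h1 : ∀ j, |riesz j 0 x| ≤ bernC * c := fun j => by
      rw [riesz_zero, h0]
      simpa using mul_nonneg hp.le ((norm_nonneg _).trans hx)
    exact (norm_velocity_le h1).trans (by rw [mul_assoc])
  · have h : ∀ᵐ x : Plane, ∀ i, |riesz i (partialD j f) x| ≤ bernC * c := by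
      refine ae_all_iff.2 fun i => ?_
      rw [riesz_partialD hf]
      refine abs_partialD_le (hf.riesz i) ?_ j
      filter_upwards [hc] with x hx using (abs_riesz_le_norm_velocity f x i).trans hx
    filter_upwards [h] with x hx
    exact (norm_velocity_le hx).trans (by rw [mul_assoc])

/-! ### H³ estimates for the interaction with a band-limited function -/

/-- The third order Leibniz rule. -/
theorem ddd_adv {R R' : ℝ} {f h : L2} (hf : BL R f) (hh : BL R' h) (i j k : Option (Fin 2)) :
    ddd i j k (adv f h) =
      adv (dl i (dl j (dl k f))) h + adv (dl j (dl k f)) (dd i h)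
      + (adv (dl i (dl k f)) (dd j h) + adv (dl k f) (dd i (dd j h)))
      + (adv (dl i (dl j f)) (dd k h) + adv (dl j f) (dd i (dd k h))
        + (adv (dl i f) (dd j (dd k h)) + adv f (ddd i j k h))) := by
  have b1 := (hf.dl k).adv hh
  have b2 := hf.adv (hh.dd k)
  have b3 := ((hf.dl k).dl j).adv hh
  have b4 := (hf.dl k).adv (hh.dd j)
  have b5 := (hf.dl j).adv (hh.dd k)
  have b6 := hf.adv ((hh.dd k).dd j)
  rw [ddd, dd_adv hf hh, dd_add b1 b2, dd_adv (hf.dl k) hh, dd_adv hf (hh.dd k),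
    dd_add (b3.add b4) (b5.add b6), dd_add b3 b4, dd_add b5 b6,
    dd_adv ((hf.dl k).dl j) hh, dd_adv (hf.dl k) (hh.dd j), dd_adv (hf.dl j) (hh.dd k),
    dd_adv hf ((hh.dd k).dd j), ddd]

theorem norm_Lam_dd_dd_le {R : ℝ} {g : L2} (hg : BL R g) (i j : Option (Fin 2)) :
    ‖Lam (dd i (dd j g))‖ ≤ ‖J3 g‖ := by
  refine norm_le_norm_of_fh_le ?_
  filter_upwards [((hg.dd j).dd i).h3.fh_Lam, (hg.dd j).fh_dd i, hg.fh_dd j, fh_J3 hg.h3]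
    with ξ h1 h2 h3 h4
  rw [h1, h2, h3, h4, norm_mul, norm_Lam_symbol, norm_mul, norm_mul, norm_mul, norm_jp3]
  have a1 := norm_le_jp ξ
  have a2 := norm_dsym_le i ξ
  have a3 := norm_dsym_le j ξ
  have hj := jp_pos ξ
  calc _ ≤ jp ξ * (jp ξ * (jp ξ * ‖fh g ξ‖)) := by gcongr
    _ = _ := by ring

theorem norm_fh_dl_le {R : ℝ} {f : L2} (hf : BL R f) (i : Option (Fin 2)) :
    ∀ᵐ ξ : Plane, ‖fh (dl i f) ξ‖ ≤ jp ξ * ‖fh f ξ‖ := by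
  rcases i with _ | j
  · filter_upwards [fh_zero] with ξ h
    have : fh (dl none f) ξ = 0 := h
    rw [this, norm_zero]
    exact mul_nonneg (jp_pos ξ).le (norm_nonneg _)
  · filter_upwards [hf.fh_dd (some j)] with ξ h
    have : fh (dl (some j) f) ξ = dsym (some j) ξ * fh f ξ := h
    rw [this, norm_mul]
    exact mul_le_mul_of_nonneg_right (norm_dsym_le _ ξ) (norm_nonneg _)

theorem norm_dl3_le {R : ℝ} {f : L2} (hf : BL R f) (i j k : Option (Fin 2)) :
    ‖dl i (dl j (dl k f))‖ ≤ ‖J3 f‖ := by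
  refine norm_le_norm_of_fh_le ?_
  filter_upwards [norm_fh_dl_le ((hf.dl k).dl j) i, norm_fh_dl_le (hf.dl k) j, norm_fh_dl_le hf k,
    fh_J3 hf.h3] with ξ h1 h2 h3 h4
  rw [h4, norm_mul, norm_jp3]
  have hj := jp_pos ξ
  calc _ ≤ jp ξ * (jp ξ * (jp ξ * ‖fh f ξ‖)) :=
        h1.trans (by gcongr; exact h2.trans (by gcongr))
    _ = _ := by ring

theorem norm_dl2_le {R : ℝ} {f : L2} (hf : BL R f) (i j : Option (Fin 2)) :
    ‖dl i (dl j f)‖ ≤ ‖J3 f‖ := by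
  refine norm_le_norm_of_fh_le ?_
  filter_upwards [norm_fh_dl_le (hf.dl j) i, norm_fh_dl_le hf j, fh_J3 hf.h3] with ξ h1 h2 h4
  rw [h4, norm_mul, norm_jp3]
  have hj := one_le_jp ξ
  calc _ ≤ jp ξ * (jp ξ * (1 * ‖fh f ξ‖)) :=
        h1.trans (by gcongr; simpa using h2)
    _ ≤ jp ξ * (jp ξ * (jp ξ * ‖fh f ξ‖)) := by gcongr
    _ = _ := by ring

theorem norm_dl1_le {R : ℝ} {f : L2} (hf : BL R f) (i : Option (Fin 2)) :
    ‖dl i f‖ ≤ ‖J3 f‖ := by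
  refine norm_le_norm_of_fh_le ?_
  filter_upwards [norm_fh_dl_le hf i, fh_J3 hf.h3] with ξ h1 h4
  rw [h4, norm_mul, norm_jp3]
  exact h1.trans (mul_le_mul_of_nonneg_right (jp_le_pow ξ) (norm_nonneg _))

theorem norm_ddd_le {R : ℝ} {f : L2} (hf : BL R f) (i j k : Option (Fin 2)) :
    ‖ddd i j k f‖ ≤ ‖J3 f‖ := by
  refine norm_le_norm_of_fh_le ?_
  filter_upwards [hf.fh_ddd i j k, fh_J3 hf.h3] with ξ h1 h4
  rw [h1, h4, norm_mul, norm_mul, norm_mul, norm_mul, norm_jp3]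
  have a1 := norm_dsym_le i ξ
  have a2 := norm_dsym_le j ξ
  have a3 := norm_dsym_le k ξ
  have hj := jp_pos ξ
  calc _ ≤ jp ξ * jp ξ * jp ξ * ‖fh f ξ‖ := by gcongr
    _ = _ := by ring

/-- Transport by a band-limited velocity field does not lose derivatives. -/
theorem abs_inner_J3_adv_le {R : ℝ} {f g : L2} (hf : BL 1 f) (hg : BL R g) {c : ℝ} (hc0 : 0 ≤ c)
    (hc : ∀ᵐ x : Plane, ‖velocity f x‖ ≤ c) :
    |inner ℝ (J3 g) (J3 (adv f g))| ≤ 189 * ((2 * bernC) ^ 3 * c) * ‖J3 g‖ ^ 2 := by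
  have hB : 1 ≤ 2 * bernC := by linarith [one_le_bernC]
  have hB0 : 0 ≤ 2 * bernC := zero_le_one.trans hB
  set B := 2 * bernC with hBdef
  have hmono1 : B * c ≤ B ^ 3 * c := by gcongr; exact le_self_pow₀ hB (by norm_num)
  have hmono2 : B * (B * c) ≤ B ^ 3 * c := by
    rw [← mul_assoc, ← sq]; gcongr; norm_num
  have V1 : ∀ i, ∀ᵐ x : Plane, ‖velocity (dl i f) x‖ ≤ B * c := fun i => norm_velocity_dl_le hf hc i
  have V2 : ∀ i j, ∀ᵐ x : Plane, ‖velocity (dl i (dl j f)) x‖ ≤ B * (B * c) := fun i j =>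
    norm_velocity_dl_le (hf.dl j) (V1 j) i
  have V3 : ∀ i j k, ∀ᵐ x : Plane, ‖velocity (dl i (dl j (dl k f))) x‖ ≤ B * (B * (B * c)) :=
    fun i j k => norm_velocity_dl_le ((hf.dl k).dl j) (V2 j k) i
  have key : ∀ {p q : L2} {c' : ℝ}, BL 1 p → BL R q → (∀ᵐ x : Plane, ‖velocity p x‖ ≤ c') →
      c' ≤ B ^ 3 * c → ‖Lam q‖ ≤ ‖J3 g‖ → ‖adv p q‖ ≤ B ^ 3 * c * ‖J3 g‖ := by
    intro p q c' hp hq hv hc' hL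
    have hv' : ∀ᵐ x : Plane, ‖velocity p x‖ ≤ B ^ 3 * c := hv.mono fun x h => h.trans hc'
    exact (norm_adv_le_velocity hp.h3 hq.h3 (by positivity) hv').trans (by gcongr)
  have L2' := norm_Lam_dd_dd_le hg
  have L1' : ∀ i, ‖Lam (dd i g)‖ ≤ ‖J3 g‖ := fun i => by simpa [dd_none] using L2' none i
  have L0' : ‖Lam g‖ ≤ ‖J3 g‖ := by simpa [dd_none] using L2' none none
  -- Of the eight Leibniz terms, the one with three derivatives on g cancels. In the other seven at
  -- most two fall on g, and the gradient in the transport brings them to three. Summing over 27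
  -- triples gives 189 = 7 · 27.
  have term : ∀ i j k, |inner ℝ (ddd i j k g) (ddd i j k (adv f g))|
      ≤ 7 * (B ^ 3 * c * ‖J3 g‖) * ‖J3 g‖ := by
    intro i j k
    rw [ddd_adv hf hg]
    have z : inner ℝ (ddd i j k g) (adv f (ddd i j k g)) = 0 := by
      rw [real_inner_comm]; exact inner_adv_self hf.h3 (hg.ddd i j k).h3
    rw [← add_assoc (adv (dl i (dl j f)) (dd k g) + _), ← add_assoc, inner_add_right, z, add_zero]
    refine (abs_real_inner_le_norm _ _).trans ?_
    rw [mul_comm]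
    gcongr
    · have t1 := key (((hf.dl k).dl j).dl i) hg (V3 i j k) (le_of_eq (by ring)) L0'
      have t2 := key ((hf.dl k).dl j) (hg.dd i) (V2 j k) hmono2 (L1' i)
      have t3 := key ((hf.dl k).dl i) (hg.dd j) (V2 i k) hmono2 (L1' j)
      have t4 := key (hf.dl k) ((hg.dd j).dd i) (V1 k) hmono1 (L2' i j)
      have t5 := key ((hf.dl j).dl i) (hg.dd k) (V2 i j) hmono2 (L1' k)
      have t6 := key (hf.dl j) ((hg.dd k).dd i) (V1 j) hmono1 (L2' i k)
      have t7 := key (hf.dl i) ((hg.dd k).dd j) (V1 i) hmono1 (L2' j k)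
      refine (norm_add_le _ _).trans ?_
      refine (add_le_add ((norm_add_le _ _).trans (add_le_add (norm_add_le _ _) (norm_add_le _ _)))
        ((norm_add_le _ _).trans (add_le_add (norm_add_le _ _) le_rfl))).trans ?_
      linarith
    · exact norm_ddd_le hg i j k
  have hadv : BL (1 + R) (adv f g) := hf.adv hg
  rw [inner_J3_eq_sum (hg.mono (by linarith)) hadv]
  calc |∑ i, ∑ j, ∑ k, inner ℝ (ddd i j k g) (ddd i j k (adv f g))|
      ≤ ∑ i, ∑ j, ∑ k, |inner ℝ (ddd i j k g) (ddd i j k (adv f g))| :=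
        (Finset.abs_sum_le_sum_abs _ _).trans (Finset.sum_le_sum fun i _ =>
          (Finset.abs_sum_le_sum_abs _ _).trans (Finset.sum_le_sum fun j _ =>
            Finset.abs_sum_le_sum_abs _ _))
    _ ≤ ∑ i : Option (Fin 2), ∑ j : Option (Fin 2), ∑ k : Option (Fin 2),
          7 * (B ^ 3 * c * ‖J3 g‖) * ‖J3 g‖ :=
        Finset.sum_le_sum fun i _ => Finset.sum_le_sum fun j _ => Finset.sum_le_sum fun k _ => term i j k
    _ = _ := by simp; ring

/-- Products with the gradient of a band-limited function. -/
theorem norm_J3_adv_le {R : ℝ} {f g : L2} (hf : BL 1 f) (hg : BL R g) {c : ℝ} (hc0 : 0 ≤ c)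
    (hc : ∀ᵐ x : Plane, |f x| ≤ c) :
    ‖J3 (adv g f)‖ ≤ 96 * (bernC ^ 4 * c) * ‖J3 g‖ := by
  have hB : 1 ≤ bernC := one_le_bernC
  have hB0 : 0 ≤ bernC := zero_le_one.trans hB
  set B := bernC with hBdef
  have G : ∀ {p : L2} {c' : ℝ}, BL 1 p → (∀ᵐ x : Plane, |p x| ≤ c') → c' ≤ B ^ 3 * c →
      ∀ᵐ x : Plane, ‖grad p x‖ ≤ 2 * (B ^ 4 * c) := by
    intro p c' hp hv hc'
    have h : ∀ᵐ x : Plane, ∀ j, |partialD j p x| ≤ B * c' := ae_all_iff.2 fun j => abs_partialD_le hp hv j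
    filter_upwards [h] with x hx
    refine (norm_grad_le hx).trans ?_
    have : B * c' ≤ B * (B ^ 3 * c) := by gcongr
    calc 2 * (B * c') ≤ 2 * (B * (B ^ 3 * c)) := by gcongr
      _ = _ := by ring
  have V1 : ∀ i, ∀ᵐ x : Plane, |dd i f x| ≤ B * c := fun i => abs_dd_le hf hc i
  have V2 : ∀ i j, ∀ᵐ x : Plane, |dd i (dd j f) x| ≤ B * (B * c) := fun i j =>
    abs_dd_le (hf.dd j) (V1 j) i
  have V3 : ∀ i j k, ∀ᵐ x : Plane, |ddd i j k f x| ≤ B * (B * (B * c)) :=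
    fun i j k => abs_dd_le ((hf.dd k).dd j) (V2 j k) i
  have m0 : c ≤ B ^ 3 * c := le_mul_of_one_le_left hc0 (one_le_pow₀ hB)
  have m1 : B * c ≤ B ^ 3 * c := by gcongr; exact le_self_pow₀ hB (by norm_num)
  have m2 : B * (B * c) ≤ B ^ 3 * c := by
    rw [← mul_assoc, ← sq]; gcongr; norm_num
  have key : ∀ {p q : L2} {c' : ℝ}, BL R p → BL 1 q → (∀ᵐ x : Plane, |q x| ≤ c') →
      c' ≤ B ^ 3 * c → ‖p‖ ≤ ‖J3 g‖ → ‖adv p q‖ ≤ 2 * (B ^ 4 * c) * ‖J3 g‖ := by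
    intro p q c' hp hq hv hc' hL
    exact (norm_adv_le_grad hp.h3 hq.h3 (by positivity) (G hq hv hc')).trans (by gcongr)
  -- All eight terms are kept, each with a factor 2 from the Euclidean norm of the gradient. The
  -- fourth power of B counts up to three derivatives and the gradient itself.
  have term : ∀ i j k, ‖ddd i j k (adv g f)‖ ≤ 16 * (B ^ 4 * c) * ‖J3 g‖ := by
    intro i j k
    rw [ddd_adv hg hf]
    have t1 := key (((hg.dl k).dl j).dl i) hf hc m0 (norm_dl3_le hg i j k)
    have t2 := key ((hg.dl k).dl j) (hf.dd i) (V1 i) m1 (norm_dl2_le hg j k)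
    have t3 := key ((hg.dl k).dl i) (hf.dd j) (V1 j) m1 (norm_dl2_le hg i k)
    have t4 := key (hg.dl k) ((hf.dd j).dd i) (V2 i j) m2 (norm_dl1_le hg k)
    have t5 := key ((hg.dl j).dl i) (hf.dd k) (V1 k) m1 (norm_dl2_le hg i j)
    have t6 := key (hg.dl j) ((hf.dd k).dd i) (V2 i k) m2 (norm_dl1_le hg j)
    have t7 := key (hg.dl i) ((hf.dd k).dd j) (V2 j k) m2 (norm_dl1_le hg i)
    have t8 := key hg (hf.ddd i j k) (V3 i j k) (le_of_eq (by ring))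
      (norm_le_J3 hg.h3)
    refine (norm_add_le _ _).trans ?_
    refine (add_le_add ((norm_add_le _ _).trans (add_le_add (norm_add_le _ _) (norm_add_le _ _)))
      ((norm_add_le _ _).trans (add_le_add (norm_add_le _ _) (norm_add_le _ _)))).trans ?_
    linarith
  refine le_of_sq_le_sq ?_ (by positivity)
  have hadv : BL (R + 1) (adv g f) := hg.adv hf
  rw [← real_inner_self_eq_norm_sq, inner_J3_eq_sum hadv hadv]
  calc ∑ i, ∑ j, ∑ k, inner ℝ (ddd i j k (adv g f)) (ddd i j k (adv g f))
      ≤ ∑ i : Option (Fin 2), ∑ j : Option (Fin 2), ∑ k : Option (Fin 2),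
          (16 * (B ^ 4 * c) * ‖J3 g‖) ^ 2 :=
        Finset.sum_le_sum fun i _ => Finset.sum_le_sum fun j _ => Finset.sum_le_sum fun k _ => by
          rw [real_inner_self_eq_norm_sq]
          exact pow_le_pow_left₀ (norm_nonneg _) (term i j k) 2
    _ = 27 * (16 * (B ^ 4 * c) * ‖J3 g‖) ^ 2 := by simp; ring
    -- 27 · 16² = 6912 ≤ 9216 = 96².
    _ ≤ _ := by nlinarith [sq_nonneg ((B ^ 4 * c) * ‖J3 g‖)]

/-! ### Frequency projections and the linear equation -/

/-- The indicator function of the ball of radius `R`. -/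
def ind (R : ℝ) (ξ : Plane) : ℝ := if ‖ξ‖ ≤ R then 1 else 0

theorem rSym_ind (R : ℝ) : RSym (ind R) :=
  RSym.of_norm (F := fun r => if r ≤ R then 1 else 0)
    (Measurable.ite measurableSet_Iic measurable_const measurable_const)

theorem ind_nonneg (R : ℝ) (ξ : Plane) : 0 ≤ ind R ξ := by unfold ind; split_ifs <;> norm_num

theorem ind_le_one (R : ℝ) (ξ : Plane) : ind R ξ ≤ 1 := by unfold ind; split_ifs <;> norm_num

theorem ind_of_le {R : ℝ} {ξ : Plane} (h : ‖ξ‖ ≤ R) : ind R ξ = 1 := if_pos h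

theorem ind_of_lt {R : ℝ} {ξ : Plane} (h : R < ‖ξ‖) : ind R ξ = 0 := if_neg (not_le.2 h)

theorem bdd_mul_ind {m : Plane → ℝ} {R C : ℝ} (h : ∀ ξ, ‖ξ‖ ≤ R → |m ξ| ≤ C) :
    ∀ ξ, |m ξ * ind R ξ| ≤ max C 0 := by
  intro ξ
  rcases le_or_gt ‖ξ‖ R with h1 | h1
  · rw [ind_of_le h1, mul_one]; exact (h ξ h1).trans (le_max_left _ _)
  · rw [ind_of_lt h1, mul_zero, abs_zero]; exact le_max_right _ _

theorem bdd_ind (R : ℝ) : ∃ C, ∀ ξ, |ind R ξ| ≤ C :=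
  ⟨1, fun ξ => by rw [abs_of_nonneg (ind_nonneg R ξ)]; exact ind_le_one R ξ⟩

/-- The projection onto frequencies of size at most `R`. -/
def proj (R : ℝ) : L2 →L[ℝ] L2 := bmul (ind R) (rSym_ind R) (bdd_ind R)

theorem fh_proj (R : ℝ) (f : L2) : fh (proj R f) =ᵐ[volume] fun ξ => ind R ξ * fh f ξ :=
  fh_bmul _ _ _ f

theorem BL.proj (R : ℝ) (f : L2) : BL R (proj R f) := by
  filter_upwards [fh_proj R f] with ξ e h
  rw [e, ind_of_lt h]; simp

theorem BL.proj_eq {R : ℝ} {f : L2} (hf : BL R f) : SQG.proj R f = f := by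
  refine ext_fh ?_
  filter_upwards [fh_proj R f, hf] with ξ e h
  rw [e]
  rcases le_or_gt ‖ξ‖ R with h1 | h1
  · rw [ind_of_le h1]; simp
  · rw [h h1, mul_zero]

theorem norm_proj_le (R : ℝ) (f : L2) : ‖proj R f‖ ≤ ‖f‖ := by
  have := norm_bmul_le (rSym_ind R) (bdd_ind R) (C := 1) (fun ξ => by
    rw [abs_of_nonneg (ind_nonneg R ξ)]; exact ind_le_one R ξ) f
  rwa [one_mul] at this

theorem inner_proj_left (R : ℝ) (f g : L2) : inner ℝ (proj R f) g = inner ℝ f (proj R g) :=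
  inner_bmul_left _ _ f g

theorem inner_bmul_self_nonneg {m : Plane → ℝ} (h : RSym m) (hb : ∃ C, ∀ ξ, |m ξ| ≤ C)
    (h0 : ∀ ξ, 0 ≤ m ξ) (f : L2) : 0 ≤ inner ℝ f (bmul m h hb f) := by
  rw [inner_eq_integral]
  refine integral_nonneg_of_ae ?_
  filter_upwards [fh_bmul m h hb f] with ξ e
  rw [e, show conj (fh f ξ) * (m ξ * fh f ξ) = ((m ξ : ℝ) : ℂ) * (conj (fh f ξ) * fh f ξ) by ring,
    Complex.re_ofReal_mul, Complex.conj_mul']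
  refine mul_nonneg (h0 ξ) ?_
  norm_cast
  positivity

/-- A real function with nonpositive derivative on `(0, ∞)`, continuous on `[0, ∞)`, decreases. -/
theorem le_initial_of_deriv_nonpos {e e' : ℝ → ℝ} (hc : ContinuousOn e (Ici 0))
    (hd : ∀ t, 0 < t → HasDerivAt e (e' t) t) (hn : ∀ t, 0 < t → e' t ≤ 0) {s t : ℝ} (hs : 0 ≤ s)
    (hst : s ≤ t) : e t ≤ e s := by
  have := antitoneOn_of_deriv_nonpos (convex_Ici (0 : ℝ)) hc
    (fun x hx => by
      rw [interior_Ici] at hx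
      exact (hd x hx).differentiableAt.differentiableWithinAt)
    (fun x hx => by
      rw [interior_Ici] at hx
      rw [(hd x hx).deriv]; exact hn x hx)
  exact this hs (hs.trans hst) hst

/-- The squared norm is nonincreasing and starts from zero. With zero derivative it also serves to
show that a curve vanishes identically. -/
theorem eq_zero_of_inner_deriv_nonpos {w w' : ℝ → L2} (hc : ContinuousOn w (Ici 0))
    (hd : ∀ t, 0 < t → HasDerivAt w (w' t) t) (hn : ∀ t, 0 < t → inner ℝ (w t) (w' t) ≤ 0)
    (h0 : w 0 = 0) {t : ℝ} (ht : 0 ≤ t) : w t = 0 := by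
  have h := le_initial_of_deriv_nonpos (e := fun t => ‖w t‖ ^ 2) (hc.norm.pow 2)
    (fun t ht => (hd t ht).norm_sq) (fun t ht => by have := hn t ht; linarith) le_rfl ht
  simp only [h0, norm_zero] at h
  have : ‖w t‖ ^ 2 ≤ 0 := by simpa using h
  exact norm_eq_zero.1 (pow_eq_zero_iff two_ne_zero |>.1 (le_antisymm this (sq_nonneg _)))

/-- The symbol of `(-Δ)^α`. -/
def lam (α : ℝ) (ξ : Plane) : ℝ := (2 * Real.pi * ‖ξ‖) ^ (2 * α)

theorem rSym_lam (α : ℝ) : RSym (lam α) := rSym_pow_norm (2 * α)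

theorem lam_nonneg (α : ℝ) (ξ : Plane) : 0 ≤ lam α ξ := Real.rpow_nonneg (by positivity) _

theorem hSym_lapSymbol (s : ℝ) : HSym (lapSymbol s) := (rSym_lam s).hSym

theorem lam_le {α R : ℝ} (h0 : 0 ≤ α) {ξ : Plane} (h : ‖ξ‖ ≤ R) :
    lam α ξ ≤ (2 * Real.pi * R) ^ (2 * α) := by
  unfold lam
  gcongr

theorem bdd_lam_ind {α : ℝ} (h0 : 0 ≤ α) (R : ℝ) : ∃ C, ∀ ξ, |lam α ξ * ind R ξ| ≤ C :=
  ⟨_, bdd_mul_ind fun ξ h => by rw [abs_of_nonneg (lam_nonneg α ξ)]; exact lam_le h0 h⟩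

/-- The truncated fractional Laplacian. -/
def lapR (α : ℝ) (h0 : 0 ≤ α) (R : ℝ) : L2 →L[ℝ] L2 :=
  bmul (fun ξ => lam α ξ * ind R ξ) ((rSym_lam α).mul (rSym_ind R)) (bdd_lam_ind h0 R)

theorem fh_lapR (α : ℝ) (h0 : 0 ≤ α) (R : ℝ) (f : L2) :
    fh (lapR α h0 R f) =ᵐ[volume] fun ξ => ((lam α ξ * ind R ξ : ℝ) : ℂ) * fh f ξ :=
  fh_bmul _ _ _ f

theorem inner_lapR_nonneg (α : ℝ) (h0 : 0 ≤ α) (R : ℝ) (f : L2) : 0 ≤ inner ℝ f (lapR α h0 R f) :=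
  inner_bmul_self_nonneg _ _ (fun ξ => mul_nonneg (lam_nonneg α ξ) (ind_nonneg R ξ)) f

theorem fracLap_eq_lapR {α : ℝ} (h0 : 0 ≤ α) {R : ℝ} {f : L2} (hf : BL R f) :
    fracLap α f = lapR α h0 R f := by
  have hd : InDomain (lapSymbol α) f := hf.inDomain (hSym_lapSymbol α)
    (C := (2 * Real.pi * R) ^ (2 * α)) fun ξ h => by
      rw [lapSymbol, Complex.norm_real, Real.norm_eq_abs]
      change |lam α ξ| ≤ _
      rw [abs_of_nonneg (lam_nonneg α ξ)]
      exact lam_le h0 h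
  refine ext_fh ?_
  filter_upwards [(hSym_lapSymbol α).fh_fourierMul hd, fh_lapR α h0 R f, hf] with ξ h1 h2 h3
  rw [fracLap, h1, h2]
  rcases le_or_gt ‖ξ‖ R with h | h
  · rw [ind_of_le h, mul_one]; rfl
  · rw [h3 h, mul_zero, mul_zero]

/-- Differentiation of a semigroup with bounded symbol. -/
theorem hasDerivAt_fourierMul_exp {a : Plane → ℝ} (ha : RSym a) (h0 : ∀ ξ, 0 ≤ a ξ) {A : ℝ}
    (hA : ∀ ξ, a ξ ≤ A) (f : L2) (t : ℝ) :
    HasDerivAt (fun t => fourierMul (fun ξ => ((Real.exp (-(t * a ξ)) : ℝ) : ℂ)) f)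
      (-(bmul a ha ⟨A, fun ξ => by rw [abs_of_nonneg (h0 ξ)]; exact hA ξ⟩
        (fourierMul (fun ξ => ((Real.exp (-(t * a ξ)) : ℝ) : ℂ)) f))) t := by
  have hA0 : 0 ≤ A := (h0 0).trans (hA 0)
  have hs : ∀ t, RSym (fun ξ => Real.exp (-(t * a ξ))) := fun t =>
    ⟨Real.measurable_exp.comp (ha.meas.const_mul t).neg, fun ξ => by rw [ha.even]⟩
  have hbd : ∀ t ξ, Real.exp (-(t * a ξ)) ≤ Real.exp (|t| * A) := fun t ξ => by
    refine Real.exp_le_exp.2 ((neg_le_abs _).trans ?_)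
    rw [abs_mul, abs_of_nonneg (h0 ξ)]
    exact mul_le_mul_of_nonneg_left (hA ξ) (abs_nonneg _)
  have hdom : ∀ t, InDomain (fun ξ => ((Real.exp (-(t * a ξ)) : ℝ) : ℂ)) f := fun t =>
    (hs t).inDomain_of_bounded ⟨_, fun ξ => by rw [Real.abs_exp]; exact hbd t ξ⟩ f
  rw [hasDerivAt_iff_isLittleO_nhds_zero]
  have hO : (fun h : ℝ => fourierMul (fun ξ => ((Real.exp (-((t + h) * a ξ)) : ℝ) : ℂ)) f
      - fourierMul (fun ξ => ((Real.exp (-(t * a ξ)) : ℝ) : ℂ)) f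
      - h • -(bmul a ha ⟨A, fun ξ => by rw [abs_of_nonneg (h0 ξ)]; exact hA ξ⟩
        (fourierMul (fun ξ => ((Real.exp (-(t * a ξ)) : ℝ) : ℂ)) f))) =O[𝓝 0] fun h : ℝ => h ^ 2 := by
    refine Asymptotics.IsBigO.of_bound (Real.exp (|t| * A) * A ^ 2 * ‖f‖) ?_
    -- The remainder bound |eˣ − 1 − x| ≤ x² needs |x| ≤ 1 for x = −h a(ξ). Boundedness of a makes
    -- this uniform in ξ, so the error is O(h²) in L².
    have hev : ∀ᶠ h : ℝ in 𝓝 0, |h| * A ≤ 1 := by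
      have : Tendsto (fun h : ℝ => |h| * A) (𝓝 0) (𝓝 (|(0 : ℝ)| * A)) :=
        (continuous_abs.mul continuous_const).tendsto 0
      rw [abs_zero, zero_mul] at this
      exact this.eventually_le_const one_pos
    filter_upwards [hev] with h hh
    set E := fourierMul (fun ξ => ((Real.exp (-(t * a ξ)) : ℝ) : ℂ)) f with hE
    have key : ‖fhat (fourierMul (fun ξ => ((Real.exp (-((t + h) * a ξ)) : ℝ) : ℂ)) f - E
        - h • -(bmul a ha ⟨A, fun ξ => by rw [abs_of_nonneg (h0 ξ)]; exact hA ξ⟩ E))‖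
        ≤ (Real.exp (|t| * A) * (A ^ 2 * |h| ^ 2)) * ‖fhat f‖ := by
      refine Lp.norm_le_mul_norm_of_ae_le_mul ?_
      filter_upwards [fh_ae f, fh_ae (fourierMul (fun ξ => ((Real.exp (-((t + h) * a ξ)) : ℝ) : ℂ)) f - E
        - h • -(bmul a ha ⟨A, fun ξ => by rw [abs_of_nonneg (h0 ξ)]; exact hA ξ⟩ E)),
        fh_sub (fourierMul (fun ξ => ((Real.exp (-((t + h) * a ξ)) : ℝ) : ℂ)) f - E)
          (h • -(bmul a ha ⟨A, fun ξ => by rw [abs_of_nonneg (h0 ξ)]; exact hA ξ⟩ E)),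
        fh_sub (fourierMul (fun ξ => ((Real.exp (-((t + h) * a ξ)) : ℝ) : ℂ)) f) E,
        (hs (t + h)).hSym.fh_fourierMul (hdom (t + h)), (hs t).hSym.fh_fourierMul (hdom t),
        fh_smul h (-(bmul a ha ⟨A, fun ξ => by rw [abs_of_nonneg (h0 ξ)]; exact hA ξ⟩ E)),
        fh_smul (-1) (bmul a ha ⟨A, fun ξ => by rw [abs_of_nonneg (h0 ξ)]; exact hA ξ⟩ E),
        fh_bmul a ha ⟨A, fun ξ => by rw [abs_of_nonneg (h0 ξ)]; exact hA ξ⟩ E]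
        with ξ e1 e2 e3 e4 e5 e6 e7 e8 e9
      rw [neg_one_smul] at e8
      rw [← e1, ← e2, e3, e4, e5, e7, e8, e9, hE, e6]
      have e10 : ((Real.exp (-((t + h) * a ξ)) : ℝ) : ℂ) * fh f ξ
          - ((Real.exp (-(t * a ξ)) : ℝ) : ℂ) * fh f ξ
          - (h : ℂ) * (((-1 : ℝ) : ℂ) * ((a ξ : ℂ) * (((Real.exp (-(t * a ξ)) : ℝ) : ℂ) * fh f ξ)))
          = ((Real.exp (-(t * a ξ)) * (Real.exp (-(h * a ξ)) - 1 - (-(h * a ξ))) : ℝ) : ℂ) * fh f ξ := by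
        rw [show -((t + h) * a ξ) = -(t * a ξ) + -(h * a ξ) by ring, Real.exp_add]
        push_cast; ring
      rw [e10, norm_mul, Complex.norm_real, Real.norm_eq_abs, abs_mul, Real.abs_exp]
      have hx : |-(h * a ξ)| ≤ 1 := by
        rw [abs_neg, abs_mul, abs_of_nonneg (h0 ξ)]
        exact (mul_le_mul_of_nonneg_left (hA ξ) (abs_nonneg _)).trans hh
      have h3 := Real.abs_exp_sub_one_sub_id_le hx
      have h4 : (-(h * a ξ)) ^ 2 ≤ A ^ 2 * |h| ^ 2 := by
        rw [neg_sq, mul_pow, ← sq_abs h, mul_comm]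
        gcongr
        exacts [h0 ξ, hA ξ]
      gcongr
      · exact Real.exp_le_exp.1 (hbd t ξ)
      · exact h3.trans h4
    rw [norm_fhat, norm_fhat] at key
    refine key.trans (le_of_eq ?_)
    rw [norm_pow, Real.norm_eq_abs]; ring
  exact hO.trans_isLittleO (by simpa using Asymptotics.isLittleO_pow_id (𝕜 := ℝ) one_lt_two)

theorem rSym_heat (μ α t : ℝ) :
    RSym (fun ξ => Real.exp (-(μ * t * (2 * Real.pi * ‖ξ‖) ^ (2 * α)))) :=
  RSym.of_norm (F := fun r => Real.exp (-(μ * t * (2 * Real.pi * r) ^ (2 * α)))) (by fun_prop)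

theorem heat_symbol_le {μ α t : ℝ} (hμ : 0 < μ) (ht : 0 ≤ t) (ξ : Plane) :
    |Real.exp (-(μ * t * (2 * Real.pi * ‖ξ‖) ^ (2 * α)))| ≤ 1 := by
  rw [Real.abs_exp, Real.exp_le_one_iff, neg_nonpos]
  have := lam_nonneg α ξ
  unfold lam at this
  positivity

theorem fh_heat {μ α t : ℝ} (hμ : 0 < μ) (ht : 0 ≤ t) (f : L2) : fh (heat μ α t f) =ᵐ[volume]
    fun ξ => ((Real.exp (-(μ * t * (2 * Real.pi * ‖ξ‖) ^ (2 * α))) : ℝ) : ℂ) * fh f ξ :=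
  (rSym_heat μ α t).hSym.fh_fourierMul
    ((rSym_heat μ α t).inDomain_of_bounded ⟨1, heat_symbol_le hμ ht⟩ f)

/-- Solutions of the linear equation are given by the semigroup. -/
theorem IsLinearSolution.eq_heat {μ α : ℝ} (hμ : 0 < μ) (h0 : 0 ≤ α) {Θ₀ : L2} {Θ : ℝ → L2}
    (h : IsLinearSolution μ α Θ₀ Θ) {t : ℝ} (ht : 0 ≤ t) : Θ t = heat μ α t Θ₀ := by
  -- On a ball of frequencies the generator is bounded. The projected solution and the semigroup
  -- with truncated symbol then solve the same linear ODE, and their difference has nonincreasing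
  -- norm. The balls exhaust the plane.
  have key : ∀ R : ℕ, ∀ᵐ ξ : Plane, ‖ξ‖ ≤ R → fh (Θ t) ξ = fh (heat μ α t Θ₀) ξ := by
    intro R
    have ha : RSym (fun ξ => μ * (lam α ξ * ind R ξ)) :=
      (RSym.const μ).mul ((rSym_lam α).mul (rSym_ind R))
    have ha0 : ∀ ξ, 0 ≤ μ * (lam α ξ * ind R ξ) := fun ξ =>
      mul_nonneg hμ.le (mul_nonneg (lam_nonneg α ξ) (ind_nonneg R ξ))
    obtain ⟨C, hC⟩ := bdd_lam_ind h0 R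
    have haA : ∀ ξ, μ * (lam α ξ * ind R ξ) ≤ μ * C := fun ξ =>
      mul_le_mul_of_nonneg_left ((le_abs_self _).trans (hC ξ)) hμ.le
    have hb : ∃ C, ∀ ξ, |μ * (lam α ξ * ind R ξ)| ≤ C :=
      ⟨μ * C, fun ξ => by rw [abs_of_nonneg (ha0 ξ)]; exact haA ξ⟩
    set z : ℝ → L2 := fun t =>
      fourierMul (fun ξ => ((Real.exp (-(t * (μ * (lam α ξ * ind R ξ)))) : ℝ) : ℂ)) (proj R Θ₀) with hz
    have hzd : ∀ t, HasDerivAt z (-(bmul _ ha hb (z t))) t := fun t =>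
      hasDerivAt_fourierMul_exp ha ha0 haA (proj R Θ₀) t
    have hyd : ∀ t, 0 < t → HasDerivAt (fun t => proj R (Θ t)) (-(bmul _ ha hb (proj R (Θ t)))) t := by
      intro t ht
      have h1 := (proj R).hasFDerivAt.comp_hasDerivAt t (h.equation t ht)
      refine h1.congr_deriv ?_
      refine ext_fh ?_
      rw [← neg_one_smul ℝ (bmul _ ha hb _), ← neg_one_smul ℝ (μ • _)]
      filter_upwards [fh_proj R ((-1 : ℝ) • (μ • fracLap α (Θ t))), fh_smul (-1) (μ • fracLap α (Θ t)),
        fh_smul μ (fracLap α (Θ t)), (hSym_lapSymbol α).fh_fourierMul (h.domain t ht),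
        fh_smul (-1) (bmul _ ha hb (proj R (Θ t))), fh_bmul _ ha hb (proj R (Θ t)),
        fh_proj R (Θ t)] with ξ e1 e2 e3 e4 e5 e6 e7
      rw [e1, e2, e3, fracLap, e4, e5, e6, e7]
      have : lapSymbol α ξ = ((lam α ξ : ℝ) : ℂ) := rfl
      rw [this]
      rcases le_or_gt ‖ξ‖ R with h | h
      · rw [ind_of_le h]; push_cast; ring
      · rw [ind_of_lt h]; simp
    have hw := eq_zero_of_inner_deriv_nonpos (w := fun t => proj R (Θ t) - z t)
      (((proj R).continuous.comp_continuousOn h.continuousOn).sub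
        (fun t _ => (hzd t).continuousAt.continuousWithinAt))
      (fun t ht => (hyd t ht).sub (hzd t))
      (fun t ht => by
        have := inner_bmul_self_nonneg ha hb ha0 (proj R (Θ t) - z t)
        rw [map_sub] at this
        rw [← neg_sub', inner_neg_right]
        linarith)
      (by
        rw [h.initial, hz]
        simpa using (fourierMul_one (proj R Θ₀)).symm ▸ sub_self _) ht
    have hw' : proj R (Θ t) = z t := sub_eq_zero.1 hw
    have hzdom : InDomain (fun ξ => ((Real.exp (-(t * (μ * (lam α ξ * ind R ξ)))) : ℝ) : ℂ)) (proj R Θ₀) := by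
      refine RSym.inDomain_of_bounded (m := fun ξ => Real.exp (-(t * (μ * (lam α ξ * ind R ξ))))) ?_
        ⟨1, fun ξ => ?_⟩ _
      · exact ⟨Real.measurable_exp.comp (ha.meas.const_mul t).neg, fun ξ => by rw [ha.even]⟩
      · rw [Real.abs_exp, Real.exp_le_one_iff, neg_nonpos]
        exact mul_nonneg ht (ha0 ξ)
    have hzs : HSym (fun ξ => ((Real.exp (-(t * (μ * (lam α ξ * ind R ξ)))) : ℝ) : ℂ)) :=
      RSym.hSym (m := fun ξ => Real.exp (-(t * (μ * (lam α ξ * ind R ξ)))))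
        ⟨Real.measurable_exp.comp (ha.meas.const_mul t).neg, fun ξ => by rw [ha.even]⟩
    filter_upwards [fh_proj R (Θ t), hzs.fh_fourierMul hzdom, fh_proj R Θ₀, fh_heat (α := α) hμ ht Θ₀]
      with ξ e1 e2 e3 e4 hξ
    have e5 : fh (proj R (Θ t)) ξ = fh (z t) ξ := by rw [hw']
    rw [e1, hz, e2, e3, ind_of_le hξ] at e5
    rw [e4]
    have : (fun ξ => (2 * Real.pi * ‖ξ‖) ^ (2 * α)) ξ = lam α ξ := rfl
    simp only at this
    rw [this]
    simp only [Complex.ofReal_one, one_mul, mul_one] at e5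
    rw [e5]
    congr 4
    ring
  refine ext_fh ?_
  filter_upwards [ae_all_iff.2 key] with ξ hξ
  obtain ⟨R, hR⟩ := exists_nat_ge ‖ξ‖
  exact hξ R hR

/-! ### Global solutions of dissipative ODEs in a Hilbert space -/

section GlobalODE

variable {E : Type*} [NormedAddCommGroup E] [InnerProductSpace ℝ E]

/-- The radial retraction onto the ball of radius `M`. -/
def retr (M : ℝ) (a : E) : E := (M / max M ‖a‖) • a

theorem norm_retr_le {M : ℝ} (hM : 0 < M) (a : E) : ‖retr M a‖ ≤ M := by
  have h1 : 0 < max M ‖a‖ := hM.trans_le (le_max_left _ _)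
  rw [retr, norm_smul, Real.norm_of_nonneg (by positivity), div_mul_eq_mul_div, div_le_iff₀ h1]
  exact mul_le_mul_of_nonneg_left (le_max_right _ _) hM.le

theorem retr_of_norm_le {M : ℝ} (hM : 0 < M) {a : E} (h : ‖a‖ ≤ M) : retr M a = a := by
  rw [retr, max_eq_left h, div_self hM.ne', one_smul]

/-- The sharp constant is 1, but any finite Lipschitz constant suffices below. -/
theorem norm_retr_sub_le {M : ℝ} (hM : 0 < M) (a b : E) :
    ‖retr M a - retr M b‖ ≤ 2 * ‖a - b‖ := by
  have ha : 0 < max M ‖a‖ := hM.trans_le (le_max_left _ _)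
  have hb : 0 < max M ‖b‖ := hM.trans_le (le_max_left _ _)
  have e : retr M a - retr M b
      = (M / max M ‖a‖) • (a - b) + (M / max M ‖a‖ - M / max M ‖b‖) • b := by
    rw [retr, retr, smul_sub, sub_smul]; abel
  have h1 : ‖(M / max M ‖a‖) • (a - b)‖ ≤ ‖a - b‖ := by
    rw [norm_smul, Real.norm_of_nonneg (by positivity)]
    exact mul_le_of_le_one_left (norm_nonneg _) ((div_le_one ha).2 (le_max_left _ _))
  have h2 : ‖(M / max M ‖a‖ - M / max M ‖b‖) • b‖ ≤ ‖a - b‖ := by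
    have h3 : |max M ‖b‖ - max M ‖a‖| ≤ ‖a - b‖ := by
      refine (abs_max_sub_max_le_max _ _ _ _).trans ?_
      rw [sub_self, abs_zero, max_eq_right (abs_nonneg _), abs_sub_comm]
      exact abs_norm_sub_norm_le a b
    rw [norm_smul, Real.norm_eq_abs, div_sub_div _ _ ha.ne' hb.ne', ← mul_comm M (max M ‖a‖) ,
      ← mul_sub, abs_div, abs_mul, abs_of_pos hM, abs_of_pos (mul_pos ha hb)]
    rw [div_mul_eq_mul_div, div_le_iff₀ (mul_pos ha hb)]
    calc M * |max M ‖b‖ - max M ‖a‖| * ‖b‖ ≤ max M ‖a‖ * ‖a - b‖ * max M ‖b‖ := by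
          gcongr
          · exact le_max_left _ _
          · exact le_max_right _ _
      _ = _ := by ring
  rw [e]
  exact (norm_add_le _ _).trans (by linarith)

variable [CompleteSpace E]

/-- A bounded, globally Lipschitz field satisfies the Picard–Lindelöf conditions on [0, T] for every
T, with a ball of radius L T. Uniqueness glues the solutions over integer T, the one with index ⌈t⌉
being read at time t. -/
theorem exists_solution_of_lipschitz_bounded {v : E → E} {K L : NNReal} (hv : LipschitzWith K v)
    (hL : ∀ x, ‖v x‖ ≤ L) (x₀ : E) :
    ∃ x : ℝ → E, x 0 = x₀ ∧ ContinuousOn x (Ici 0) ∧ ∀ t, 0 < t → HasDerivAt x (v (x t)) t := by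
  have h1 : ∀ T : ℕ, ∃ x : ℝ → E, x 0 = x₀ ∧
      ∀ t ∈ Icc (0 : ℝ) T, HasDerivWithinAt x (v (x t)) (Icc (0 : ℝ) T) t := by
    intro T
    have hT : (0 : ℝ) ∈ Icc (0 : ℝ) T := ⟨le_rfl, T.cast_nonneg⟩
    have := IsPicardLindelof.of_time_independent (f := v) (t₀ := ⟨0, hT⟩) (x₀ := x₀)
      (a := L * T) (r := 0) (L := L) (K := K) (fun x _ => hL x) hv.lipschitzOnWith
      (by simp)
    exact this.exists_eq_forall_mem_Icc_hasDerivWithinAt₀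
  choose X hX0 hX using h1
  have hcont : ∀ T : ℕ, ContinuousOn (X T) (Icc 0 T) := fun T t ht => (hX T t ht).continuousWithinAt
  have hright : ∀ T : ℕ, ∀ t ∈ Ico (0 : ℝ) T, HasDerivWithinAt (X T) (v (X T t)) (Ici t) t := by
    intro T t ht
    refine ((hX T t ⟨ht.1, ht.2.le⟩).mono (Icc_subset_Icc_left ht.1 : Icc t (T : ℝ) ⊆ _)).mono_of_mem_nhdsWithin
      (Icc_mem_nhdsGE ht.2)
  have huniq : ∀ S T : ℕ, S ≤ T → EqOn (X S) (X T) (Icc 0 S) := by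
    intro S T hST
    have hST' : (S : ℝ) ≤ T := by exact_mod_cast hST
    exact ODE_solution_unique (v := fun _ => v) (fun _ => hv) (hcont S) (hright S)
      ((hcont T).mono (Icc_subset_Icc_right hST'))
      (fun t ht => hright T t ⟨ht.1, ht.2.trans_le hST'⟩) ((hX0 S).trans (hX0 T).symm)
  have hx : ∀ T : ℕ, ∀ t ∈ Icc (0 : ℝ) T, X ⌈t⌉₊ t = X T t := fun T t ht =>
    huniq _ _ (Nat.ceil_le.2 ht.2) ⟨ht.1, Nat.le_ceil t⟩
  refine ⟨fun t => X ⌈t⌉₊ t, by simpa using hX0 _, ?_, ?_⟩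
  · intro t ht
    obtain ⟨T, hT⟩ := exists_nat_gt t
    have h2 : ContinuousWithinAt (X T) (Ici 0) t :=
      (hcont T t ⟨ht, hT.le⟩).mono_of_mem_nhdsWithin (by
        filter_upwards [inter_mem_nhdsWithin (Ici (0 : ℝ)) (Iio_mem_nhds hT)] with s hs
          using ⟨hs.1, (mem_Iio.1 hs.2).le⟩)
    refine h2.congr_of_eventuallyEq ?_ (hx T t ⟨ht, hT.le⟩)
    filter_upwards [inter_mem_nhdsWithin (Ici (0 : ℝ)) (Iio_mem_nhds hT)] with s hs
      using hx T s ⟨hs.1, (mem_Iio.1 hs.2).le⟩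
  · intro t ht
    obtain ⟨T, hT⟩ := exists_nat_gt t
    have h2 := (hX T t ⟨ht.le, hT.le⟩).hasDerivAt (Icc_mem_nhds ht hT)
    simp only [hx T t ⟨ht.le, hT.le⟩]
    refine h2.congr_of_eventuallyEq ?_
    filter_upwards [Icc_mem_nhds ht hT] with s hs using hx T s hs

/-- Global existence for dissipative, locally Lipschitz vector fields on a Hilbert space. -/
theorem exists_solution_of_dissipative {G : E → E}
    (hG : ∀ M : ℝ, ∃ K : NNReal, LipschitzOnWith K G (Metric.closedBall 0 M))
    (hd : ∀ x, inner ℝ x (G x) ≤ 0) (x₀ : E) :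
    ∃ x : ℝ → E, x 0 = x₀ ∧ ContinuousOn x (Ici 0) ∧ ∀ t, 0 < t → HasDerivAt x (G (x t)) t := by
  -- Precomposing the field with the retraction makes it bounded and globally Lipschitz. The
  -- solution never leaves the ball of radius M, where the field is unchanged; the added 1 keeps M
  -- positive.
  set M := ‖x₀‖ + 1 with hMdef
  have hM : 0 < M := by positivity
  obtain ⟨K, hK⟩ := hG M
  have hmem : ∀ a : E, retr M a ∈ Metric.closedBall (0 : E) M := fun a => by
    rw [mem_closedBall_zero_iff]; exact norm_retr_le hM a
  have hret : LipschitzWith 2 (retr M : E → E) := LipschitzWith.of_dist_le_mul fun a b => by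
    rw [dist_eq_norm, dist_eq_norm]; exact norm_retr_sub_le hM a b
  have hv : LipschitzWith (K * 2) (fun a => G (retr M a)) := by
    rw [← lipschitzOnWith_univ]
    exact hK.comp hret.lipschitzOnWith fun a _ => hmem a
  have hb : ∀ a, ‖G (retr M a)‖ ≤ (‖G 0‖₊ + K * ⟨M, hM.le⟩ : NNReal) := fun a => by
    have h1 := hK.dist_le_mul _ (hmem a) 0 (by simpa using hM.le)
    rw [dist_eq_norm, dist_zero_right] at h1
    have h2 : ‖G (retr M a)‖ ≤ ‖G (retr M a) - G 0‖ + ‖G 0‖ := by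
      simpa using norm_add_le (G (retr M a) - G 0) (G 0)
    have h3 := mul_le_mul_of_nonneg_left (norm_retr_le hM a) K.coe_nonneg
    push_cast
    change _ ≤ ‖G 0‖ + K * M
    linarith
  obtain ⟨x, hx0, hxc, hxd⟩ := exists_solution_of_lipschitz_bounded hv hb x₀
  have hle : ∀ t, 0 ≤ t → ‖x t‖ ≤ M := by
    intro t ht
    have h := le_initial_of_deriv_nonpos (e := fun t => ‖x t‖ ^ 2) (hxc.norm.pow 2)
      (fun t ht => (hxd t ht).norm_sq) (fun t ht => by
        -- The retracted point is a positive multiple of x t, so dissipativity there has the same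
        -- sign when tested against x t.
        have h1 : 0 < M / max M ‖x t‖ := div_pos hM (hM.trans_le (le_max_left _ _))
        have h2 := hd (retr M (x t))
        rw [retr, real_inner_smul_left] at h2
        have h3 := nonpos_of_mul_nonpos_right h2 h1
        change 2 * inner ℝ (x t) (G ((M / max M ‖x t‖) • x t)) ≤ 0
        linarith) le_rfl ht
    have h4 : ‖x t‖ ^ 2 ≤ ‖x₀‖ ^ 2 := by simpa [hx0] using h
    have := (pow_le_pow_iff_left₀ (norm_nonneg _) (norm_nonneg _) two_ne_zero).1 h4
    linarith
  refine ⟨x, hx0, hxc, fun t ht => ?_⟩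
  have := hxd t ht
  rwa [retr_of_norm_le hM (hle t ht.le)] at this

end GlobalODE

/-! ### The frequency-truncated equation -/

theorem norm_J3_proj_le (R : ℝ) : ∃ A : ℝ, 0 ≤ A ∧ ∀ f : L2, ‖J3 (proj R f)‖ ≤ A * ‖f‖ := by
  refine ⟨Real.sqrt (1 + (2 * Real.pi * R) ^ 2) ^ 3, by positivity, fun f => ?_⟩
  rw [← norm_fhat, ← norm_fhat f]
  refine Lp.norm_le_mul_norm_of_ae_le_mul ?_
  filter_upwards [fh_ae (J3 (proj R f)), fh_J3 (BL.proj R f).h3, fh_proj R f, fh_ae f] with ξ h1 h2 h3 h4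
  rw [← h1, ← h4, h2, h3, norm_mul, norm_mul, Complex.norm_real, Complex.norm_real,
    Real.norm_of_nonneg (by have := jp_pos ξ; positivity), Real.norm_of_nonneg (ind_nonneg R ξ)]
  rcases le_or_gt ‖ξ‖ R with h | h
  · rw [ind_of_le h, one_mul]
    gcongr
    · exact (jp_pos ξ).le
    · exact jp_le_of_norm_le h
  · rw [ind_of_lt h, zero_mul, mul_zero]; positivity

/-- The frequency-truncated SQG vector field. -/
def galerkin (μ α : ℝ) (h0 : 0 ≤ α) (R : ℝ) (f : L2) : L2 :=
  -proj R (adv (proj R f) (proj R f)) - μ • lapR α h0 R f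

/-- Self-adjointness moves the outer projection onto f, after which the transport term is skew. -/
theorem inner_galerkin_nonpos {μ α : ℝ} (hμ : 0 < μ) (h0 : 0 ≤ α) (R : ℝ) (f : L2) :
    inner ℝ f (galerkin μ α h0 R f) ≤ 0 := by
  rw [galerkin, inner_sub_right, inner_neg_right, ← inner_proj_left, real_inner_comm,
    inner_adv_self (BL.proj R f).h3 (BL.proj R f).h3, real_inner_smul_right]
  have := mul_nonneg hμ.le (inner_lapR_nonneg α h0 R f)
  linarith

/-- On frequencies below R all derivatives are bounded on L², so the field is quadratic plus linear;
the constant may depend on R. -/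
theorem lipschitzOnWith_galerkin (μ α : ℝ) (h0 : 0 ≤ α) (R M : ℝ) :
    ∃ K : NNReal, LipschitzOnWith K (galerkin μ α h0 R) (Metric.closedBall 0 M) := by
  obtain ⟨A, hA0, hA⟩ := norm_J3_proj_le R
  refine ⟨(wC * A * M + wC * A * M + |μ| * ‖lapR α h0 R‖).toNNReal, LipschitzOnWith.of_dist_le_mul ?_⟩
  intro a ha b hb
  rw [mem_closedBall_zero_iff] at ha hb
  have hw := wC_nonneg
  have hM : 0 ≤ M := (norm_nonneg a).trans ha
  rw [dist_eq_norm, dist_eq_norm, Real.coe_toNNReal _ (by positivity)]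
  have h3 : ∀ f, H3 (proj R f) := fun f => (BL.proj R f).h3
  have e : galerkin μ α h0 R a - galerkin μ α h0 R b
      = -(proj R (adv (proj R (a - b)) (proj R a))) - proj R (adv (proj R b) (proj R (a - b)))
        - μ • lapR α h0 R (a - b) := by
    rw [map_sub (proj R) a b, adv_sub_left (h3 a) (h3 b) (h3 a), adv_sub_right (h3 b) (h3 a) (h3 b),
      map_sub, map_sub, map_sub, smul_sub, galerkin, galerkin]
    abel
  have h4 : ‖proj R (adv (proj R (a - b)) (proj R a))‖ ≤ wC * A * M * ‖a - b‖ := by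
    refine (norm_proj_le _ _).trans ((norm_adv_le' (h3 _) (h3 _)).trans ?_)
    calc wC * ‖J3 (proj R a)‖ * ‖proj R (a - b)‖ ≤ wC * (A * M) * ‖a - b‖ := by
          gcongr
          · exact (hA a).trans (by gcongr)
          · exact norm_proj_le _ _
      _ = _ := by ring
  have h5 : ‖proj R (adv (proj R b) (proj R (a - b)))‖ ≤ wC * A * M * ‖a - b‖ := by
    refine (norm_proj_le _ _).trans ((norm_adv_le' (h3 _) (h3 _)).trans ?_)
    calc wC * ‖J3 (proj R (a - b))‖ * ‖proj R b‖ ≤ wC * (A * ‖a - b‖) * M := by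
          gcongr
          · exact hA _
          · exact (norm_proj_le _ _).trans hb
      _ = _ := by ring
  have h6 : ‖μ • lapR α h0 R (a - b)‖ ≤ |μ| * ‖lapR α h0 R‖ * ‖a - b‖ := by
    rw [norm_smul, Real.norm_eq_abs, mul_assoc]
    gcongr
    exact (lapR α h0 R).le_opNorm _
  rw [e]
  refine (norm_sub_le _ _).trans ?_
  have h7 := norm_sub_le (-(proj R (adv (proj R (a - b)) (proj R a))))
    (proj R (adv (proj R b) (proj R (a - b))))
  rw [norm_neg] at h7
  linarith

/-- The frequency-truncated SQG equation is globally solvable. -/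
theorem exists_galerkin {μ α : ℝ} (hμ : 0 < μ) (h0 : 0 ≤ α) (R : ℝ) {x₀ : L2} (hx : BL R x₀) :
    ∃ x : ℝ → L2, x 0 = x₀ ∧ ContinuousOn x (Ici 0) ∧ (∀ t, 0 ≤ t → BL R (x t)) ∧
      ∀ t, 0 < t → HasDerivAt x (-proj R (adv (x t) (x t)) - μ • fracLap α (x t)) t := by
  obtain ⟨x, hx0, hxc, hxd⟩ := exists_solution_of_dissipative (lipschitzOnWith_galerkin μ α h0 R)
    (inner_galerkin_nonpos hμ h0 R) x₀
  -- The component outside the ball has zero derivative and starts from zero.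
  have hproj : ∀ t, 0 ≤ t → x t - proj R (x t) = 0 := by
    intro t ht
    refine eq_zero_of_inner_deriv_nonpos (w := fun t => x t - proj R (x t)) (w' := fun _ => 0)
      (hxc.sub ((proj R).continuous.comp_continuousOn hxc)) (fun t ht => ?_) (by simp)
      (by rw [hx0, hx.proj_eq, sub_self]) ht
    have h1 := (proj R).hasFDerivAt.comp_hasDerivAt t (hxd t ht)
    refine ((hxd t ht).sub h1).congr_deriv ?_
    have h2 : BL R (galerkin μ α h0 R (x t)) := by
      have h3 : BL R (lapR α h0 R (x t)) := by
        filter_upwards [fh_lapR α h0 R (x t)] with ξ e h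
        rw [e, ind_of_lt h]; simp
      have h4 := ((BL.proj R (adv (proj R (x t)) (proj R (x t)))).smul (-1)).sub (h3.smul μ)
      rwa [neg_one_smul] at h4
    rw [h2.proj_eq, sub_self]
  have hBL : ∀ t, 0 ≤ t → BL R (x t) := fun t ht => by
    rw [sub_eq_zero.1 (hproj t ht)]; exact BL.proj R _
  refine ⟨x, hx0, hxc, hBL, fun t ht => ?_⟩
  have := hxd t ht
  rwa [galerkin, (hBL t ht.le).proj_eq, ← fracLap_eq_lapR h0 (hBL t ht.le)] at this

/-! ### Continuity in time of the norms, and the smallness condition in real form -/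

theorem bdd_jp3_ind (R : ℝ) : ∃ C, ∀ ξ, |jp ξ ^ 3 * ind R ξ| ≤ C :=
  ⟨_, bdd_mul_ind (C := Real.sqrt (1 + (2 * Real.pi * R) ^ 2) ^ 3) fun ξ h => by
    rw [abs_of_nonneg (pow_nonneg (jp_pos ξ).le 3)]
    exact pow_le_pow_left₀ (jp_pos ξ).le (jp_le_of_norm_le h) 3⟩

/-- The operator `J3` truncated to frequencies of size at most `R`. -/
def J3R (R : ℝ) : L2 →L[ℝ] L2 :=
  bmul (fun ξ => jp ξ ^ 3 * ind R ξ) ((rSym_jp.pow 3).mul (rSym_ind R)) (bdd_jp3_ind R)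

theorem fh_J3R (R : ℝ) (f : L2) :
    fh (J3R R f) =ᵐ[volume] fun ξ => ((jp ξ ^ 3 * ind R ξ : ℝ) : ℂ) * fh f ξ :=
  fh_bmul _ _ _ f

theorem BL.J3_eq {R : ℝ} {f : L2} (hf : BL R f) : J3 f = J3R R f := by
  refine ext_fh ?_
  filter_upwards [fh_J3 hf.h3, fh_J3R R f, hf] with ξ h1 h2 h3
  rw [h1, h2]
  rcases le_or_gt ‖ξ‖ R with h | h
  · rw [ind_of_le h, mul_one]
  · rw [h3 h, mul_zero, mul_zero]

theorem continuousOn_J3 {R : ℝ} {Θ : ℝ → L2} {S : Set ℝ} (hc : ContinuousOn Θ S)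
    (hb : ∀ t ∈ S, BL R (Θ t)) : ContinuousOn (fun t => J3 (Θ t)) S :=
  ((J3R R).continuous.comp_continuousOn hc).congr fun t ht => (hb t ht).J3_eq

theorem norm_adv_sub_le {f g : L2} (hf : H3 f) (hg : H3 g) :
    ‖adv f f - adv g g‖ ≤ wC * ‖J3 f‖ * ‖f - g‖ + wC * ‖J3 (f - g)‖ * ‖g‖ := by
  have e : adv f f - adv g g = adv (f - g) f + adv g (f - g) := by
    rw [adv_sub_left hf hg hf, adv_sub_right hg hf hg]; abel
  rw [e]
  exact (norm_add_le _ _).trans (add_le_add (norm_adv_le' (hf.sub hg) hf) (norm_adv_le' hg (hf.sub hg)))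

theorem continuousOn_adv {Θ : ℝ → L2} {S : Set ℝ} (h3 : ∀ t ∈ S, H3 (Θ t)) (hc : ContinuousOn Θ S)
    (hJ : ContinuousOn (fun t => J3 (Θ t)) S) : ContinuousOn (fun t => adv (Θ t) (Θ t)) S := by
  intro t ht
  rw [ContinuousWithinAt, tendsto_iff_norm_sub_tendsto_zero]
  have h1 : Tendsto (fun s => ‖Θ s - Θ t‖) (𝓝[S] t) (𝓝 0) :=
    tendsto_iff_norm_sub_tendsto_zero.1 (hc t ht)
  have h2 : Tendsto (fun s => ‖J3 (Θ s) - J3 (Θ t)‖) (𝓝[S] t) (𝓝 0) :=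
    tendsto_iff_norm_sub_tendsto_zero.1 (hJ t ht)
  have h4 : Tendsto (fun s => wC * ‖J3 (Θ s)‖ * ‖Θ s - Θ t‖
      + wC * ‖J3 (Θ s) - J3 (Θ t)‖ * ‖Θ t‖) (𝓝[S] t) (𝓝 0) := by
    have h5 : Tendsto (fun s => ‖J3 (Θ s)‖) (𝓝[S] t) (𝓝 ‖J3 (Θ t)‖) := (hJ t ht).norm
    have := ((h5.const_mul wC).mul h1).add ((h2.const_mul wC).mul_const ‖Θ t‖)
    simpa using this
  refine squeeze_zero' (Eventually.of_forall fun s => norm_nonneg _) ?_ h4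
  filter_upwards [self_mem_nhdsWithin] with s hs
  rw [← J3_sub (h3 s hs) (h3 t ht)]
  exact norm_adv_sub_le (h3 s hs) (h3 t ht)

/-- The supremum norm of the velocity. -/
def velSup (f : L2) : ℝ := (eLpNorm (velocity f) ⊤ volume).toReal

/-- The supremum norm. -/
def absSup (f : L2) : ℝ := (eLpNorm f ⊤ volume).toReal

theorem integral_norm_fh_le {f : L2} (hf : H3 f) : ∫ ξ, ‖fh f ξ‖ ≤ wC * ‖J3 f‖ := by
  have h := lintegral_fh_le hf
  rw [integral_norm_eq_lintegral_enorm (measurable_fh f).aestronglyMeasurable]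
  refine ENNReal.toReal_le_of_le_ofReal (mul_nonneg wC_nonneg (norm_nonneg _)) ?_
  rwa [ENNReal.ofReal_mul wC_nonneg, ofReal_norm]

theorem abs_le_J3 {f : L2} (hf : H3 f) : ∀ᵐ x : Plane, |f x| ≤ wC * ‖J3 f‖ := by
  filter_upwards [abs_le_integral_fh f hf.integrable_fh] with x hx
    using hx.trans (integral_norm_fh_le hf)

theorem abs_riesz_le_J3 {f : L2} (hf : H3 f) (j : Fin 2) :
    ∀ᵐ x : Plane, |riesz j f x| ≤ wC * ‖J3 f‖ := by
  filter_upwards [abs_le_integral_fh (riesz j f) (hf.integrable_fh_riesz j)] with x hx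
  refine hx.trans (le_trans (integral_mono_ae (hf.integrable_fh_riesz j).norm hf.integrable_fh.norm ?_)
    (integral_norm_fh_le hf))
  filter_upwards [fh_riesz j f] with ξ e
  rw [e, norm_mul]
  exact mul_le_of_le_one_left (norm_nonneg _) (norm_riesz_symbol_le j ξ)

theorem norm_velocity_le_J3 {f : L2} (hf : H3 f) :
    ∀ᵐ x : Plane, ‖velocity f x‖ ≤ 2 * (wC * ‖J3 f‖) := by
  filter_upwards [abs_riesz_le_J3 hf 0, abs_riesz_le_J3 hf 1] with x h0 h1
  exact norm_velocity_le (fun j => by fin_cases j; exacts [h0, h1])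

theorem eLpNorm_top_le_of_ae {E : Type*} [NormedAddCommGroup E] {u : Plane → E} {c : ℝ}
    (h : ∀ᵐ x, ‖u x‖ ≤ c) : eLpNorm u ⊤ volume ≤ ENNReal.ofReal c := by
  rw [eLpNorm_exponent_top]
  exact eLpNormEssSup_le_of_ae_bound h

theorem ae_norm_le_toReal {E : Type*} [NormedAddCommGroup E] {u : Plane → E}
    (h : eLpNorm u ⊤ volume ≠ ⊤) : ∀ᵐ x, ‖u x‖ ≤ (eLpNorm u ⊤ volume).toReal := by
  rw [eLpNorm_exponent_top] at h ⊢
  filter_upwards [enorm_ae_le_eLpNormEssSup u volume] with x hx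
  rw [← toReal_enorm]
  exact ENNReal.toReal_mono h hx

theorem toReal_eLpNorm_top_le {E : Type*} [NormedAddCommGroup E] {u : Plane → E} {c : ℝ}
    (hc : 0 ≤ c) (h : ∀ᵐ x, ‖u x‖ ≤ c) : (eLpNorm u ⊤ volume).toReal ≤ c :=
  ENNReal.toReal_le_of_le_ofReal hc (eLpNorm_top_le_of_ae h)

theorem eLpNorm_velocity_ne_top {f : L2} (hf : H3 f) : eLpNorm (velocity f) ⊤ volume ≠ ⊤ :=
  ((eLpNorm_top_le_of_ae (norm_velocity_le_J3 hf)).trans_lt ENNReal.ofReal_lt_top).ne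

theorem eLpNorm_abs_ne_top {f : L2} (hf : H3 f) : eLpNorm f ⊤ volume ≠ ⊤ :=
  ((eLpNorm_top_le_of_ae (u := f) (abs_le_J3 hf)).trans_lt ENNReal.ofReal_lt_top).ne

theorem norm_velocity_le_velSup {f : L2} (hf : H3 f) : ∀ᵐ x : Plane, ‖velocity f x‖ ≤ velSup f :=
  ae_norm_le_toReal (eLpNorm_velocity_ne_top hf)

theorem abs_le_absSup {f : L2} (hf : H3 f) : ∀ᵐ x : Plane, |f x| ≤ absSup f :=
  ae_norm_le_toReal (eLpNorm_abs_ne_top hf)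

theorem velSup_nonneg (f : L2) : 0 ≤ velSup f := ENNReal.toReal_nonneg

theorem absSup_nonneg (f : L2) : 0 ≤ absSup f := ENNReal.toReal_nonneg

theorem riesz_add (j : Fin 2) (f g : L2) : riesz j (f + g) = riesz j f + riesz j g :=
  (hSym_riesz j).fourierMul_add (inDomain_riesz j f) (inDomain_riesz j g)

theorem velocity_add_ae (f g : L2) :
    ∀ᵐ x : Plane, velocity (f + g) x = velocity f x + velocity g x := by
  have h := fun j => riesz_add j f g
  filter_upwards [Lp.coeFn_add (riesz 0 f) (riesz 0 g), Lp.coeFn_add (riesz 1 f) (riesz 1 g)] with x h0 h1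
  rw [← h, Pi.add_apply] at h0 h1
  ext i
  fin_cases i
  · simp [velocity, h1]
  · simp [velocity, h0]; ring

theorem velSup_le_add {f g : L2} (hf : H3 f) (hg : H3 g) :
    velSup f ≤ velSup g + 2 * (wC * ‖J3 (f - g)‖) := by
  have hw := wC_nonneg
  refine toReal_eLpNorm_top_le (add_nonneg (velSup_nonneg g) (by positivity)) ?_
  filter_upwards [velocity_add_ae g (f - g), norm_velocity_le_velSup hg,
    norm_velocity_le_J3 (hf.sub hg)] with x h1 h2 h3
  rw [add_sub_cancel] at h1
  rw [h1]
  exact (norm_add_le _ _).trans (add_le_add h2 h3)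

theorem absSup_le_add {f g : L2} (hf : H3 f) (hg : H3 g) :
    absSup f ≤ absSup g + 2 * (wC * ‖J3 (f - g)‖) := by
  have hw := wC_nonneg
  have h0 : 0 ≤ wC * ‖J3 (f - g)‖ := by positivity
  refine toReal_eLpNorm_top_le (u := f) (add_nonneg (absSup_nonneg g) (by positivity)) ?_
  filter_upwards [Lp.coeFn_sub f g, abs_le_absSup hg, abs_le_J3 (hf.sub hg)] with x h1 h2 h3
  rw [h1, Pi.sub_apply] at h3
  rw [Real.norm_eq_abs]
  have : f x = g x + (f x - g x) := by ring
  rw [this]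
  exact (abs_add_le _ _).trans (by linarith)

/-- The one-sided inequality, applied to both orderings of a pair, makes φ Lipschitz for the H³
distance. -/
theorem continuousOn_of_le_add {φ : L2 → ℝ}
    (hφ : ∀ f g, H3 f → H3 g → φ f ≤ φ g + 2 * (wC * ‖J3 (f - g)‖)) {Θ : ℝ → L2} {S : Set ℝ}
    (h3 : ∀ t ∈ S, H3 (Θ t)) (hJ : ContinuousOn (fun t => J3 (Θ t)) S) :
    ContinuousOn (fun t => φ (Θ t)) S := by
  intro t ht
  rw [ContinuousWithinAt, tendsto_iff_norm_sub_tendsto_zero]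
  have h2 : Tendsto (fun s => ‖J3 (Θ s) - J3 (Θ t)‖) (𝓝[S] t) (𝓝 0) :=
    tendsto_iff_norm_sub_tendsto_zero.1 (hJ t ht)
  have h4 : Tendsto (fun s => 2 * (wC * ‖J3 (Θ s) - J3 (Θ t)‖)) (𝓝[S] t) (𝓝 0) := by
    simpa using (h2.const_mul wC).const_mul 2
  refine squeeze_zero' (Eventually.of_forall fun s => norm_nonneg _) ?_ h4
  filter_upwards [self_mem_nhdsWithin] with s hs
  have e1 := hφ _ _ (h3 s hs) (h3 t ht)
  have e2 := hφ _ _ (h3 t ht) (h3 s hs)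
  rw [J3_sub (h3 s hs) (h3 t ht)] at e1
  rw [J3_sub (h3 t ht) (h3 s hs), norm_sub_rev] at e2
  rw [Real.norm_eq_abs, abs_le]
  constructor <;> linarith

/-- The size of the velocity and of the function itself in the supremum norm. -/
def supSize (f : L2) : ℝ := velSup f + absSup f

/-- The `H³` norm of the nonlinear term. -/
def advSize (f : L2) : ℝ := ‖J3 (adv f f)‖

theorem supSize_nonneg (f : L2) : 0 ≤ supSize f := add_nonneg (velSup_nonneg f) (absSup_nonneg f)

theorem continuousOn_supSize {R : ℝ} {Θ : ℝ → L2} {S : Set ℝ} (hc : ContinuousOn Θ S)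
    (hb : ∀ t ∈ S, BL R (Θ t)) : ContinuousOn (fun t => supSize (Θ t)) S :=
  (continuousOn_of_le_add (fun _ _ => velSup_le_add) (fun t ht => (hb t ht).h3)
    (continuousOn_J3 hc hb)).add
  (continuousOn_of_le_add (fun _ _ => absSup_le_add) (fun t ht => (hb t ht).h3)
    (continuousOn_J3 hc hb))

theorem continuousOn_advSize {R : ℝ} {Θ : ℝ → L2} {S : Set ℝ} (hc : ContinuousOn Θ S)
    (hb : ∀ t ∈ S, BL R (Θ t)) : ContinuousOn (fun t => advSize (Θ t)) S :=
  (continuousOn_J3 (continuousOn_adv (fun t ht => (hb t ht).h3) hc (continuousOn_J3 hc hb))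
    fun t ht => (hb t ht).adv (hb t ht)).norm

theorem supSize_eq {f : L2} (hf : H3 f) :
    eLpNorm (velocity f) ⊤ volume + eLpNorm f ⊤ volume = ENNReal.ofReal (supSize f) := by
  rw [supSize, ENNReal.ofReal_add (velSup_nonneg f) (absSup_nonneg f), velSup, absSup,
    ENNReal.ofReal_toReal (eLpNorm_velocity_ne_top hf), ENNReal.ofReal_toReal (eLpNorm_abs_ne_top hf)]

theorem hNorm_congr {s : ℝ} {u v : Plane → ℝ} (h : u =ᵐ[volume] v) : hNorm s u = hNorm s v := by
  unfold hNorm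
  by_cases hu : MemLp u 2 (volume : Measure Plane)
  · have hv := (memLp_congr_ae h).1 hu
    rw [dif_pos hu, dif_pos hv, (MemLp.toLp_eq_toLp_iff hu hv).2 h]
  · have hv : ¬ MemLp v 2 (volume : Measure Plane) := fun hv => hu ((memLp_congr_ae h).2 hv)
    rw [dif_neg hu, dif_neg hv]

theorem BL.hNorm_advection {R : ℝ} {f : L2} (hf : BL R f) :
    hNorm 3 (advection f) = ENNReal.ofReal (advSize f) := by
  rw [hNorm_congr (advection_ae hf.h3), hNorm_eq_enorm_J3 (hf.adv hf).h3, advSize, ofReal_norm]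

theorem lintegral_Ioc_eq {φ : ℝ → ℝ} (hφ : ContinuousOn φ (Ici 0)) (h0 : ∀ t, 0 ≤ φ t) {T : ℝ}
    (hT : 0 ≤ T) :
    ∫⁻ t in Ioc 0 T, ENNReal.ofReal (φ t) = ENNReal.ofReal (∫ t in (0 : ℝ)..T, φ t) := by
  rw [intervalIntegral.integral_of_le hT, ofReal_integral_eq_lintegral_ofReal]
  · exact ((hφ.mono Icc_subset_Ici_self).integrableOn_Icc).mono_set Ioc_subset_Icc_self
  · exact Eventually.of_forall h0

/-- The smallness condition, on a finite time interval, as an inequality between real numbers. -/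
theorem SmallnessCondition.real {R C ε : ℝ} {g₀ : L2} {Θ : ℝ → L2} (hC : 0 ≤ C) (hε : 0 < ε)
    (hc : ContinuousOn Θ (Ici 0)) (hb : ∀ t ∈ Ici (0 : ℝ), BL R (Θ t))
    (h : SmallnessCondition C ε g₀ Θ) :
    H3 g₀ ∧ ∀ T, 0 ≤ T → (‖J3 g₀‖ ^ 2 + ∫ t in (0 : ℝ)..T, advSize (Θ t)) *
      Real.exp (C * ((∫ t in (0 : ℝ)..T, supSize (Θ t)) + ∫ t in (0 : ℝ)..T, advSize (Θ t))) ≤ ε := by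
  unfold SmallnessCondition at h
  -- The exponential is at least 1, so the first factor alone is finite; this is how g₀ is seen to
  -- lie in H³.
  have hfin : (hNorm 3 g₀ ^ 2 + forcingIntegral Θ) ≤ ENNReal.ofReal ε := by
    refine le_trans (le_mul_of_one_le_right' ?_) h
    rw [← EReal.exp_zero]
    exact EReal.exp_monotone (EReal.coe_ennreal_nonneg _)
  have h3 : H3 g₀ := by
    rw [← hNorm_lt_top_iff]
    have : hNorm 3 g₀ ^ 2 < ⊤ := (le_self_add.trans hfin).trans_lt ENNReal.ofReal_lt_top
    simpa [ENNReal.pow_lt_top_iff] using this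
  refine ⟨h3, fun T hT => ?_⟩
  have hadv0 : ∀ t, 0 ≤ advSize (Θ t) := fun t => norm_nonneg _
  have hA : ENNReal.ofReal (∫ t in (0 : ℝ)..T, advSize (Θ t)) ≤ forcingIntegral Θ := by
    rw [← lintegral_Ioc_eq (continuousOn_advSize hc hb) hadv0 hT, forcingIntegral]
    refine le_trans (le_of_eq ?_) (lintegral_mono_set (Ioc_subset_Ioi_self : Ioc 0 T ⊆ Ioi 0))
    refine setLIntegral_congr_fun measurableSet_Ioc fun t ht => ?_
    exact ((hb t ht.1.le).hNorm_advection).symm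
  have hS : ENNReal.ofReal (∫ t in (0 : ℝ)..T, supSize (Θ t)) ≤ supIntegral Θ := by
    rw [← lintegral_Ioc_eq (continuousOn_supSize hc hb) (fun t => supSize_nonneg _) hT, supIntegral]
    refine le_trans (le_of_eq ?_) (lintegral_mono_set (Ioc_subset_Ioi_self : Ioc 0 T ⊆ Ioi 0))
    refine setLIntegral_congr_fun measurableSet_Ioc fun t ht => ?_
    exact (supSize_eq (hb t ht.1.le).h3).symm
  have hA0 : 0 ≤ ∫ t in (0 : ℝ)..T, advSize (Θ t) :=
    intervalIntegral.integral_nonneg hT fun t _ => hadv0 t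
  have hS0 : 0 ≤ ∫ t in (0 : ℝ)..T, supSize (Θ t) :=
    intervalIntegral.integral_nonneg hT fun t _ => supSize_nonneg _
  set A := ∫ t in (0 : ℝ)..T, advSize (Θ t)
  set S := ∫ t in (0 : ℝ)..T, supSize (Θ t)
  rw [← ENNReal.ofReal_le_ofReal_iff hε.le]
  refine le_trans ?_ h
  rw [ENNReal.ofReal_mul (by positivity), ENNReal.ofReal_add (by positivity) hA0,
    ENNReal.ofReal_pow (norm_nonneg _), ofReal_norm, hNorm_eq_enorm_J3 h3]
  gcongr
  rw [← EReal.exp_coe]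
  refine EReal.exp_monotone ?_
  have e : ((C * (S + A) : ℝ) : EReal) = ((ENNReal.ofReal (C * (S + A)) : ℝ≥0∞) : EReal) := by
    rw [EReal.coe_ennreal_ofReal, max_eq_left (by positivity)]
  rw [e, EReal.coe_ennreal_le_coe_ennreal_iff, ENNReal.ofReal_mul hC, ENNReal.ofReal_add hS0 hA0]
  gcongr

/-- Since 3/2 < 2π, the spectrum lies in the unit ball in the normalization with 2π in the exponent.
-/
theorem AnnulusSupported.bl {f : L2} (h : AnnulusSupported f) : BL 1 f := by
  filter_upwards [h, fh_ae f] with ξ h1 h2 h3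
  by_contra h4
  rw [h2] at h4
  have := (h1 h4).2
  have hp := Real.pi_gt_three
  nlinarith

theorem BL.heat {R μ α t : ℝ} (hμ : 0 < μ) (ht : 0 ≤ t) {f : L2} (hf : BL R f) :
    BL R (heat μ α t f) := by
  filter_upwards [hf, fh_heat (α := α) hμ ht f] with ξ h1 h2 h3
  rw [h2, h1 h3, mul_zero]

theorem norm_J3_heat_le {R μ α t : ℝ} (hμ : 0 < μ) (ht : 0 ≤ t) {f : L2} (hf : BL R f) :
    ‖J3 (heat μ α t f)‖ ≤ ‖J3 f‖ := by
  refine norm_le_norm_of_fh_le ?_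
  filter_upwards [fh_J3 (hf.heat hμ ht).h3, fh_J3 hf.h3, fh_heat (α := α) hμ ht f] with ξ h1 h2 h3
  rw [h1, h2, h3, norm_mul, norm_mul, norm_mul]
  gcongr
  refine mul_le_of_le_one_left (norm_nonneg _) ?_
  rw [Complex.norm_real]
  exact heat_symbol_le hμ ht ξ

/-! ### The energy inequality and the uniform bound -/

/-- Gronwall's inequality with a dissipation term. -/
theorem gronwall_dissipation {e e' d a F : ℝ → ℝ} {T μ : ℝ} (hT : 0 ≤ T) (hμ : 0 ≤ μ)
    (he : ContinuousOn e (Icc 0 T)) (hd : Continuous d) (ha : Continuous a) (hF : Continuous F)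
    (hd0 : ∀ t, 0 ≤ d t) (ha0 : ∀ t, 0 ≤ a t) (hF0 : ∀ t, 0 ≤ F t)
    (hderiv : ∀ t ∈ Ioo 0 T, HasDerivAt e (e' t) t)
    (hle : ∀ t ∈ Ioo 0 T, e' t + μ * d t ≤ a t * e t + F t) :
    e T + μ * ∫ t in (0 : ℝ)..T, d t
      ≤ (e 0 + ∫ t in (0 : ℝ)..T, F t) * Real.exp (∫ t in (0 : ℝ)..T, a t) := by
  set A : ℝ → ℝ := fun t => ∫ s in (0 : ℝ)..t, a s with hA
  have hAd : ∀ t, HasDerivAt A (a t) t := fun t =>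
    ha.integral_hasStrictDerivAt 0 t |>.hasDerivAt
  have hAc : Continuous A := continuous_iff_continuousAt.2 fun t => (hAd t).continuousAt
  have hPd : ∀ t, HasDerivAt (fun t => ∫ s in (0 : ℝ)..t, F s) (F t) t := fun t =>
    hF.integral_hasStrictDerivAt 0 t |>.hasDerivAt
  have hm : Continuous fun t => Real.exp (-A t) * d t := (hAc.neg.rexp).mul hd
  have hQd : ∀ t, HasDerivAt (fun t => ∫ s in (0 : ℝ)..t, Real.exp (-A s) * d s)
      (Real.exp (-A t) * d t) t := fun t => hm.integral_hasStrictDerivAt 0 t |>.hasDerivAt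
  have hAnn : ∀ t, 0 ≤ t → 0 ≤ A t := fun t ht => intervalIntegral.integral_nonneg ht fun s _ => ha0 s
  -- The integrating factor exp(−A) is kept on the energy and on the dissipation; in front of F it
  -- is at most 1 and is dropped.
  have hanti : AntitoneOn (fun t => Real.exp (-A t) * e t
      + μ * (∫ s in (0 : ℝ)..t, Real.exp (-A s) * d s) - ∫ s in (0 : ℝ)..t, F s) (Icc 0 T) := by
    have hD : ∀ t ∈ Ioo 0 T, HasDerivAt (fun t => Real.exp (-A t) * e t
        + μ * (∫ s in (0 : ℝ)..t, Real.exp (-A s) * d s) - ∫ s in (0 : ℝ)..t, F s)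
        ((Real.exp (-A t) * (-a t)) * e t + Real.exp (-A t) * e' t
          + μ * (Real.exp (-A t) * d t) - F t) t := fun t ht =>
      ((((hAd t).neg.exp).mul (hderiv t ht)).add ((hQd t).const_mul μ)).sub (hPd t)
    refine antitoneOn_of_deriv_nonpos (convex_Icc 0 T) ?_ ?_ ?_
    · refine ContinuousOn.sub (ContinuousOn.add ((hAc.neg.rexp).continuousOn.mul he) ?_) ?_
      · exact (continuous_const.mul (continuous_iff_continuousAt.2
          fun t => (hQd t).continuousAt)).continuousOn
      · exact (continuous_iff_continuousAt.2 fun t => (hPd t).continuousAt).continuousOn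
    · intro t ht
      rw [interior_Icc] at ht
      exact (hD t ht).differentiableAt.differentiableWithinAt
    · intro t ht
      rw [interior_Icc] at ht
      rw [(hD t ht).deriv]
      have h1 : Real.exp (-A t) ≤ 1 := Real.exp_le_one_iff.2 (neg_nonpos.2 (hAnn t ht.1.le))
      have h2 := mul_le_mul_of_nonneg_left (hle t ht) (Real.exp_pos (-A t)).le
      have h3 := mul_le_mul_of_nonneg_right h1 (hF0 t)
      nlinarith
  have h1 := hanti (left_mem_Icc.2 hT) (right_mem_Icc.2 hT) hT
  have hA0 : A 0 = 0 := by simp [hA]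
  simp only [hA0, neg_zero, Real.exp_zero, one_mul, intervalIntegral.integral_same, mul_zero,
    add_zero, sub_zero] at h1
  -- A is nondecreasing, so the weight under the integral is smallest at T; multiplying by exp(A T)
  -- then frees energy and dissipation together.
  have h2 : Real.exp (-A T) * ∫ t in (0 : ℝ)..T, d t ≤ ∫ s in (0 : ℝ)..T, Real.exp (-A s) * d s := by
    rw [← intervalIntegral.integral_const_mul]
    refine intervalIntegral.integral_mono_on hT ((continuous_const.mul hd).intervalIntegrable _ _)
      (hm.intervalIntegrable _ _) fun t ht => ?_
    refine mul_le_mul_of_nonneg_right (Real.exp_le_exp.2 (neg_le_neg ?_)) (hd0 t)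
    have := intervalIntegral.integral_add_adjacent_intervals (ha.intervalIntegrable 0 t)
      (ha.intervalIntegrable (μ := volume) t T)
    have h3 : 0 ≤ ∫ s in t..T, a s := intervalIntegral.integral_nonneg ht.2 fun s _ => ha0 s
    change (∫ s in (0 : ℝ)..t, a s) ≤ ∫ s in (0 : ℝ)..T, a s
    linarith
  have h3 : Real.exp (-A T) * (e T + μ * ∫ t in (0 : ℝ)..T, d t)
      ≤ e 0 + ∫ t in (0 : ℝ)..T, F t := by
    have := mul_le_mul_of_nonneg_left h2 hμ
    linarith
  have h4 := mul_le_mul_of_nonneg_right h3 (Real.exp_pos (A T)).le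
  have h5 : Real.exp (-A T) * Real.exp (A T) = 1 := by rw [← Real.exp_add]; simp
  calc e T + μ * ∫ t in (0 : ℝ)..T, d t
      = Real.exp (-A T) * Real.exp (A T) * (e T + μ * ∫ t in (0 : ℝ)..T, d t) := by rw [h5, one_mul]
    _ = Real.exp (-A T) * (e T + μ * ∫ t in (0 : ℝ)..T, d t) * Real.exp (A T) := by ring
    _ ≤ _ := h4

theorem bdd_dw_ind {α : ℝ} (h0 : 0 ≤ α) (R : ℝ) : ∃ C, ∀ ξ, |dw α ξ * ind R ξ| ≤ C :=
  ⟨_, bdd_mul_ind (C := (2 * Real.pi * R) ^ α * Real.sqrt (1 + (2 * Real.pi * R) ^ 2) ^ 3)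
    fun ξ h => by
      rw [abs_of_nonneg (dw_nonneg α ξ), dw]
      have hR : 0 ≤ R := (norm_nonneg _).trans h
      gcongr
      · exact pow_nonneg (jp_pos ξ).le 3
      · exact (jp_pos ξ).le
      · exact jp_le_of_norm_le h⟩

/-- The truncation of the multiplier measuring dissipation. -/
def dwR (α : ℝ) (h0 : 0 ≤ α) (R : ℝ) : L2 →L[ℝ] L2 :=
  bmul (fun ξ => dw α ξ * ind R ξ) ((rSym_dw α).mul (rSym_ind R)) (bdd_dw_ind h0 R)

theorem fh_dwR (α : ℝ) (h0 : 0 ≤ α) (R : ℝ) (f : L2) :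
    fh (dwR α h0 R f) =ᵐ[volume] fun ξ => ((dw α ξ * ind R ξ : ℝ) : ℂ) * fh f ξ :=
  fh_bmul _ _ _ f

theorem BL.inDomain_dw {α : ℝ} (h0 : 0 ≤ α) {R : ℝ} {f : L2} (hf : BL R f) :
    InDomain (fun ξ => (dw α ξ : ℂ)) f := by
  obtain ⟨C, hC⟩ := bdd_dw_ind h0 R
  refine hf.inDomain (rSym_dw α).hSym (C := C) fun ξ h => ?_
  have := hC ξ
  rwa [ind_of_le h, mul_one, ← Real.norm_eq_abs, ← Complex.norm_real] at this

theorem BL.fourierMul_dw {α : ℝ} (h0 : 0 ≤ α) {R : ℝ} {f : L2} (hf : BL R f) :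
    SQG.fourierMul (fun ξ => (dw α ξ : ℂ)) f = dwR α h0 R f := by
  refine ext_fh ?_
  filter_upwards [(rSym_dw α).hSym.fh_fourierMul (hf.inDomain_dw h0), fh_dwR α h0 R f, hf] with ξ h1 h2 h3
  rw [h1, h2]
  rcases le_or_gt ‖ξ‖ R with h | h
  · rw [ind_of_le h, mul_one]
  · rw [h3 h, mul_zero, mul_zero]

/-- The spectrum of g lies in the ball, so the projection in the truncated equation is invisible
when paired with g. -/
theorem inner_J3R_proj {R : ℝ} {g h : L2} (hg : BL R g) (hh : H3 h) :
    inner ℝ (J3R R g) (J3R R (proj R h)) = inner ℝ (J3 g) (J3 h) := by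
  rw [inner_eq_integral, inner_eq_integral]
  refine integral_congr_ae ?_
  filter_upwards [fh_J3R R g, fh_J3R R (proj R h), fh_proj R h, fh_J3 hg.h3, fh_J3 hh, hg]
    with ξ h1 h2 h3 h4 h5 h6
  rw [h1, h2, h3, h4, h5]
  rcases le_or_gt ‖ξ‖ R with h | h
  · rw [ind_of_le h]; simp
  · rw [h6 h]; simp

/-- |2πξ|^{2α} is the square of |2πξ|^α, so testing the fractional Laplacian in H³ yields precisely
the dissipation. -/
theorem inner_J3R_lapR {α : ℝ} (h0 : 0 ≤ α) (R : ℝ) (g : L2) :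
    inner ℝ (J3R R g) (J3R R (lapR α h0 R g)) = ‖dwR α h0 R g‖ ^ 2 := by
  rw [← real_inner_self_eq_norm_sq, inner_eq_integral, inner_eq_integral]
  refine integral_congr_ae ?_
  filter_upwards [fh_J3R R g, fh_J3R R (lapR α h0 R g), fh_lapR α h0 R g, fh_dwR α h0 R g]
    with ξ h1 h2 h3 h4
  rw [h1, h2, h3, h4]
  have e : lam α ξ = ((2 * Real.pi * ‖ξ‖) ^ α) ^ 2 := by
    rw [lam, mul_comm 2 α, Real.rpow_mul (by positivity), Real.rpow_two]
  rcases le_or_gt ‖ξ‖ R with h | h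
  · rw [ind_of_le h, dw, e]
    simp only [map_mul, Complex.conj_ofReal]
    congr 1
    push_cast
    ring
  · rw [ind_of_lt h]; simp

/-- Once N exceeds the bracket on the spectrum of g the truncation is inactive, and commutator
bounds for the bounded weight become bounds for the H³ inner product. -/
theorem BL.bmul_jpN {R : ℝ} {g : L2} (hg : BL R g) {N : ℝ} (hN : 0 ≤ N)
    (hRN : Real.sqrt (1 + (2 * Real.pi * R) ^ 2) ≤ N) {h : L2} (hh : H3 h) :
    inner ℝ h (bmul _ ((rSym_jpN N).pow 6) (bdd_jpN_pow hN 6) g) = inner ℝ (J3 g) (J3 h) := by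
  rw [real_inner_comm, inner_eq_integral, inner_eq_integral]
  refine integral_congr_ae ?_
  filter_upwards [fh_bmul _ ((rSym_jpN N).pow 6) (bdd_jpN_pow hN 6) g, fh_J3 hg.h3, fh_J3 hh, hg]
    with ξ h1 h2 h3 h4
  rw [h1, h2, h3]
  rcases le_or_gt ‖ξ‖ R with h | h
  · rw [jpN, min_eq_left ((jp_le_of_norm_le h).trans hRN)]
    simp only [map_mul, Complex.conj_ofReal]
    congr 1
    push_cast
    ring
  · rw [h4 h]; simp

/-- The universal constant of the energy inequality. -/
def engC : ℝ := 3024 * bernC ^ 4 + 1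

theorem one_lt_engC : 1 < engC := by
  have := bernC_pos
  unfold engC
  have : 0 < bernC ^ 4 := by positivity
  linarith

/-- The energy inequality for the perturbation of a slowly varying solution of the linear equation. -/
theorem energy_le {μ α R : ℝ} (h0 : 0 ≤ α) (h1 : α ≤ 1 / 2) {g Θ : L2} (hR : 2 ≤ R)
    (hg : BL R g) (hΘ : BL 1 Θ) :
    2 * inner ℝ (J3R R g) (J3R R (-proj R (adv (g + Θ) (g + Θ)) - μ • lapR α h0 R g))
      + (2 * μ - 126 * wC * ‖J3R R g‖) * ‖dwR α h0 R g‖ ^ 2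
      ≤ engC * (supSize Θ + advSize Θ) * ‖J3R R g‖ ^ 2 + advSize Θ := by
  have hR' : BL R Θ := hΘ.mono (by linarith)
  have hg3 := hg.h3
  have hΘ3 := hΘ.h3
  -- Self-interaction, transport by U, stretching of Θ, and forcing; they are bounded in this order
  -- in `b1`, `b2`, `b3`, `b4`.
  have e1 : adv (g + Θ) (g + Θ) = adv g g + adv Θ g + (adv g Θ + adv Θ Θ) := by
    rw [adv_add_left hg3 hΘ3 (hg3.add hΘ3), adv_add_right hg3 hg3 hΘ3, adv_add_right hΘ3 hg3 hΘ3]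
    abel
  have a1 := (hg.adv hg).h3
  have a2 := (hΘ.adv hg).h3
  have a3 := (hg.adv hΘ).h3
  have a4 := (hΘ.adv hΘ).h3
  have e2 : inner ℝ (J3R R g) (J3R R (-proj R (adv (g + Θ) (g + Θ)) - μ • lapR α h0 R g))
      = -(inner ℝ (J3 g) (J3 (adv g g)) + inner ℝ (J3 g) (J3 (adv Θ g))
        + inner ℝ (J3 g) (J3 (adv g Θ)) + inner ℝ (J3 g) (J3 (adv Θ Θ)))
        - μ * ‖dwR α h0 R g‖ ^ 2 := by
    rw [map_sub, map_neg, map_smul, inner_sub_right, inner_neg_right, real_inner_smul_right,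
      inner_J3R_lapR, inner_J3R_proj hg (((hg.add hR').adv (hg.add hR')).h3), e1,
      J3_add (a1.add a2) (a3.add a4), J3_add a1 a2, J3_add a3 a4, inner_add_right, inner_add_right,
      inner_add_right]
    ring
  set N := Real.sqrt (1 + (2 * Real.pi * R) ^ 2) with hN
  have hN0 : 0 ≤ N := Real.sqrt_nonneg _
  have b1 := abs_inner_adv_self_le_dw h0 h1 hg3 (hg.inDomain_dw h0) hN0
  rw [hg.bmul_jpN hN0 le_rfl a1, hg.fourierMul_dw h0] at b1
  have b2 := abs_inner_J3_adv_le hΘ hg (velSup_nonneg Θ) (norm_velocity_le_velSup hΘ3)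
  have b3 : |inner ℝ (J3 g) (J3 (adv g Θ))| ≤ ‖J3 g‖ * (96 * (bernC ^ 4 * absSup Θ) * ‖J3 g‖) :=
    (abs_real_inner_le_norm _ _).trans (mul_le_mul_of_nonneg_left
      (norm_J3_adv_le hΘ hg (absSup_nonneg Θ) (abs_le_absSup hΘ3)) (norm_nonneg _))
  have b4 : |inner ℝ (J3 g) (J3 (adv Θ Θ))| ≤ ‖J3 g‖ * advSize Θ := abs_real_inner_le_norm _ _
  rw [e2]
  rw [hg.J3_eq] at b1 b2 b3 b4 ⊢
  have hv := velSup_nonneg Θ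
  have ha := absSup_nonneg Θ
  have hf : 0 ≤ advSize Θ := norm_nonneg _
  have hb := one_le_bernC
  set j := ‖J3R R g‖
  -- Transport sets the constant: 2 · 189 · 2³ = 3024, which exceeds the 2 · 96 needed for
  -- stretching. The additional 1 in `engC` pays for the quadratic part of the forcing in `c4`.
  have c2 : 189 * ((2 * bernC) ^ 3 * velSup Θ) * j ^ 2 ≤ 1512 * bernC ^ 4 * velSup Θ * j ^ 2 := by
    have : bernC ^ 3 ≤ bernC ^ 4 := pow_le_pow_right₀ hb (by norm_num)
    calc 189 * ((2 * bernC) ^ 3 * velSup Θ) * j ^ 2 = 1512 * bernC ^ 3 * velSup Θ * j ^ 2 := by ring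
      _ ≤ _ := by gcongr
  have hb4 : 0 ≤ bernC ^ 4 := by positivity
  have c4 : 2 * (j * advSize Θ) ≤ advSize Θ * (1 + j ^ 2) := by nlinarith [sq_nonneg (j - 1)]
  have c5 : 0 ≤ bernC ^ 4 * absSup Θ * j ^ 2 := by positivity
  have c6 : 0 ≤ bernC ^ 4 * advSize Θ * j ^ 2 := by positivity
  have c7 : 0 ≤ (supSize Θ) * j ^ 2 := mul_nonneg (supSize_nonneg Θ) (sq_nonneg _)
  have d1 := (abs_le.1 b1).1
  have d2 := (abs_le.1 b2).1
  have d3 := (abs_le.1 b3).1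
  have d4 := (abs_le.1 b4).1
  unfold engC supSize
  unfold supSize at c7
  nlinarith

/-- A barrier argument: a quantity that stays below `ε` as long as it stays below `2ε`. -/
theorem le_of_bootstrap {e : ℝ → ℝ} {ε : ℝ} (hε : 0 < ε) (hc : ContinuousOn e (Ici 0))
    (h : ∀ T, 0 ≤ T → (∀ t ∈ Ioo 0 T, e t ≤ 2 * ε) → e T ≤ ε) {T : ℝ} (hT : 0 ≤ T) :
    e T ≤ 2 * ε := by
  by_contra! hcon
  have hcl : IsClosed (Icc 0 T ∩ e ⁻¹' Ici (2 * ε)) :=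
    (hc.mono Icc_subset_Ici_self).preimage_isClosed_of_isClosed isClosed_Icc isClosed_Ici
  have hcomp : IsCompact (Icc 0 T ∩ e ⁻¹' Ici (2 * ε)) :=
    isCompact_Icc.of_isClosed_subset hcl inter_subset_left
  -- The first time at which e reaches 2ε; before it the hypothesis applies and gives e t ≤ ε, a
  -- contradiction.
  obtain ⟨t, ht, hleast⟩ := hcomp.exists_isLeast ⟨T, ⟨hT, le_rfl⟩, hcon.le⟩
  have h1 : e t ≤ ε := h t ht.1.1 fun s hs => by
    by_contra! hs'
    exact absurd (hleast ⟨⟨hs.1.le, hs.2.le.trans ht.1.2⟩, hs'.le⟩) (not_le.2 hs.2)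
  have h2 : 2 * ε ≤ e t := ht.2
  linarith

/-- The uniform bound for frequency-truncated perturbations of the linear solution. -/
theorem galerkin_bound {μ α ε R : ℝ} (hμ : 0 < μ) (h0 : 0 ≤ α) (h1 : α ≤ 1 / 2) (hR : 2 ≤ R)
    {θ Θ : ℝ → L2} (hθc : ContinuousOn θ (Ici 0)) (hθB : ∀ t, 0 ≤ t → BL R (θ t))
    (hθd : ∀ t, 0 < t → HasDerivAt θ (-proj R (adv (θ t) (θ t)) - μ • fracLap α (θ t)) t)
    (hΘc : ContinuousOn Θ (Ici 0)) (hΘB : ∀ t, 0 ≤ t → BL 1 (Θ t))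
    (hΘd : ∀ t, 0 < t → HasDerivAt Θ (-(μ • fracLap α (Θ t))) t) (hε : 0 < ε)
    (hsm : 126 * wC * Real.sqrt (2 * ε) ≤ μ)
    (hsmall : ∀ T, 0 ≤ T → (‖J3 (θ 0 - Θ 0)‖ ^ 2 + ∫ t in (0 : ℝ)..T, advSize (Θ t)) *
      Real.exp (engC * ((∫ t in (0 : ℝ)..T, supSize (Θ t)) + ∫ t in (0 : ℝ)..T, advSize (Θ t))) ≤ ε)
    {T : ℝ} (hT : 0 ≤ T) :
    ‖J3 (θ T - Θ T)‖ ^ 2 +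
      μ * ∫ t in (0 : ℝ)..T, ‖fourierMul (fun ξ => (dw α ξ : ℂ)) (θ t - Θ t)‖ ^ 2 ≤ ε := by
  have hgB : ∀ t, 0 ≤ t → BL R (θ t - Θ t) := fun t ht =>
    (hθB t ht).sub ((hΘB t ht).mono (by linarith))
  have hgc : ContinuousOn (fun t => θ t - Θ t) (Ici 0) := hθc.sub hΘc
  set g : ℝ → L2 := fun t => θ t - Θ t with hg
  have hgd : ∀ t, 0 < t → HasDerivAt g
      (-proj R (adv (g t + Θ t) (g t + Θ t)) - μ • lapR α h0 R (g t)) t := fun t ht => by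
    refine ((hθd t ht).sub (hΘd t ht)).congr_deriv ?_
    rw [fracLap_eq_lapR h0 (hθB t ht.le), fracLap_eq_lapR h0 ((hΘB t ht.le).mono (by linarith : 1 ≤ R)),
      hg]
    simp only [map_sub, smul_sub, sub_add_cancel]
    abel
  set e : ℝ → ℝ := fun t => ‖J3R R (g t)‖ ^ 2 with he
  have hec : ContinuousOn e (Ici 0) := ((J3R R).continuous.comp_continuousOn hgc).norm.pow 2
  -- Clamping time at 0 extends the coefficients continuously to the whole line, as
  -- `gronwall_dissipation` requires.
  have hmax : Continuous fun t : ℝ => max t 0 := continuous_id.max continuous_const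
  have hmem : ∀ t : ℝ, max t 0 ∈ Ici (0 : ℝ) := fun t => mem_Ici.2 (le_max_right _ _)
  set d : ℝ → ℝ := fun t => ‖dwR α h0 R (g (max t 0))‖ ^ 2 with hd
  have hdc : Continuous d :=
    ((dwR α h0 R).continuous.comp (hgc.comp_continuous hmax hmem)).norm.pow 2
  set S : ℝ → ℝ := fun t => supSize (Θ (max t 0)) with hS
  have hSc : Continuous S := (continuousOn_supSize hΘc hΘB).comp_continuous hmax hmem
  set F : ℝ → ℝ := fun t => advSize (Θ (max t 0)) with hF
  have hFc : Continuous F := (continuousOn_advSize hΘc hΘB).comp_continuous hmax hmem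
  have hF0 : ∀ t, 0 ≤ F t := fun t => norm_nonneg _
  have hS0 : ∀ t, 0 ≤ S t := fun t => supSize_nonneg _
  have hC0 : 0 ≤ engC := zero_le_one.trans one_lt_engC.le
  have hInt : ∀ {φ : ℝ → ℝ} {T : ℝ}, 0 ≤ T →
      ∫ t in (0 : ℝ)..T, φ (max t 0) = ∫ t in (0 : ℝ)..T, φ t := by
    intro φ T hT
    refine intervalIntegral.integral_congr fun t ht => ?_
    rw [uIcc_of_le hT] at ht
    simp only [max_eq_left ht.1]
  have key : ∀ T, 0 ≤ T → (∀ t ∈ Ioo 0 T, e t ≤ 2 * ε) →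
      e T + μ * ∫ t in (0 : ℝ)..T, d t ≤ ε := by
    intro T hT hb
    have hgr := gronwall_dissipation (e := e) (d := d) (a := fun t => engC * (S t + F t)) (F := F)
      (e' := fun t => 2 * inner ℝ (J3R R (g t))
        (J3R R (-proj R (adv (g t + Θ t) (g t + Θ t)) - μ • lapR α h0 R (g t)))) hT hμ.le
      (hec.mono Icc_subset_Ici_self) hdc (continuous_const.mul (hSc.add hFc)) hFc
      (fun t => sq_nonneg _) (fun t => mul_nonneg hC0 (add_nonneg (hS0 t) (hF0 t))) hF0
      (fun t ht => ((J3R R).hasFDerivAt.comp_hasDerivAt t (hgd t ht.1)).norm_sq)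
      (fun t ht => ?_)
    · refine hgr.trans (le_trans (le_of_eq ?_) (hsmall T hT))
      rw [intervalIntegral.integral_const_mul, intervalIntegral.integral_add
        (hSc.intervalIntegrable _ _) (hFc.intervalIntegrable _ _)]
      rw [hInt (φ := fun t => supSize (Θ t)) hT, hInt (φ := fun t => advSize (Θ t)) hT,
        (hgB 0 le_rfl).J3_eq]
    · have h2 := energy_le (μ := μ) h0 h1 hR (hgB t ht.1.le) (hΘB t ht.1.le)
      -- As long as e ≤ 2ε, the self-interaction consumes at most μ of the dissipation 2μ, and μ
      -- remains.
      have h3 : ‖J3R R (g t)‖ ≤ Real.sqrt (2 * ε) := Real.le_sqrt_of_sq_le (hb t ht)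
      have h4 : 126 * wC * ‖J3R R (g t)‖ ≤ μ :=
        (mul_le_mul_of_nonneg_left h3 (mul_nonneg (by norm_num) wC_nonneg)).trans hsm
      have h5 : max t 0 = t := max_eq_left ht.1.le
      simp only [hd, hS, hF, he, h5]
      nlinarith [sq_nonneg ‖dwR α h0 R (g t)‖]
  have hdi0 : ∀ T, 0 ≤ T → 0 ≤ μ * ∫ t in (0 : ℝ)..T, d t := fun T hT =>
    mul_nonneg hμ.le (intervalIntegral.integral_nonneg hT fun t _ => sq_nonneg _)
  have hboot : ∀ t, 0 ≤ t → e t ≤ 2 * ε := fun t ht =>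
    le_of_bootstrap hε hec (fun T hT hb => by have := key T hT hb; have := hdi0 T hT; linarith) ht
  have hfin := key T hT fun t ht => hboot t ht.1.le
  rw [hInt (φ := fun t => ‖dwR α h0 R (g t)‖ ^ 2) hT] at hfin
  have e1 : J3 (θ T - Θ T) = J3R R (g T) := (hgB T hT).J3_eq
  have e2 : ∫ t in (0 : ℝ)..T, ‖fourierMul (fun ξ => (dw α ξ : ℂ)) (θ t - Θ t)‖ ^ 2
      = ∫ t in (0 : ℝ)..T, ‖dwR α h0 R (g t)‖ ^ 2 := by
    refine intervalIntegral.integral_congr fun t ht => ?_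
    rw [uIcc_of_le hT] at ht
    have h6 : fourierMul (fun ξ => (dw α ξ : ℂ)) (θ t - Θ t) = dwR α h0 R (g t) :=
      (hgB t ht.1).fourierMul_dw h0
    simp only [h6]
  rw [e1, e2]
  exact hfin

/-! ### L² stability of truncated and of exact solutions -/

theorem le_gronwall_const {e e' : ℝ → ℝ} {T a b : ℝ} (hT : 0 ≤ T) (ha : 0 ≤ a) (hb : 0 ≤ b)
    (he : ContinuousOn e (Icc 0 T)) (hderiv : ∀ t ∈ Ioo 0 T, HasDerivAt e (e' t) t)
    (hle : ∀ t ∈ Ioo 0 T, e' t ≤ a * e t + b) : e T ≤ (e 0 + T * b) * Real.exp (T * a) := by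
  have h := gronwall_dissipation (μ := 0) (d := fun _ => 0) (a := fun _ => a) (F := fun _ => b) hT le_rfl
    he continuous_const continuous_const continuous_const (fun _ => le_rfl) (fun _ => ha) (fun _ => hb)
    hderiv (by simpa using hle)
  simpa using h

theorem H3.inDomain_fracLap {s : ℝ} (h0 : 0 ≤ s) (h1 : 2 * s ≤ 3) {f : L2} (hf : H3 f) :
    InDomain (lapSymbol s) f := by
  refine (hSym_lapSymbol s).inDomain_of_le (C := 1) (fun ξ => ?_) hf
  rw [norm_jp3, one_mul, lapSymbol, Complex.norm_real,
    Real.norm_of_nonneg (Real.rpow_nonneg (by positivity) _)]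
  calc (2 * Real.pi * ‖ξ‖) ^ (2 * s) ≤ jp ξ ^ (2 * s) := by
        gcongr
        exact norm_le_jp ξ
    _ ≤ jp ξ ^ (3 : ℝ) := Real.rpow_le_rpow_of_exponent_le (one_le_jp ξ) h1
    _ = jp ξ ^ 3 := by norm_cast

/-- Interpolation from |2πξ|² ≤ ⟨ξ⟩³: convergence in L² with bounded H³ norms entails convergence of
one derivative. -/
theorem norm_Lam_sq_le {f : L2} (hf : H3 f) : ‖Lam f‖ ^ 2 ≤ ‖f‖ * ‖J3 f‖ := by
  refine le_trans ?_ (real_inner_le_norm f (J3 f))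
  rw [← real_inner_self_eq_norm_sq, inner_eq_integral, inner_eq_integral]
  refine integral_mono_ae (integrable_inner_fh _ _) (integrable_inner_fh _ _) ?_
  filter_upwards [hf.fh_Lam, fh_J3 hf] with ξ h1 h2
  simp only [h1, h2, map_mul, Complex.conj_ofReal]
  have e1 : ∀ a : ℝ, (conj (fh f ξ) * ((a : ℂ) * fh f ξ)).re = a * ‖fh f ξ‖ ^ 2 := fun a => by
    rw [show conj (fh f ξ) * ((a : ℂ) * fh f ξ) = (a : ℂ) * (conj (fh f ξ) * fh f ξ) by ring,
      Complex.re_ofReal_mul, Complex.conj_mul']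
    norm_cast
  have e2 : ∀ a : ℝ, ((a : ℂ) * conj (fh f ξ) * ((a : ℂ) * fh f ξ)).re = a ^ 2 * ‖fh f ξ‖ ^ 2 :=
    fun a => by
      rw [← e1 (a ^ 2)]
      congr 1
      push_cast
      ring
  have e3 := e2 (2 * Real.pi * ‖ξ‖)
  push_cast at e3 ⊢
  have e4 := e1 (jp ξ ^ 3)
  push_cast at e4
  rw [e3, e4]
  refine mul_le_mul_of_nonneg_right ?_ (sq_nonneg _)
  calc (2 * Real.pi * ‖ξ‖) ^ 2 ≤ jp ξ ^ 2 := by gcongr; exact norm_le_jp ξ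
    _ ≤ jp ξ ^ 3 := pow_le_pow_right₀ (one_le_jp ξ) (by norm_num)

theorem norm_fracLap_le {α : ℝ} (h0 : 0 ≤ α) (h1 : α ≤ 1 / 2) {f : L2} (hf : H3 f) :
    ‖fracLap α f‖ ≤ ‖f‖ + ‖Lam f‖ := by
  refine le_trans (norm_le_norm_of_fh_le ?_) (norm_add_le f (Lam f))
  filter_upwards [(hSym_lapSymbol α).fh_fourierMul (hf.inDomain_fracLap h0 (by linarith)),
    fh_add f (Lam f), hf.fh_Lam] with ξ e1 e2 e3
  have e4 : fh f ξ + ((2 * Real.pi * ‖ξ‖ : ℝ) : ℂ) * fh f ξ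
      = ((1 + 2 * Real.pi * ‖ξ‖ : ℝ) : ℂ) * fh f ξ := by push_cast; ring
  rw [fracLap, e1, e2, e3, e4, norm_mul, norm_mul, lapSymbol, Complex.norm_real, Complex.norm_real]
  refine mul_le_mul_of_nonneg_right ?_ (norm_nonneg _)
  have hx : 0 ≤ 2 * Real.pi * ‖ξ‖ := by positivity
  rw [Real.norm_of_nonneg (Real.rpow_nonneg hx _), Real.norm_of_nonneg (by linarith)]
  rcases le_total (2 * Real.pi * ‖ξ‖) 1 with h | h
  · exact (Real.rpow_le_one hx h (by linarith)).trans (by linarith)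
  · calc (2 * Real.pi * ‖ξ‖) ^ (2 * α) ≤ (2 * Real.pi * ‖ξ‖) ^ (1 : ℝ) :=
          Real.rpow_le_rpow_of_exponent_le h (by linarith)
      _ ≤ _ := by rw [Real.rpow_one]; linarith

/-- Outside the ball ⟨ξ⟩³ ≥ R. A single power of R is kept, which is enough for the limit. -/
theorem norm_sub_proj_le {R : ℝ} (hR : 0 < R) {f : L2} (hf : H3 f) :
    ‖f - proj R f‖ ≤ R⁻¹ * ‖J3 f‖ := by
  rw [← norm_fhat, ← norm_fhat (J3 f)]
  refine Lp.norm_le_mul_norm_of_ae_le_mul ?_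
  filter_upwards [fh_ae (f - proj R f), fh_sub f (proj R f), fh_proj R f, fh_ae (J3 f), fh_J3 hf]
    with ξ h1 h2 h3 h4 h5
  rw [← h1, ← h4, h2, h3, h5]
  rcases le_or_gt ‖ξ‖ R with h | h
  · rw [ind_of_le h]
    simp only [Complex.ofReal_one, one_mul, sub_self, norm_zero]
    positivity
  · rw [ind_of_lt h, norm_mul, Complex.norm_real,
      Real.norm_of_nonneg (pow_nonneg (jp_pos ξ).le 3)]
    simp only [Complex.ofReal_zero, zero_mul, sub_zero]
    have h6 : R ≤ jp ξ ^ 3 := by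
      refine le_trans ?_ (le_self_pow₀ (one_le_jp ξ) (by norm_num))
      refine le_trans ?_ (norm_le_jp ξ)
      nlinarith [Real.pi_gt_three, norm_nonneg ξ]
    rw [← mul_assoc]
    refine le_mul_of_one_le_left (norm_nonneg _) ?_
    rw [← div_eq_inv_mul]
    exact (one_le_div hR).2 h6

/-- The nonlinear term is continuous in `L²` on bounded sets of `H³`. -/
theorem norm_adv_sub_adv_le {M : ℝ} {f g : L2} (hf : H3 f) (hg : H3 g) (hfM : ‖J3 f‖ ≤ M)
    (hgM : ‖J3 g‖ ≤ M) :
    ‖adv f f - adv g g‖ ≤ wC * M * ‖f - g‖ + 2 * (wC * M) * ‖Lam (f - g)‖ := by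
  have hw := wC_nonneg
  have e : adv f f - adv g g = adv (f - g) f + adv g (f - g) := by
    rw [adv_sub_left hf hg hf, adv_sub_right hg hf hg]; abel
  rw [e]
  refine (norm_add_le _ _).trans (add_le_add ((norm_adv_le' (hf.sub hg) hf).trans ?_)
    ((norm_adv_le_velocity hg (hf.sub hg) (by positivity) (norm_velocity_le_J3 hg)).trans ?_))
  · gcongr
  · have : 2 * (wC * ‖J3 g‖) ≤ 2 * (wC * M) := by gcongr
    exact mul_le_mul_of_nonneg_right this (norm_nonneg _)

theorem inner_fracLap_nonneg {α : ℝ} {f : L2} (hf : InDomain (lapSymbol α) f) :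
    0 ≤ inner ℝ f (fracLap α f) := by
  rw [inner_eq_integral]
  refine integral_nonneg_of_ae ?_
  filter_upwards [(hSym_lapSymbol α).fh_fourierMul hf] with ξ e
  have e' : fh (fracLap α f) ξ = ((lam α ξ : ℝ) : ℂ) * fh f ξ := e
  rw [e', show conj (fh f ξ) * ((lam α ξ : ℝ) * fh f ξ)
    = ((lam α ξ : ℝ) : ℂ) * (conj (fh f ξ) * fh f ξ) by ring,
    Complex.re_ofReal_mul, Complex.conj_mul']
  refine mul_nonneg (lam_nonneg α ξ) ?_
  norm_cast
  positivity

theorem fracLap_sub {α : ℝ} {f g : L2} (hf : InDomain (lapSymbol α) f)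
    (hg : InDomain (lapSymbol α) g) : fracLap α (f - g) = fracLap α f - fracLap α g :=
  (hSym_lapSymbol α).fourierMul_sub hf hg

/-- The nonlinear contribution to the evolution of the `L²` norm of a difference. -/
theorem abs_inner_sub_adv_le {f g : L2} (hf : H3 f) (hg : H3 g) :
    |inner ℝ (f - g) (adv f f - adv g g)| ≤ wC * ‖J3 f‖ * ‖f - g‖ ^ 2 := by
  have e : adv f f - adv g g = adv (f - g) f + adv g (f - g) := by
    rw [adv_sub_left hf hg hf, adv_sub_right hg hf hg]; abel
  -- Transport of the difference by g is skew, so the H³ norm of g never enters; this is why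
  -- uniqueness asks for a bound on one solution only.
  rw [e, inner_add_right, real_inner_comm (adv g (f - g)), inner_adv_self hg (hf.sub hg), add_zero]
  refine (abs_real_inner_le_norm _ _).trans ?_
  calc ‖f - g‖ * ‖adv (f - g) f‖ ≤ ‖f - g‖ * (wC * ‖J3 f‖ * ‖f - g‖) := by
        gcongr
        exact norm_adv_le' (hf.sub hg) hf
    _ = _ := by ring

theorem norm_adv_self_le {M : ℝ} {h : L2} (hh : H3 h) (hM : ‖J3 h‖ ≤ M) :
    ‖adv h h‖ ≤ wC * M * M := by
  have hw := wC_nonneg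
  have hM0 : 0 ≤ M := (norm_nonneg _).trans hM
  refine (norm_adv_le' hh hh).trans ?_
  gcongr
  exact (norm_le_J3 hh).trans hM

/-- Self-adjointness transfers the projection error from h, known only in L², to w, which lies in H³
and yields the factor 1/n. -/
theorem abs_inner_sub_proj_le {M r n : ℝ} {w h : L2} (hn : 0 < n) (hnr : n ≤ r) (hw : H3 w)
    (hwM : ‖J3 w‖ ≤ 2 * M) (hM : 0 ≤ M) {c : ℝ} (hc : ‖h‖ ≤ c) :
    |inner ℝ w (h - proj r h)| ≤ n⁻¹ * (2 * M) * c := by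
  have e : inner ℝ w (h - proj r h) = inner ℝ (w - proj r w) h := by
    rw [inner_sub_right, inner_sub_left, inner_proj_left]
  rw [e]
  refine (abs_real_inner_le_norm _ _).trans ?_
  have hr0 : 0 < r := hn.trans_le hnr
  refine mul_le_mul ((norm_sub_proj_le hr0 hw).trans ?_) hc (norm_nonneg _) (by positivity)
  gcongr

/-- The truncated fields differ from the exact one by two projection errors, each at most n⁻¹ · 2M ·
wC M²; with the factor 2 in front this makes 8. -/
theorem inner_sub_galerkin_le {μ α M m n : ℝ} (hμ : 0 < μ) (h0 : 0 ≤ α) (h1 : α ≤ 1 / 2)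
    (hn : 0 < n) (hnm : n ≤ m) {f g : L2} (hf : H3 f) (hg : H3 g) (hfM : ‖J3 f‖ ≤ M)
    (hgM : ‖J3 g‖ ≤ M) :
    2 * inner ℝ (f - g) (-proj m (adv f f) - μ • fracLap α f - (-proj n (adv g g) - μ • fracLap α g))
      ≤ 2 * wC * M * ‖f - g‖ ^ 2 + n⁻¹ * (8 * wC * M ^ 3) := by
  have hM : 0 ≤ M := (norm_nonneg _).trans hfM
  have hdx := hf.inDomain_fracLap h0 (by linarith : 2 * α ≤ 3)
  have hdy := hg.inDomain_fracLap h0 (by linarith : 2 * α ≤ 3)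
  have e1 : -proj m (adv f f) - μ • fracLap α f - (-proj n (adv g g) - μ • fracLap α g)
      = -(adv f f - adv g g) + (adv f f - proj m (adv f f)) - (adv g g - proj n (adv g g))
        - μ • fracLap α (f - g) := by
    rw [fracLap_sub hdx hdy, smul_sub]; abel
  have hJw : ‖J3 (f - g)‖ ≤ 2 * M := by
    rw [J3_sub hf hg]
    exact (norm_sub_le _ _).trans (by linarith)
  have c1 := (abs_le.1 (abs_inner_sub_adv_le hf hg)).1
  have c2 := (abs_le.1 (abs_inner_sub_proj_le hn hnm (hf.sub hg) hJw hM (norm_adv_self_le hf hfM))).2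
  have c3 := (abs_le.1 (abs_inner_sub_proj_le hn le_rfl (hf.sub hg) hJw hM (norm_adv_self_le hg hgM))).1
  have c4 := mul_nonneg hμ.le
    (inner_fracLap_nonneg ((hf.sub hg).inDomain_fracLap h0 (by linarith : 2 * α ≤ 3)))
  have c5 : wC * ‖J3 f‖ * ‖f - g‖ ^ 2 ≤ wC * M * ‖f - g‖ ^ 2 :=
    mul_le_mul_of_nonneg_right (mul_le_mul_of_nonneg_left hfM wC_nonneg) (sq_nonneg _)
  rw [e1, inner_sub_right, inner_sub_right, inner_add_right, inner_neg_right, real_inner_smul_right]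
  have e2 : n⁻¹ * (8 * wC * M ^ 3) = 4 * (n⁻¹ * (2 * M) * (wC * M * M)) := by ring
  rw [e2]
  linarith

/-- Two frequency-truncated solutions with different truncations stay close in `L²`. -/
theorem norm_galerkin_sub_sq_le {μ α M T m n : ℝ} (hμ : 0 < μ) (h0 : 0 ≤ α) (h1 : α ≤ 1 / 2)
    (hn : 0 < n) (hnm : n ≤ m) (hT : 0 ≤ T) {x y : ℝ → L2}
    (hxc : ContinuousOn x (Ici 0)) (hx3 : ∀ t, 0 ≤ t → H3 (x t)) (hxM : ∀ t, 0 ≤ t → ‖J3 (x t)‖ ≤ M)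
    (hxd : ∀ t, 0 < t → HasDerivAt x (-proj m (adv (x t) (x t)) - μ • fracLap α (x t)) t)
    (hyc : ContinuousOn y (Ici 0)) (hy3 : ∀ t, 0 ≤ t → H3 (y t)) (hyM : ∀ t, 0 ≤ t → ‖J3 (y t)‖ ≤ M)
    (hyd : ∀ t, 0 < t → HasDerivAt y (-proj n (adv (y t) (y t)) - μ • fracLap α (y t)) t) :
    ‖x T - y T‖ ^ 2 ≤ (‖x 0 - y 0‖ ^ 2 + T * (n⁻¹ * (8 * wC * M ^ 3))) *
      Real.exp (T * (2 * wC * M)) := by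
  have hw := wC_nonneg
  have hM : 0 ≤ M := (norm_nonneg _).trans (hxM 0 le_rfl)
  exact le_gronwall_const (e := fun t => ‖x t - y t‖ ^ 2) hT (by positivity) (by positivity)
    (((hxc.sub hyc).mono Icc_subset_Ici_self).norm.pow 2)
    (fun t ht => (show HasDerivAt (fun t => x t - y t) _ t from
      (hxd t ht.1).sub (hyd t ht.1)).norm_sq)
    fun t ht => inner_sub_galerkin_le hμ h0 h1 hn hnm (hx3 t ht.1.le) (hy3 t ht.1.le)
      (hxM t ht.1.le) (hyM t ht.1.le)

/-- Uniqueness of solutions that are bounded in `H³`. -/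
theorem eq_of_bounded_solutions {μ α M T : ℝ} (hμ : 0 < μ) (h0 : 0 ≤ α) (h1 : α ≤ 1 / 2)
    (hT : 0 ≤ T) {x y : ℝ → L2}
    (hxc : ContinuousOn x (Ici 0)) (hx3 : ∀ t, 0 ≤ t → H3 (x t))
    (hxM : ∀ t ∈ Icc 0 T, ‖J3 (x t)‖ ≤ M)
    (hxd : ∀ t, 0 < t → HasDerivAt x (-adv (x t) (x t) - μ • fracLap α (x t)) t)
    (hyc : ContinuousOn y (Ici 0)) (hy3 : ∀ t, 0 ≤ t → H3 (y t))
    (hyd : ∀ t, 0 < t → HasDerivAt y (-adv (y t) (y t) - μ • fracLap α (y t)) t)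
    (h : x 0 = y 0) : x T = y T := by
  have hw := wC_nonneg
  have hM : 0 ≤ M := (norm_nonneg _).trans (hxM 0 ⟨le_rfl, hT⟩)
  have key := le_gronwall_const (e := fun t => ‖x t - y t‖ ^ 2) (a := 2 * wC * M) (b := 0) hT
    (by positivity) le_rfl (((hxc.sub hyc).mono Icc_subset_Ici_self).norm.pow 2)
    (fun t ht => (show HasDerivAt (fun t => x t - y t) _ t from
      (hxd t ht.1).sub (hyd t ht.1)).norm_sq) fun t ht => by
      have hx := hx3 t ht.1.le
      have hy := hy3 t ht.1.le
      have hxM := hxM t ⟨ht.1.le, ht.2.le⟩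
      have hdx := hx.inDomain_fracLap h0 (by linarith)
      have hdy := hy.inDomain_fracLap h0 (by linarith)
      have e1 : -adv (x t) (x t) - μ • fracLap α (x t) - (-adv (y t) (y t) - μ • fracLap α (y t))
          = -(adv (x t) (x t) - adv (y t) (y t)) - μ • fracLap α (x t - y t) := by
        rw [fracLap_sub hdx hdy, smul_sub]; abel
      have c1 := abs_le.1 (abs_inner_sub_adv_le hx hy)
      have c4 := mul_nonneg hμ.le
        (inner_fracLap_nonneg ((hx.sub hy).inDomain_fracLap h0 (by linarith)))
      have c5 : wC * ‖J3 (x t)‖ * ‖x t - y t‖ ^ 2 ≤ wC * M * ‖x t - y t‖ ^ 2 := by gcongr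
      rw [e1, inner_sub_right, inner_neg_right, real_inner_smul_right]
      linarith [c1.1]
  simp only [h, sub_self, norm_zero, mul_zero, add_zero] at key
  have h2 : ‖x T - y T‖ ^ 2 ≤ 0 := by simpa using key
  exact sub_eq_zero.1 (norm_eq_zero.1 (pow_eq_zero_iff two_ne_zero |>.1 (le_antisymm h2 (sq_nonneg _))))

/-! ### Lower semicontinuity of the H³ norm and of the dissipation -/

theorem enorm_complex_ofReal (r : ℝ) : ‖(r : ℂ)‖ₑ = ‖r‖ₑ := by
  rw [← ofReal_norm, Complex.norm_real, ofReal_norm]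

theorem ind_mono {R R' : ℝ} (h : R ≤ R') (ξ : Plane) : ind R ξ ≤ ind R' ξ := by
  rcases le_or_gt ‖ξ‖ R with h1 | h1
  · rw [ind_of_le h1, ind_of_le (h1.trans h)]
  · rw [ind_of_lt h1]; exact ind_nonneg _ _

theorem proj_proj {R R' : ℝ} (h : R ≤ R') (f : L2) : proj R (proj R' f) = proj R f := by
  refine ext_fh ?_
  filter_upwards [fh_proj R (proj R' f), fh_proj R' f, fh_proj R f] with ξ h1 h2 h3
  rw [h1, h2, h3]
  rcases le_or_gt ‖ξ‖ R with h4 | h4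
  · rw [ind_of_le (h4.trans h)]; simp
  · rw [ind_of_lt h4]; simp

theorem monotone_enorm_mul_ind (m : Plane → ℝ) (f : L2) (ξ : Plane) :
    Monotone fun R : ℕ => ‖((m ξ * ind R ξ : ℝ) : ℂ) * fh f ξ‖ₑ ^ 2 := by
  intro R R' h
  have h1 : (R : ℝ) ≤ R' := by exact_mod_cast h
  dsimp only
  rw [enorm_mul, enorm_mul, enorm_complex_ofReal, enorm_complex_ofReal, enorm_mul, enorm_mul]
  gcongr
  rw [enorm_ofReal_abs, enorm_ofReal_abs, abs_of_nonneg (ind_nonneg _ _), abs_of_nonneg (ind_nonneg _ _)]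
  exact ENNReal.ofReal_le_ofReal (ind_mono h1 ξ)

/-- Monotone convergence over balls of frequencies. It exhibits the H³ norm and the dissipation as
suprema of functions continuous on L². -/
theorem lintegral_eq_iSup_ind {m : Plane → ℝ} (hm : Measurable m) (f : L2) :
    ∫⁻ ξ, ‖(m ξ : ℂ) * fh f ξ‖ₑ ^ 2 = ⨆ R : ℕ, ∫⁻ ξ, ‖((m ξ * ind R ξ : ℝ) : ℂ) * fh f ξ‖ₑ ^ 2 := by
  rw [← lintegral_iSup]
  · refine lintegral_congr fun ξ => le_antisymm ?_ (iSup_le fun R => ?_)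
    · obtain ⟨R, hR⟩ := exists_nat_ge ‖ξ‖
      refine le_iSup_of_le R ?_
      rw [ind_of_le hR, mul_one]
    · obtain ⟨R', hR'⟩ := exists_nat_ge (max ‖ξ‖ R)
      have h1 := monotone_enorm_mul_ind m f ξ
        (show R ≤ R' by exact_mod_cast (le_max_right _ _).trans hR')
      dsimp only at h1
      rwa [ind_of_le ((le_max_left _ _).trans hR'), mul_one] at h1
  · intro R
    have h1 := measurable_fh f
    have h2 := (rSym_ind R).meas
    exact (((Complex.measurable_ofReal.comp (hm.mul h2)).mul h1).enorm).pow_const 2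
  · intro R R' h ξ
    exact monotone_enorm_mul_ind m f ξ h

theorem hNorm_sq_eq_iSup (f : L2) : hNorm 3 f ^ 2 = ⨆ R : ℕ, ‖J3R R f‖ₑ ^ 2 := by
  rw [hNorm_coe_sq, lintegral_eq_iSup_ind (m := fun ξ => jp ξ ^ 3) (measurable_jp.pow_const 3)]
  refine iSup_congr fun R => ?_
  rw [enorm_sq_eq]
  refine lintegral_congr_ae ?_
  filter_upwards [fh_J3R R f] with ξ e
  rw [e]

/-- The square of the `H³` norm of `Λ^α f`. -/
def dissip (α : ℝ) (f : L2) : ℝ≥0∞ := ∫⁻ ξ, ‖(dw α ξ : ℂ) * fh f ξ‖ₑ ^ 2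

theorem dissip_eq_iSup {α : ℝ} (h0 : 0 ≤ α) (f : L2) :
    dissip α f = ⨆ R : ℕ, ‖dwR α h0 R f‖ₑ ^ 2 := by
  rw [dissip, lintegral_eq_iSup_ind (rSym_dw α).meas]
  refine iSup_congr fun R => ?_
  rw [enorm_sq_eq]
  refine lintegral_congr_ae ?_
  filter_upwards [fh_dwR α h0 R f] with ξ e
  rw [e]

theorem monotone_enorm_dwR {α : ℝ} (h0 : 0 ≤ α) (f : L2) :
    Monotone fun R : ℕ => ‖dwR α h0 R f‖ₑ ^ 2 := by
  intro R R' h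
  simp only [enorm_sq_eq]
  refine lintegral_mono_ae ?_
  filter_upwards [fh_dwR α h0 R f, fh_dwR α h0 R' f] with ξ e1 e2
  rw [e1, e2]
  exact monotone_enorm_mul_ind _ f ξ h

theorem hNorm_fracLap_sq {α : ℝ} (h0 : 0 ≤ α) (h1 : α ≤ 1 / 2) {f : L2} (hf : H3 f) :
    hNorm 3 (fracLap (α / 2) f) ^ 2 = dissip α f := by
  rw [hNorm_coe_sq, dissip]
  refine lintegral_congr_ae ?_
  filter_upwards [(hSym_lapSymbol (α / 2)).fh_fourierMul
    (hf.inDomain_fracLap (by linarith) (by linarith))] with ξ e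
  rw [fracLap, e, lapSymbol, dw, ← mul_assoc, show 2 * (α / 2) = α by ring]
  congr 3
  push_cast
  ring

theorem norm_J3R_le_J3 (R : ℝ) {f : L2} (hf : H3 f) : ‖J3R R f‖ ≤ ‖J3 f‖ := by
  refine norm_le_norm_of_fh_le ?_
  filter_upwards [fh_J3R R f, fh_J3 hf] with ξ h1 h2
  rw [h1, h2, norm_mul, norm_mul, Complex.norm_real, Complex.norm_real, norm_mul]
  gcongr
  rw [Real.norm_of_nonneg (ind_nonneg R ξ)]
  exact mul_le_of_le_one_right (norm_nonneg _) (ind_le_one R ξ)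

theorem h3_of_norm_J3R_le {f : L2} {M : ℝ} (h : ∀ R : ℕ, ‖J3R R f‖ ≤ M) : H3 f ∧ ‖J3 f‖ ≤ M := by
  have hM : 0 ≤ M := (norm_nonneg _).trans (h 0)
  have h1 : hNorm 3 f ^ 2 ≤ ENNReal.ofReal M ^ 2 := by
    rw [hNorm_sq_eq_iSup]
    refine iSup_le fun R => ?_
    gcongr
    rw [← ofReal_norm]
    exact ENNReal.ofReal_le_ofReal (h R)
  have h2 := (ENNReal.pow_right_strictMono two_ne_zero).le_iff_le.1 h1
  have h3 : H3 f := (hNorm_lt_top_iff f).1 (h2.trans_lt ENNReal.ofReal_lt_top)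
  refine ⟨h3, ?_⟩
  rw [hNorm_eq_enorm_J3 h3, ← ofReal_norm] at h2
  exact (ENNReal.ofReal_le_ofReal_iff hM).1 h2

/-- Each truncation `J3R` is continuous on L², so the bound passes to the limit before R is sent to
infinity. -/
theorem h3_of_tendsto {ι : Type*} {l : Filter ι} [NeBot l] {u : ι → L2} {f : L2} {M : ℝ}
    (h : Tendsto u l (𝓝 f)) (h3 : ∀ᶠ n in l, H3 (u n)) (hM : ∀ᶠ n in l, ‖J3 (u n)‖ ≤ M) :
    H3 f ∧ ‖J3 f‖ ≤ M := by
  refine h3_of_norm_J3R_le fun R => ?_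
  refine le_of_tendsto (((J3R R).continuous.tendsto f).comp h).norm ?_
  filter_upwards [h3, hM] with n e1 e2 using (norm_J3R_le_J3 R e1).trans e2

theorem tendsto_proj (f : L2) : Tendsto (fun R : ℕ => proj R f) atTop (𝓝 f) := by
  have hlim : Tendsto (fun R : ℕ => ∫⁻ ξ, ‖((1 - ind R ξ : ℝ) : ℂ) * fh f ξ‖ₑ ^ 2) atTop (𝓝 0) := by
    have h1 := measurable_fh f
    have := tendsto_lintegral_of_dominated_convergence (μ := (volume : Measure Plane))
      (F := fun (R : ℕ) ξ => ‖((1 - ind R ξ : ℝ) : ℂ) * fh f ξ‖ₑ ^ 2) (f := fun _ => 0)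
      (fun ξ => ‖fh f ξ‖ₑ ^ 2) (fun R => ?_) (fun R => Eventually.of_forall fun ξ => ?_) ?_
      (Eventually.of_forall fun ξ => ?_)
    · simpa using this
    · have h2 := (rSym_ind R).meas
      exact (((Complex.measurable_ofReal.comp (measurable_const.sub h2)).mul h1).enorm).pow_const 2
    · dsimp only
      rw [enorm_mul, mul_pow]
      refine mul_le_of_le_one_left' (pow_le_one₀ zero_le ?_)
      rw [enorm_complex_ofReal, enorm_ofReal_abs, ENNReal.ofReal_le_one, abs_le]
      constructor <;> linarith [ind_nonneg R ξ, ind_le_one R ξ]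
    · rw [← enorm_sq_eq]
      exact (ENNReal.pow_lt_top enorm_lt_top).ne
    · obtain ⟨N, hN⟩ := exists_nat_ge ‖ξ‖
      refine tendsto_const_nhds.congr' ?_
      filter_upwards [eventually_ge_atTop N] with R hR
      rw [ind_of_le (hN.trans (by exact_mod_cast hR))]
      simp
  have h2 : Tendsto (fun R : ℕ => ‖f - proj R f‖ₑ ^ 2) atTop (𝓝 0) := by
    refine hlim.congr fun R => ?_
    rw [enorm_sq_eq]
    refine lintegral_congr_ae ?_
    filter_upwards [fh_sub f (proj R f), fh_proj R f] with ξ e1 e2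
    rw [e1, e2]
    congr 2
    push_cast
    ring
  have h3 : Tendsto (fun R : ℕ => ‖f - proj R f‖ ^ 2) atTop (𝓝 0) := by
    have := (ENNReal.tendsto_toReal (by simp)).comp h2
    simpa [Function.comp_def] using this
  have h4 : Tendsto (fun R : ℕ => ‖f - proj R f‖) atTop (𝓝 0) := by
    have := h3.sqrt
    simpa [Real.sqrt_sq (norm_nonneg _)] using this
  rw [tendsto_iff_norm_sub_tendsto_zero]
  simpa only [norm_sub_rev] using h4

theorem eq_zero_of_proj_eq_zero {f : L2} (h : ∀ R : ℕ, proj R f = 0) : f = 0 := by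
  have := tendsto_proj f
  simp only [h] at this
  exact (tendsto_nhds_unique this tendsto_const_nhds)

/-! ### Passage to the limit in the truncated equations -/

/-- The right-hand side of the SQG equation. -/
def rhs (μ α : ℝ) (f : L2) : L2 := -adv f f - μ • fracLap α f

/-- A modulus of continuity in `L²` for the right-hand side of the equation on bounded sets of `H³`. -/
def modulus (μ M d : ℝ) : ℝ := (wC * M + |μ|) * d + (2 * (wC * M) + |μ|) * Real.sqrt (d * (2 * M))

theorem tendsto_modulus (μ M : ℝ) : Tendsto (modulus μ M) (𝓝 0) (𝓝 0) := by
  have : Continuous (modulus μ M) := by unfold modulus; fun_prop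
  simpa [modulus] using this.tendsto 0

/-- The right-hand side loses at most one derivative, which is interpolated between the L² distance
and the H³ bound 2M; hence the square root in `modulus`. -/
theorem norm_rhs_sub_le {μ α M : ℝ} (h0 : 0 ≤ α) (h1 : α ≤ 1 / 2) {f g : L2} (hf : H3 f) (hg : H3 g)
    (hfM : ‖J3 f‖ ≤ M) (hgM : ‖J3 g‖ ≤ M) :
    ‖rhs μ α f - rhs μ α g‖ ≤ modulus μ M ‖f - g‖ := by
  have hM : 0 ≤ M := (norm_nonneg _).trans hfM
  have hw := wC_nonneg
  have hJ : ‖J3 (f - g)‖ ≤ 2 * M := by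
    rw [J3_sub hf hg]; exact (norm_sub_le _ _).trans (by linarith)
  have hL : ‖Lam (f - g)‖ ≤ Real.sqrt (‖f - g‖ * (2 * M)) :=
    Real.le_sqrt_of_sq_le ((norm_Lam_sq_le (hf.sub hg)).trans (by gcongr))
  have e : rhs μ α f - rhs μ α g = -(adv f f - adv g g) - μ • fracLap α (f - g) := by
    rw [fracLap_sub (hf.inDomain_fracLap h0 (by linarith)) (hg.inDomain_fracLap h0 (by linarith)),
      rhs, rhs, smul_sub]
    abel
  rw [e]
  have b1 := norm_adv_sub_adv_le hf hg hfM hgM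
  have b2 := norm_fracLap_le h0 h1 (hf.sub hg)
  refine (norm_sub_le _ _).trans ?_
  rw [norm_neg, norm_smul, Real.norm_eq_abs]
  have c1 := mul_le_mul_of_nonneg_left b2 (abs_nonneg μ)
  have c2 := mul_le_mul_of_nonneg_left hL (by positivity : 0 ≤ 2 * (wC * M) + |μ|)
  unfold modulus
  linarith

theorem continuousOn_rhs {μ α M : ℝ} (h0 : 0 ≤ α) (h1 : α ≤ 1 / 2) {θ : ℝ → L2} {S : Set ℝ}
    (hc : ContinuousOn θ S) (h3 : ∀ t ∈ S, H3 (θ t)) (hM : ∀ t ∈ S, ‖J3 (θ t)‖ ≤ M) :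
    ContinuousOn (fun t => rhs μ α (θ t)) S := by
  intro t ht
  rw [ContinuousWithinAt, tendsto_iff_norm_sub_tendsto_zero]
  have h2 : Tendsto (fun s => ‖θ s - θ t‖) (𝓝[S] t) (𝓝 0) :=
    tendsto_iff_norm_sub_tendsto_zero.1 (hc t ht)
  refine squeeze_zero' (Eventually.of_forall fun s => norm_nonneg _) ?_ ((tendsto_modulus μ M).comp h2)
  filter_upwards [self_mem_nhdsWithin] with s hs
  exact norm_rhs_sub_le h0 h1 (h3 s hs) (h3 t ht) (hM s hs) (hM t ht)

theorem exists_uniform_limit {E : Type*} [NormedAddCommGroup E] [CompleteSpace E] {x : ℕ → ℝ → E}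
    (h : ∀ T, 0 ≤ T → ∃ δ : ℕ → ℝ, Tendsto δ atTop (𝓝 0) ∧
      ∀ n m, n ≤ m → ∀ t ∈ Icc 0 T, ‖x m t - x n t‖ ≤ δ n) :
    ∃ θ : ℝ → E, ∀ T, 0 ≤ T → TendstoUniformlyOn x θ atTop (Icc 0 T) := by
  have huc : ∀ T, 0 ≤ T → UniformCauchySeqOn x atTop (Icc 0 T) := by
    intro T hT
    obtain ⟨δ, hδ, hx⟩ := h T hT
    rw [Metric.uniformCauchySeqOn_iff]
    intro ε hε
    obtain ⟨N, hN⟩ := (hδ.eventually_lt_const (half_pos hε)).exists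
    refine ⟨N, fun m hm n hn t ht => ?_⟩
    have h1 := hx N m hm t ht
    have h2 := hx N n hn t ht
    calc dist (x m t) (x n t) ≤ dist (x m t) (x N t) + dist (x n t) (x N t) := dist_triangle_right _ _ _
      _ < ε := by rw [dist_eq_norm, dist_eq_norm]; linarith
  have hlim : ∀ t, ∃ y, 0 ≤ t → Tendsto (fun n => x n t) atTop (𝓝 y) := by
    intro t
    by_cases ht : 0 ≤ t
    · obtain ⟨y, hy⟩ := cauchySeq_tendsto_of_complete ((huc t ht).cauchySeq ⟨ht, le_rfl⟩)
      exact ⟨y, fun _ => hy⟩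
    · exact ⟨0, fun h => absurd h ht⟩
  choose θ hθ using hlim
  exact ⟨θ, fun T hT => (huc T hT).tendstoUniformlyOn_of_tendsto fun t ht => hθ t ht.1⟩

theorem continuousOn_Ici_of_tendstoUniformlyOn {E : Type*} [NormedAddCommGroup E] {x : ℕ → ℝ → E}
    {θ : ℝ → E} (h : ∀ T, 0 ≤ T → TendstoUniformlyOn x θ atTop (Icc 0 T))
    (hc : ∀ n, ContinuousOn (x n) (Ici 0)) : ContinuousOn θ (Ici 0) := by
  intro t ht
  have ht' : (0 : ℝ) ≤ t := ht
  have h1 : ContinuousOn θ (Icc 0 (t + 1)) := (h (t + 1) (by linarith)).continuousOn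
    (Frequently.of_forall fun n => (hc n).mono Icc_subset_Ici_self)
  refine (h1 t ⟨ht', by linarith⟩).mono_of_mem_nhdsWithin ?_
  filter_upwards [inter_mem_nhdsWithin (Ici (0 : ℝ)) (Iio_mem_nhds (lt_add_one t))] with s hs
    using ⟨hs.1, (mem_Iio.1 hs.2).le⟩

/-- A limit of solutions of the truncated equations, bounded in `H³`, solves the equation. -/
theorem hasDerivAt_of_limit {μ α M : ℝ} (h0 : 0 ≤ α) (h1 : α ≤ 1 / 2) {x : ℕ → ℝ → L2} {θ : ℝ → L2}
    (hu : ∀ T, 0 ≤ T → TendstoUniformlyOn x θ atTop (Icc 0 T))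
    (hc : ContinuousOn θ (Ici 0)) (hx3 : ∀ n t, 0 ≤ t → H3 (x n t))
    (hxM : ∀ n t, 0 ≤ t → ‖J3 (x n t)‖ ≤ M)
    (hθ3 : ∀ t, 0 ≤ t → H3 (θ t)) (hθM : ∀ t, 0 ≤ t → ‖J3 (θ t)‖ ≤ M)
    (hd : ∀ (n : ℕ) t, 0 < t →
      HasDerivAt (x n) (-proj (n + 2) (adv (x n t) (x n t)) - μ • fracLap α (x n t)) t) :
    ∀ t, 0 < t → HasDerivAt θ (rhs μ α (θ t)) t := by
  -- After projection to a fixed ball, the truncation at n + 2 is invisible for n ≥ R and the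
  -- derivatives converge uniformly.
  have hproj : ∀ (R : ℕ) t, 0 < t →
      HasDerivAt (fun t => proj R (θ t)) (proj R (rhs μ α (θ t))) t := by
    intro R t ht
    have hunif : TendstoUniformlyOn (fun n t => proj R (rhs μ α (x n t)))
        (fun t => proj R (rhs μ α (θ t))) atTop (Ioo 0 (t + 1)) := by
      rw [Metric.tendstoUniformlyOn_iff]
      intro ε hε
      obtain ⟨η, hη, hmod⟩ := Metric.eventually_nhds_iff.1
        ((tendsto_modulus μ M).eventually_lt_const hε)
      filter_upwards [Metric.tendstoUniformlyOn_iff.1 (hu (t + 1) (by linarith)) η hη] with n hn s hs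
      have hs0 : 0 ≤ s := hs.1.le
      rw [dist_eq_norm, ← map_sub]
      refine (norm_proj_le _ _).trans_lt ((norm_rhs_sub_le h0 h1 (hθ3 s hs0) (hx3 n s hs0) (hθM s hs0)
        (hxM n s hs0)).trans_lt (hmod ?_))
      have := hn s ⟨hs0, hs.2.le⟩
      rw [dist_eq_norm] at this
      rw [dist_zero_right, norm_norm]
      exact this
    refine hasDerivAt_of_tendstoLocallyUniformlyOn (f := fun n t => proj R (x n t)) isOpen_Ioo
      hunif.tendstoLocallyUniformlyOn ?_ (fun s hs => ?_) ⟨ht, lt_add_one t⟩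
    · filter_upwards [eventually_ge_atTop R] with n hn s hs
      have hRn : (R : ℝ) ≤ n + 2 := by
        have : (R : ℝ) ≤ n := by exact_mod_cast hn
        linarith
      refine ((proj R).hasFDerivAt.comp_hasDerivAt s (hd n s hs.1)).congr_deriv ?_
      rw [rhs, map_sub, map_sub, map_neg, map_neg, proj_proj hRn]
    · exact ((proj R).continuous.tendsto _).comp
        ((hu (t + 1) (by linarith)).tendsto_at ⟨hs.1.le, hs.2.le⟩)
  have hmax : Continuous fun t : ℝ => max t 0 := continuous_id.max continuous_const
  have hH : Continuous fun t : ℝ => rhs μ α (θ (max t 0)) :=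
    (continuousOn_rhs h0 h1 hc (fun t ht => hθ3 t ht) fun t ht => hθM t ht).comp_continuous hmax
      fun t => mem_Ici.2 (le_max_right _ _)
  have hId : ∀ t, HasDerivAt (fun t => ∫ s in (0 : ℝ)..t, rhs μ α (θ (max s 0)))
      (rhs μ α (θ (max t 0))) t := fun t => (hH.integral_hasStrictDerivAt 0 t).hasDerivAt
  -- The projected equations combine into the integral equation: every projection of the defect has
  -- zero derivative. Continuity of the integrand then gives the derivative in L².
  have heq : ∀ t, 0 ≤ t → θ t - θ 0 - ∫ s in (0 : ℝ)..t, rhs μ α (θ (max s 0)) = 0 := by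
    intro t ht
    refine eq_zero_of_proj_eq_zero fun R => ?_
    refine eq_zero_of_inner_deriv_nonpos
      (w := fun t => proj R (θ t - θ 0 - ∫ s in (0 : ℝ)..t, rhs μ α (θ (max s 0))))
      (w' := fun _ => 0) ?_ (fun s hs => ?_) (by simp) (by simp) ht
    · exact (proj R).continuous.comp_continuousOn ((hc.sub continuousOn_const).sub
        (continuous_iff_continuousAt.2 fun t => (hId t).continuousAt).continuousOn)
    · have e1 := ((hproj R s hs).sub_const (proj R (θ 0))).sub
        ((proj R).hasFDerivAt.comp_hasDerivAt s (hId s))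
      rw [max_eq_left hs.le, sub_self] at e1
      refine e1.congr_of_eventuallyEq (Eventually.of_forall fun r => ?_)
      simp [map_sub]
  intro t ht
  have h2 := (hId t).const_add (θ 0)
  rw [max_eq_left ht.le] at h2
  refine h2.congr_of_eventuallyEq ?_
  filter_upwards [Ioi_mem_nhds ht] with s hs
  have := heq s (mem_Ioi.1 hs).le
  rw [sub_sub, sub_eq_zero] at this
  exact this

/-- Frequency-truncated solutions that are uniformly bounded in `H³` converge to a solution. -/
theorem exists_limit {μ α M : ℝ} (hμ : 0 < μ) (h0 : 0 ≤ α) (h1 : α ≤ 1 / 2) {θ₀ : L2} (hθ₀ : H3 θ₀)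
    {x : ℕ → ℝ → L2} (hx0 : ∀ n : ℕ, x n 0 = proj (n + 2) θ₀)
    (hxc : ∀ n, ContinuousOn (x n) (Ici 0))
    (hB : ∀ (n : ℕ) t, 0 ≤ t → BL (n + 2) (x n t))
    (hxM : ∀ n t, 0 ≤ t → ‖J3 (x n t)‖ ≤ M)
    (hd : ∀ (n : ℕ) t, 0 < t →
      HasDerivAt (x n) (-proj (n + 2) (adv (x n t) (x n t)) - μ • fracLap α (x n t)) t) :
    ∃ θ : ℝ → L2, θ 0 = θ₀ ∧ (∀ T, 0 ≤ T → TendstoUniformlyOn x θ atTop (Icc 0 T)) ∧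
      ContinuousOn θ (Ici 0) ∧ (∀ t, 0 ≤ t → H3 (θ t)) ∧ (∀ t, 0 ≤ t → ‖J3 (θ t)‖ ≤ M) ∧
      ∀ t, 0 < t → HasDerivAt θ (rhs μ α (θ t)) t := by
  have hw := wC_nonneg
  have hM : 0 ≤ M := (norm_nonneg _).trans (hxM 0 0 le_rfl)
  have hx3 : ∀ n t, 0 ≤ t → H3 (x n t) := fun n t ht => (hB n t ht).h3
  have hinv : Tendsto (fun n : ℕ => ((n : ℝ) + 2)⁻¹) atTop (𝓝 0) :=
    tendsto_inv_atTop_zero.comp (tendsto_atTop_add_const_right _ _ tendsto_natCast_atTop_atTop)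
  obtain ⟨θ, hθ⟩ := exists_uniform_limit (x := x) fun T hT => by
    -- The rate: the squared truncation error of the data plus the O(1/n) defect of the equations,
    -- amplified by Gronwall.
    refine ⟨fun n => Real.sqrt (((2 * (((n : ℝ) + 2)⁻¹ * ‖J3 θ₀‖)) ^ 2
      + T * (((n : ℝ) + 2)⁻¹ * (8 * wC * M ^ 3))) * Real.exp (T * (2 * wC * M))), ?_, ?_⟩
    · have := ((((hinv.mul_const ‖J3 θ₀‖).const_mul 2).pow 2).add
        ((hinv.mul_const (8 * wC * M ^ 3)).const_mul T)).mul_const (Real.exp (T * (2 * wC * M)))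
      simpa using this.sqrt
    · intro n m hnm t ht
      have hn : (0 : ℝ) < n + 2 := by positivity
      have hnm' : (n : ℝ) + 2 ≤ m + 2 := by
        have : (n : ℝ) ≤ m := by exact_mod_cast hnm
        linarith
      have hm : (0 : ℝ) < m + 2 := hn.trans_le hnm'
      refine Real.le_sqrt_of_sq_le ((norm_galerkin_sub_sq_le hμ h0 h1 hn hnm' ht.1 (hxc m) (hx3 m)
        (hxM m) (hd m) (hxc n) (hx3 n) (hxM n) (hd n)).trans ?_)
      have h4 : ‖x m 0 - x n 0‖ ≤ 2 * (((n : ℝ) + 2)⁻¹ * ‖J3 θ₀‖) := by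
        rw [hx0, hx0]
        have e : proj ((m : ℝ) + 2) θ₀ - proj ((n : ℝ) + 2) θ₀
            = (θ₀ - proj ((n : ℝ) + 2) θ₀) - (θ₀ - proj ((m : ℝ) + 2) θ₀) := by abel
        rw [e]
        have i1 := norm_sub_proj_le hn hθ₀
        have i2 := norm_sub_proj_le hm hθ₀
        have i3 : ((m : ℝ) + 2)⁻¹ * ‖J3 θ₀‖ ≤ ((n : ℝ) + 2)⁻¹ * ‖J3 θ₀‖ := by gcongr
        exact (norm_sub_le _ _).trans (by linarith)
      have ht2 := ht.2
      gcongr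
  have hpt : ∀ t, 0 ≤ t → Tendsto (fun n => x n t) atTop (𝓝 (θ t)) := fun t ht =>
    (hθ t ht).tendsto_at ⟨ht, le_rfl⟩
  have hb : ∀ t, 0 ≤ t → H3 (θ t) ∧ ‖J3 (θ t)‖ ≤ M := fun t ht =>
    h3_of_tendsto (hpt t ht) (Eventually.of_forall fun n => hx3 n t ht)
      (Eventually.of_forall fun n => hxM n t ht)
  have hc := continuousOn_Ici_of_tendstoUniformlyOn hθ hxc
  refine ⟨θ, ?_, hθ, hc, fun t ht => (hb t ht).1, fun t ht => (hb t ht).2,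
    hasDerivAt_of_limit h0 h1 hθ hc hx3 hxM (fun t ht => (hb t ht).1) (fun t ht => (hb t ht).2) hd⟩
  have h5 : Tendsto (fun n => x n 0) atTop (𝓝 θ₀) := by
    rw [tendsto_iff_norm_sub_tendsto_zero]
    have h6 : Tendsto (fun n : ℕ => ((n : ℝ) + 2)⁻¹ * ‖J3 θ₀‖) atTop (𝓝 0) := by
      simpa using hinv.mul_const ‖J3 θ₀‖
    refine squeeze_zero (fun n => norm_nonneg _) (fun n => ?_) h6
    rw [hx0, norm_sub_rev]
    exact norm_sub_proj_le (by positivity) hθ₀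
  exact tendsto_nhds_unique (hpt 0 le_rfl) h5

/-- Lower semicontinuity of the dissipation under locally uniform convergence. -/
theorem lintegral_dissip_le {α T c : ℝ} (h0 : 0 ≤ α) (hT : 0 ≤ T) {g : ℕ → ℝ → L2} {G : ℝ → L2}
    (hG : ContinuousOn G (Ici 0)) (hg : ∀ n, ContinuousOn (g n) (Ici 0))
    (hB : ∀ (n : ℕ) t, 0 ≤ t → BL (n + 2) (g n t))
    (hlim : ∀ t, 0 ≤ t → Tendsto (fun n => g n t) atTop (𝓝 (G t)))
    (hle : ∀ n, ∫ t in (0 : ℝ)..T, ‖fourierMul (fun ξ => (dw α ξ : ℂ)) (g n t)‖ ^ 2 ≤ c) :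
    ∫⁻ t in Ioc 0 T, dissip α (G t) ≤ ENNReal.ofReal c := by
  have hmeas : ∀ (R : ℝ) {u : ℝ → L2}, ContinuousOn u (Ici 0) →
      AEMeasurable (fun t => ‖dwR α h0 R (u t)‖ₑ ^ 2) (volume.restrict (Ioc 0 T)) := by
    intro R u hu
    have h1 : ContinuousOn (fun t => ‖dwR α h0 R (u t)‖ₑ ^ 2) (Ioc 0 T) :=
      ((ENNReal.continuous_pow 2).comp continuous_enorm).comp_continuousOn
        ((dwR α h0 R).continuous.comp_continuousOn
          (hu.mono (Ioc_subset_Icc_self.trans Icc_subset_Ici_self)))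
    exact h1.aemeasurable measurableSet_Ioc
  simp only [dissip_eq_iSup h0]
  rw [lintegral_iSup' (fun R => hmeas R hG)
    (Eventually.of_forall fun t => monotone_enorm_dwR h0 (G t))]
  refine iSup_le fun R => ?_
  -- Fatou at a fixed frequency cutoff R. For n ≥ R the cutoff is then raised to n + 2, which
  -- captures the full dissipation of g n.
  have hfat := lintegral_liminf_le' (μ := volume.restrict (Ioc 0 T)) (u := atTop)
    (f := fun (n : ℕ) t => ‖dwR α h0 R (g n t)‖ₑ ^ 2) fun n => hmeas R (hg n)
  refine le_trans (le_of_eq ?_) (hfat.trans ?_)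
  · refine setLIntegral_congr_fun measurableSet_Ioc fun t ht => ?_
    have : Tendsto (fun n => ‖dwR α h0 R (g n t)‖ₑ ^ 2) atTop (𝓝 (‖dwR α h0 R (G t)‖ₑ ^ 2)) :=
      (((ENNReal.continuous_pow 2).comp continuous_enorm).tendsto _).comp
        (((dwR α h0 R).continuous.tendsto _).comp (hlim t ht.1.le))
    exact this.liminf_eq.symm
  · refine liminf_le_of_le (by isBoundedDefault) fun b hb => ?_
    obtain ⟨n, hn1, hn2⟩ := (hb.and (eventually_ge_atTop R)).exists
    refine hn1.trans ?_
    have hcont : ContinuousOn (fun t => ‖dwR α h0 (n + 2) (g n t)‖ ^ 2) (Icc 0 T) :=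
      (((dwR α h0 (n + 2)).continuous.comp_continuousOn ((hg n).mono Icc_subset_Ici_self)).norm.pow 2)
    calc ∫⁻ t in Ioc 0 T, ‖dwR α h0 R (g n t)‖ₑ ^ 2
        ≤ ∫⁻ t in Ioc 0 T, ENNReal.ofReal (‖dwR α h0 (n + 2) (g n t)‖ ^ 2) := by
          refine lintegral_mono fun t => ?_
          rw [ENNReal.ofReal_pow (norm_nonneg _), ofReal_norm]
          have := monotone_enorm_dwR h0 (g n t) (show R ≤ n + 2 by omega)
          push_cast at this
          exact this
      _ = ENNReal.ofReal (∫ t in (0 : ℝ)..T, ‖dwR α h0 (n + 2) (g n t)‖ ^ 2) := by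
          rw [intervalIntegral.integral_of_le hT, ofReal_integral_eq_lintegral_ofReal]
          · exact hcont.integrableOn_Icc.mono_set Ioc_subset_Icc_self
          · exact Eventually.of_forall fun t => sq_nonneg _
      _ ≤ ENNReal.ofReal c := by
          refine ENNReal.ofReal_le_ofReal (le_trans (le_of_eq ?_) (hle n))
          refine intervalIntegral.integral_congr fun t ht => ?_
          rw [uIcc_of_le hT] at ht
          simp only [(hB n t ht.1).fourierMul_dw h0]

/-! ### Strong continuity in H³ -/

theorem norm_sub_proj_sq (R : ℝ) (x : L2) : ‖x - proj R x‖ ^ 2 = ‖x‖ ^ 2 - ‖proj R x‖ ^ 2 := by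
  have h : inner ℝ x (proj R x) = ‖proj R x‖ ^ 2 := by
    rw [← real_inner_self_eq_norm_sq, inner_proj_left, proj_proj le_rfl]
  rw [norm_sub_sq_real, h]; ring

theorem proj_J3 (R : ℝ) {f : L2} (hf : H3 f) : proj R (J3 f) = J3R R f := by
  refine ext_fh ?_
  filter_upwards [fh_proj R (J3 f), fh_J3 hf, fh_J3R R f] with ξ h1 h2 h3
  rw [h1, h2, h3]; push_cast; ring

/-- Convergence in `L²` together with convergence of the `H³` norms implies convergence in `H³`. -/
theorem tendsto_J3_of_tendsto_norm {ι : Type*} {l : Filter ι} {u : ι → L2} {f : L2}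
    (hu : Tendsto u l (𝓝 f)) (h3 : ∀ᶠ n in l, H3 (u n)) (hf : H3 f)
    (hn : Tendsto (fun n => ‖J3 (u n)‖ ^ 2) l (𝓝 (‖J3 f‖ ^ 2))) :
    Tendsto (fun n => J3 (u n)) l (𝓝 (J3 f)) := by
  rw [Metric.tendsto_nhds]
  intro ε hε
  -- R is chosen so that the limit has a small tail. Low frequencies converge by L² convergence, and
  -- convergence of the norms forces the tails of u n to be small as well.
  have h1 : Tendsto (fun R : ℕ => 2 * ‖J3 f - proj R (J3 f)‖) atTop (𝓝 0) := by
    have := (tendsto_iff_norm_sub_tendsto_zero.1 (tendsto_proj (J3 f))).const_mul 2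
    simpa only [mul_zero, norm_sub_rev] using this
  obtain ⟨R, hR⟩ := (h1.eventually_lt_const hε).exists
  have hJ : Tendsto (fun n => J3R R (u n)) l (𝓝 (J3R R f)) := ((J3R R).continuous.tendsto f).comp hu
  have h2 : Tendsto (fun n => Real.sqrt (‖J3 (u n)‖ ^ 2 - ‖J3R R (u n)‖ ^ 2)
      + ‖J3R R (u n) - J3R R f‖ + ‖J3 f - proj R (J3 f)‖) l (𝓝 (2 * ‖J3 f - proj R (J3 f)‖)) := by
    have h4 := (((hn.sub (hJ.norm.pow 2)).sqrt).add
      (tendsto_iff_norm_sub_tendsto_zero.1 hJ)).add_const ‖J3 f - proj R (J3 f)‖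
    rw [← proj_J3 R hf, ← norm_sub_proj_sq, Real.sqrt_sq (norm_nonneg _), add_zero, ← two_mul] at h4
    rwa [← proj_J3 R hf]
  filter_upwards [h2.eventually_lt_const hR, h3] with n hn1 hn3
  rw [← proj_J3 R hn3, ← norm_sub_proj_sq, Real.sqrt_sq (norm_nonneg _), ← proj_J3 R hf] at hn1
  refine lt_of_le_of_lt ?_ hn1
  rw [dist_eq_norm]
  have e : J3 (u n) - J3 f = (J3 (u n) - proj R (J3 (u n))) + (proj R (J3 (u n)) - proj R (J3 f))
      - (J3 f - proj R (J3 f)) := by abel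
  rw [e]
  exact (norm_sub_le _ _).trans (add_le_add_left (norm_add_le _ _) _)

/-- The weight `min(⟨ξ⟩, N)⁶`, as an operator. -/
def wop (N : ℕ) : L2 →L[ℝ] L2 :=
  bmul _ ((rSym_jpN N).pow 6) (bdd_jpN_pow N.cast_nonneg 6)

theorem fh_wop (N : ℕ) (f : L2) :
    fh (wop N f) =ᵐ[volume] fun ξ => ((jpN N ξ ^ 6 : ℝ) : ℂ) * fh f ξ := fh_bmul _ _ _ f

theorem inner_wop_left (N : ℕ) (f g : L2) : inner ℝ (wop N f) g = inner ℝ f (wop N g) :=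
  inner_bmul_left _ _ f g

theorem jpN_nonneg (N : ℕ) (ξ : Plane) : 0 ≤ jpN N ξ := le_min (jp_pos ξ).le N.cast_nonneg

theorem jpN_le (N : ℕ) (ξ : Plane) : jpN N ξ ≤ jp ξ := min_le_left _ _

theorem re_conj_mul_ofReal_mul (z : ℂ) (a : ℝ) : (conj z * ((a : ℂ) * z)).re = a * ‖z‖ ^ 2 := by
  rw [show conj z * ((a : ℂ) * z) = (a : ℂ) * (conj z * z) by ring,
    Complex.re_ofReal_mul, Complex.conj_mul']
  norm_cast

/-- The truncated quadratic form is differentiable along any L²-differentiable curve, which is not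
known for the H³ norm itself; dominated convergence recovers the latter. -/
theorem tendsto_inner_wop {f : L2} (hf : H3 f) :
    Tendsto (fun N : ℕ => inner ℝ f (wop N f)) atTop (𝓝 (‖J3 f‖ ^ 2)) := by
  rw [norm_sq_eq_integral_fh]
  simp only [inner_eq_integral]
  refine tendsto_integral_of_dominated_convergence (fun ξ => ‖fh (J3 f) ξ‖ ^ 2)
    (fun N => (integrable_inner_fh _ _).aestronglyMeasurable) (integrable_fh_sq _) (fun N => ?_) ?_
  · filter_upwards [fh_wop N f, fh_J3 hf] with ξ h1 h2
    rw [h1, h2, re_conj_mul_ofReal_mul,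
      Real.norm_of_nonneg (mul_nonneg (pow_nonneg (jpN_nonneg N ξ) 6) (sq_nonneg _)),
      norm_mul, Complex.norm_real, mul_pow, Real.norm_of_nonneg (pow_nonneg (jp_pos ξ).le 3), ← pow_mul]
    refine mul_le_mul_of_nonneg_right ?_ (sq_nonneg _)
    exact pow_le_pow_left₀ (jpN_nonneg N ξ) (jpN_le N ξ) 6
  · filter_upwards [ae_all_iff.2 fun N : ℕ => fh_wop N f, fh_J3 hf] with ξ h1 h2
    obtain ⟨N₀, hN₀⟩ := exists_nat_ge (jp ξ)
    refine tendsto_const_nhds.congr' ?_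
    filter_upwards [eventually_ge_atTop N₀] with N hN
    have h5 : jpN N ξ = jp ξ := min_eq_left (hN₀.trans (by exact_mod_cast hN))
    rw [h1 N, h2, re_conj_mul_ofReal_mul, h5, norm_mul, Complex.norm_real, mul_pow,
      Real.norm_of_nonneg (pow_nonneg (jp_pos ξ).le 3), ← pow_mul]

theorem ofReal_inner_fracLap_wop_le {α : ℝ} (h0 : 0 ≤ α) (h1 : α ≤ 1 / 2) {f : L2} (hf : H3 f)
    (N : ℕ) : ENNReal.ofReal |inner ℝ (fracLap α f) (wop N f)| ≤ dissip α f := by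
  rw [← enorm_ofReal_abs, inner_eq_integral]
  refine (enorm_integral_le_lintegral_enorm _).trans (lintegral_mono_ae ?_)
  filter_upwards [fh_wop N f, (hSym_lapSymbol α).fh_fourierMul
    (hf.inDomain_fracLap h0 (by linarith))] with ξ e1 e2
  have e3 : fh (fracLap α f) ξ = ((lam α ξ : ℝ) : ℂ) * fh f ξ := e2
  have e : lam α ξ = ((2 * Real.pi * ‖ξ‖) ^ α) ^ 2 := by
    rw [lam, mul_comm 2 α, Real.rpow_mul (by positivity), Real.rpow_two]
  have e4 : (conj (((lam α ξ : ℝ) : ℂ) * fh f ξ) * (((jpN N ξ ^ 6 : ℝ) : ℂ) * fh f ξ)).re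
      = (lam α ξ * jpN N ξ ^ 6) * ‖fh f ξ‖ ^ 2 := by
    rw [← re_conj_mul_ofReal_mul, map_mul, Complex.conj_ofReal]
    congr 1
    push_cast
    ring
  rw [e1, e3, e4, enorm_ofReal_abs, abs_of_nonneg (mul_nonneg (mul_nonneg (lam_nonneg α ξ)
    (pow_nonneg (jpN_nonneg N ξ) 6)) (sq_nonneg _)), ← ofReal_norm, ← ENNReal.ofReal_pow (norm_nonneg _),
    norm_mul, Complex.norm_real, Real.norm_of_nonneg (dw_nonneg α ξ), mul_pow, dw, mul_pow, ← e,
    ← pow_mul]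
  refine ENNReal.ofReal_le_ofReal (mul_le_mul_of_nonneg_right ?_ (sq_nonneg _))
  exact mul_le_mul_of_nonneg_left (pow_le_pow_left₀ (jpN_nonneg N ξ) (jpN_le N ξ) 6) (lam_nonneg α ξ)

/-- Uniform in N, so the truncation can be removed. No smallness enters: the cubic term is simply
bounded. -/
theorem enorm_inner_rhs_wop_le {μ α M : ℝ} (hμ : 0 < μ) (h0 : 0 ≤ α) (h1 : α ≤ 1 / 2) {f : L2}
    (hf : H3 f) (hM : ‖J3 f‖ ≤ M) (N : ℕ) :
    ‖2 * inner ℝ (rhs μ α f) (wop N f)‖ₑ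
      ≤ ENNReal.ofReal (126 * wC * M ^ 3) + ENNReal.ofReal (2 * μ) * dissip α f := by
  have hw := wC_nonneg
  have hM0 : 0 ≤ M := (norm_nonneg _).trans hM
  have b1 := abs_inner_adv_self_le_J3 hf (N := N) N.cast_nonneg
  have b1' : |2 * inner ℝ (adv f f) (wop N f)| ≤ 126 * wC * M ^ 3 := b1.trans (by gcongr)
  rw [rhs, inner_sub_left, inner_neg_left, real_inner_smul_left, enorm_ofReal_abs]
  have h2 : |2 * (-inner ℝ (adv f f) (wop N f) - μ * inner ℝ (fracLap α f) (wop N f))|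
      ≤ 126 * wC * M ^ 3 + 2 * μ * |inner ℝ (fracLap α f) (wop N f)| := by
    rw [show 2 * (-inner ℝ (adv f f) (wop N f) - μ * inner ℝ (fracLap α f) (wop N f))
      = -(2 * inner ℝ (adv f f) (wop N f)) - 2 * μ * inner ℝ (fracLap α f) (wop N f) by ring]
    refine (abs_sub _ _).trans ?_
    rw [abs_neg, abs_mul (2 * μ), abs_of_pos (by positivity : 0 < 2 * μ)]
    linarith
  refine (ENNReal.ofReal_le_ofReal h2).trans ?_
  rw [ENNReal.ofReal_add (by positivity) (by positivity),
    ENNReal.ofReal_mul (p := 2 * μ) (by positivity)]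
  gcongr
  exact ofReal_inner_fracLap_wop_le h0 h1 hf N

theorem enorm_sub_le_of_deriv {e e' : ℝ → ℝ} {φ : ℝ → ℝ≥0∞} {s t : ℝ} (hst : s ≤ t)
    (hc : ContinuousOn e (Icc s t)) (hd : ∀ τ ∈ Ioo s t, HasDerivAt e (e' τ) τ)
    (hc' : ContinuousOn e' (Icc s t)) (hle : ∀ τ ∈ Ioc s t, ‖e' τ‖ₑ ≤ φ τ) :
    ‖e t - e s‖ₑ ≤ ∫⁻ τ in Ioc s t, φ τ := by
  rw [← intervalIntegral.integral_eq_sub_of_hasDerivAt_of_le hst hc hd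
    (hc'.intervalIntegrable_of_Icc hst), intervalIntegral.integral_of_le hst]
  refine (enorm_integral_le_lintegral_enorm _).trans ?_
  exact setLIntegral_mono' measurableSet_Ioc hle

/-- The `H³` norm of a solution varies by at most the dissipation and a Lipschitz term. -/
theorem enorm_J3_sq_sub_le {μ α M : ℝ} (hμ : 0 < μ) (h0 : 0 ≤ α) (h1 : α ≤ 1 / 2) {θ : ℝ → L2}
    (hc : ContinuousOn θ (Ici 0)) (h3 : ∀ t, 0 ≤ t → H3 (θ t)) (hM : ∀ t, 0 ≤ t → ‖J3 (θ t)‖ ≤ M)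
    (hd : ∀ t, 0 < t → HasDerivAt θ (rhs μ α (θ t)) t) {s t : ℝ} (hs : 0 ≤ s) (hst : s ≤ t) :
    ‖‖J3 (θ t)‖ ^ 2 - ‖J3 (θ s)‖ ^ 2‖ₑ ≤ ∫⁻ τ in Ioc s t,
      (ENNReal.ofReal (126 * wC * M ^ 3) + ENNReal.ofReal (2 * μ) * dissip α (θ τ)) := by
  have hsub : Icc s t ⊆ Ici 0 := fun τ hτ => hs.trans hτ.1
  have hN : ∀ N : ℕ, ‖inner ℝ (θ t) (wop N (θ t)) - inner ℝ (θ s) (wop N (θ s))‖ₑ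
      ≤ ∫⁻ τ in Ioc s t,
        (ENNReal.ofReal (126 * wC * M ^ 3) + ENNReal.ofReal (2 * μ) * dissip α (θ τ)) := by
    intro N
    have hcθ := hc.mono hsub
    have hcW : ContinuousOn (fun τ => wop N (θ τ)) (Icc s t) :=
      (wop N).continuous.comp_continuousOn hcθ
    refine enorm_sub_le_of_deriv (e := fun τ => inner ℝ (θ τ) (wop N (θ τ)))
      (e' := fun τ => 2 * inner ℝ (rhs μ α (θ τ)) (wop N (θ τ))) hst (hcθ.inner hcW) (fun τ hτ => ?_)
      ?_ fun τ hτ => ?_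
    · have h4 := hd τ (hs.trans_lt hτ.1)
      refine (h4.inner ℝ ((wop N).hasFDerivAt.comp_hasDerivAt τ h4)).congr_deriv ?_
      rw [← inner_wop_left, real_inner_comm]
      simp only [Function.comp_apply]
      ring
    · exact continuousOn_const.mul (((continuousOn_rhs h0 h1 hc (fun t ht => h3 t ht)
        fun t ht => hM t ht).mono hsub).inner hcW)
    · have hτ0 : 0 ≤ τ := hs.trans hτ.1.le
      exact enorm_inner_rhs_wop_le hμ h0 h1 (h3 τ hτ0) (hM τ hτ0) N
  have hlim := (tendsto_inner_wop (h3 t (hs.trans hst))).sub (tendsto_inner_wop (h3 s hs))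
  exact le_of_tendsto ((continuous_enorm.tendsto _).comp hlim) (Eventually.of_forall hN)

/-- Bounded solutions with locally integrable dissipation are continuous in `H³`. -/
theorem continuousOn_J3_of_solution {μ α M : ℝ} (hμ : 0 < μ) (h0 : 0 ≤ α) (h1 : α ≤ 1 / 2)
    {θ : ℝ → L2} (hc : ContinuousOn θ (Ici 0)) (h3 : ∀ t, 0 ≤ t → H3 (θ t))
    (hM : ∀ t, 0 ≤ t → ‖J3 (θ t)‖ ≤ M) (hd : ∀ t, 0 < t → HasDerivAt θ (rhs μ α (θ t)) t)
    (hdis : ∀ T, 0 ≤ T → ∫⁻ t in Ioc 0 T, dissip α (θ t) < ⊤) :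
    ContinuousOn (fun t => J3 (θ t)) (Ici 0) := by
  intro t ht
  have ht0 : (0 : ℝ) ≤ t := ht
  refine tendsto_J3_of_tendsto_norm (hc t ht) ?_ (h3 t ht0) ?_
  · filter_upwards [self_mem_nhdsWithin] with s hs using h3 s hs
  set φ : ℝ → ℝ≥0∞ := fun τ =>
    ENNReal.ofReal (126 * wC * M ^ 3) + ENNReal.ofReal (2 * μ) * dissip α (θ τ) with hφ
  have hfin : ∫⁻ τ in Ioc 0 (t + 1), φ τ ≠ ⊤ := by
    rw [hφ, lintegral_add_left measurable_const, lintegral_const_mul' _ _ ENNReal.ofReal_ne_top]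
    refine ENNReal.add_ne_top.2 ⟨?_, ENNReal.mul_ne_top ENNReal.ofReal_ne_top
      (hdis (t + 1) (by linarith)).ne⟩
    rw [lintegral_const, Measure.restrict_apply_univ, Real.volume_Ioc]
    exact ENNReal.mul_ne_top ENNReal.ofReal_ne_top ENNReal.ofReal_ne_top
  rw [tendsto_iff_edist_tendsto_0]
  -- Absolute continuity of the integral of φ: the interval between s and t has measure |s − t|.
  have hvol : Tendsto ((volume.restrict (Ioc 0 (t + 1))) ∘ fun s => Ioc (min s t) (max s t))
      (𝓝[Ici 0] t) (𝓝 0) := by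
    have h5 : Tendsto (fun s => ENNReal.ofReal |s - t|) (𝓝[Ici 0] t) (𝓝 0) := by
      have : Continuous fun s : ℝ => ENNReal.ofReal |s - t| :=
        ENNReal.continuous_ofReal.comp (by fun_prop)
      simpa using (this.tendsto t).mono_left nhdsWithin_le_nhds
    refine tendsto_of_tendsto_of_tendsto_of_le_of_le tendsto_const_nhds h5 (fun _ => zero_le) fun s => ?_
    refine (Measure.restrict_apply_le _ _).trans ?_
    rw [Real.volume_Ioc, max_sub_min_eq_abs']
  refine tendsto_of_tendsto_of_tendsto_of_le_of_le' tendsto_const_nhds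
    (tendsto_setLIntegral_zero hfin hvol) (Eventually.of_forall fun _ => zero_le) ?_
  filter_upwards [inter_mem_nhdsWithin (Ici (0 : ℝ)) (Iio_mem_nhds (lt_add_one t))] with s hs
  have hs0 : (0 : ℝ) ≤ s := hs.1
  have hs1 : s < t + 1 := hs.2
  have hres : ∫⁻ τ in Ioc (min s t) (max s t), φ τ ∂(volume.restrict (Ioc 0 (t + 1)))
      = ∫⁻ τ in Ioc (min s t) (max s t), φ τ := by
    rw [Measure.restrict_restrict measurableSet_Ioc, inter_eq_left.2]
    exact Ioc_subset_Ioc (le_min hs0 ht0) (max_le hs1.le (by linarith))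
  rw [hres]
  rcases le_total s t with h | h
  · rw [min_eq_left h, max_eq_right h, edist_comm, edist_eq_enorm_sub]
    exact enorm_J3_sq_sub_le hμ h0 h1 hc h3 hM hd hs0 h
  · rw [min_eq_right h, max_eq_left h, edist_eq_enorm_sub]
    exact enorm_J3_sq_sub_le hμ h0 h1 hc h3 hM hd ht0 h

/-! ### Global solutions: construction and uniqueness -/

theorem norm_J3_proj_le_J3 (R : ℝ) {f : L2} (hf : H3 f) : ‖J3 (proj R f)‖ ≤ ‖J3 f‖ := by
  refine norm_le_norm_of_fh_le ?_
  filter_upwards [fh_J3 (BL.proj R f).h3, fh_J3 hf, fh_proj R f] with ξ h1 h2 h3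
  rw [h1, h2, h3, norm_mul, norm_mul, norm_mul]
  gcongr
  rw [Complex.norm_real, Real.norm_of_nonneg (ind_nonneg R ξ)]
  exact mul_le_of_le_one_left (norm_nonneg _) (ind_le_one R ξ)

theorem dissip_add_le {α : ℝ} (f g : L2) : dissip α (f + g) ≤ 2 * dissip α f + 2 * dissip α g := by
  have hm : ∀ u : L2, Measurable fun ξ => ‖(dw α ξ : ℂ) * fh u ξ‖ₑ ^ 2 := fun u =>
    (((Complex.measurable_ofReal.comp (rSym_dw α).meas).mul (measurable_fh u)).enorm).pow_const 2
  unfold dissip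
  rw [← lintegral_const_mul _ (hm f), ← lintegral_const_mul _ (hm g),
    ← lintegral_add_left ((hm f).const_mul 2)]
  refine lintegral_mono_ae ?_
  filter_upwards [fh_add f g] with ξ e
  rw [e, mul_add]
  set a := (dw α ξ : ℂ) * fh f ξ
  set b := (dw α ξ : ℂ) * fh g ξ
  have h : ‖a + b‖ ^ 2 ≤ 2 * ‖a‖ ^ 2 + 2 * ‖b‖ ^ 2 := by
    have h1 : ‖a + b‖ ^ 2 ≤ (‖a‖ + ‖b‖) ^ 2 := by gcongr; exact norm_add_le a b
    nlinarith [sq_nonneg (‖a‖ - ‖b‖)]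
  have h2 := ENNReal.ofReal_le_ofReal h
  rwa [ENNReal.ofReal_add (by positivity) (by positivity), ENNReal.ofReal_mul (by norm_num),
    ENNReal.ofReal_mul (by norm_num), ENNReal.ofReal_pow (norm_nonneg _),
    ENNReal.ofReal_pow (norm_nonneg _), ENNReal.ofReal_pow (norm_nonneg _), ofReal_norm, ofReal_norm,
    ofReal_norm, ENNReal.ofReal_ofNat] at h2

theorem BL.dissip_eq {α : ℝ} (h0 : 0 ≤ α) {R : ℝ} {f : L2} (hf : BL R f) :
    dissip α f = ‖dwR α h0 R f‖ₑ ^ 2 := by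
  rw [dissip, enorm_sq_eq]
  refine lintegral_congr_ae ?_
  filter_upwards [hf, fh_dwR α h0 R f] with ξ h1 h2
  rw [h2]
  rcases le_or_gt ‖ξ‖ R with h | h
  · rw [ind_of_le h, mul_one]
  · rw [h1 h, mul_zero, mul_zero]

theorem lintegral_dissip_lt_top {α R T : ℝ} (h0 : 0 ≤ α) {Θ : ℝ → L2} (hc : ContinuousOn Θ (Ici 0))
    (hB : ∀ t, 0 ≤ t → BL R (Θ t)) : ∫⁻ t in Ioc 0 T, dissip α (Θ t) < ⊤ := by
  have h1 : ContinuousOn (fun t => ‖dwR α h0 R (Θ t)‖ ^ 2) (Icc 0 T) :=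
    ((dwR α h0 R).continuous.comp_continuousOn (hc.mono Icc_subset_Ici_self)).norm.pow 2
  have h2 : IntegrableOn (fun t => ‖dwR α h0 R (Θ t)‖ ^ 2) (Ioc 0 T) :=
    h1.integrableOn_Icc.mono_set Ioc_subset_Icc_self
  refine lt_of_le_of_lt (le_of_eq ?_) h2.2
  refine setLIntegral_congr_fun measurableSet_Ioc fun t ht => ?_
  simp only [(hB t ht.1.le).dissip_eq h0, enorm_pow, enorm_norm]

theorem IsGlobalSolution.h3 {μ α : ℝ} {θ₀ : L2} {θ : ℝ → L2} (h : IsGlobalSolution μ α θ₀ θ) {t : ℝ}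
    (ht : 0 ≤ t) : H3 (θ t) := (hNorm_lt_top_iff _).1 (h.regular t ht)

theorem IsGlobalSolution.continuousOn {μ α : ℝ} {θ₀ : L2} {θ : ℝ → L2}
    (h : IsGlobalSolution μ α θ₀ θ) : ContinuousOn θ (Ici 0) := by
  intro t ht
  rw [ContinuousWithinAt, tendsto_iff_edist_tendsto_0]
  refine tendsto_of_tendsto_of_tendsto_of_le_of_le' tendsto_const_nhds (h.continuous t ht)
    (Eventually.of_forall fun _ => zero_le) ?_
  filter_upwards [self_mem_nhdsWithin] with s hs
  have h3 := (h.h3 hs).sub (h.h3 ht)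
  rw [edist_eq_enorm_sub, hNorm_eq_enorm_J3 h3, ← ofReal_norm, ← ofReal_norm]
  exact ENNReal.ofReal_le_ofReal (norm_le_J3 h3)

theorem rhs_ae {μ α : ℝ} {f : L2} (hf : H3 f) :
    ∀ᵐ x : Plane, rhs μ α f x + advection f x + μ * fracLap α f x = 0 := by
  filter_upwards [Lp.coeFn_sub (-adv f f) (μ • fracLap α f), Lp.coeFn_neg (adv f f),
    Lp.coeFn_smul μ (fracLap α f), advection_ae hf] with x e1 e2 e3 e4
  rw [rhs, e1, e4, Pi.sub_apply, e2, e3, Pi.neg_apply, Pi.smul_apply, smul_eq_mul]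
  ring

theorem IsGlobalSolution.hasDerivAt {μ α : ℝ} {θ₀ : L2} {θ : ℝ → L2}
    (h : IsGlobalSolution μ α θ₀ θ) {t : ℝ} (ht : 0 < t) : HasDerivAt θ (rhs μ α (θ t)) t := by
  obtain ⟨dθ, hd, he⟩ := h.equation t ht
  have : dθ = rhs μ α (θ t) := by
    refine Lp.ext ?_
    filter_upwards [he, rhs_ae (μ := μ) (α := α) (h.h3 ht.le)] with x e1 e2
    linarith
  rwa [this] at hd

theorem IsGlobalSolution.of_bounded {μ α M : ℝ} (hμ : 0 < μ) (h0 : 0 ≤ α) (h1 : α ≤ 1 / 2)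
    {θ₀ : L2} {θ : ℝ → L2} (hi : θ 0 = θ₀)
    (hc : ContinuousOn θ (Ici 0)) (h3 : ∀ t, 0 ≤ t → H3 (θ t)) (hM : ∀ t, 0 ≤ t → ‖J3 (θ t)‖ ≤ M)
    (hd : ∀ t, 0 < t → HasDerivAt θ (rhs μ α (θ t)) t)
    (hdis : ∀ T, 0 ≤ T → ∫⁻ t in Ioc 0 T, dissip α (θ t) < ⊤) : IsGlobalSolution μ α θ₀ θ where
  initial := hi
  regular t ht := (hNorm_lt_top_iff _).2 (h3 t ht)
  continuous t ht := by
    have hJ := continuousOn_J3_of_solution hμ h0 h1 hc h3 hM hd hdis t ht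
    refine (tendsto_iff_edist_tendsto_0.1 hJ).congr' ?_
    filter_upwards [self_mem_nhdsWithin] with s hs
    rw [edist_eq_enorm_sub, ← J3_sub (h3 s hs) (h3 t ht), hNorm_eq_enorm_J3 ((h3 s hs).sub (h3 t ht))]
  equation t ht := ⟨_, hd t ht, rhs_ae (h3 t ht.le)⟩

theorem IsGlobalSolution.unique {μ α M : ℝ} (hμ : 0 < μ) (h0 : 0 ≤ α) (h1 : α ≤ 1 / 2) {θ₀ : L2}
    {θ θ' : ℝ → L2} (h : IsGlobalSolution μ α θ₀ θ) (hM : ∀ t, 0 ≤ t → ‖J3 (θ t)‖ ≤ M)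
    (h' : IsGlobalSolution μ α θ₀ θ') {t : ℝ} (ht : 0 ≤ t) : θ' t = θ t :=
  (eq_of_bounded_solutions hμ h0 h1 ht h.continuousOn (fun _ => h.h3) (fun s hs => hM s hs.1)
    (fun _ => h.hasDerivAt) h'.continuousOn (fun _ => h'.h3) (fun _ => h'.hasDerivAt)
    (h.initial.trans h'.initial.symm)).symm

/-- Global solutions near the linear evolution of data with frequencies of size at most `1`. -/
theorem exists_solution_near_linear {μ α ε : ℝ} (hμ : 0 < μ) (h0 : 0 ≤ α) (h1 : α ≤ 1 / 2)
    (hε : 0 < ε) (hsm : 126 * wC * Real.sqrt (2 * ε) ≤ μ) {Θ₀ g₀ : L2} {Θ : ℝ → L2}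
    (hΘ : IsLinearSolution μ α Θ₀ Θ) (hΘ₀ : BL 1 Θ₀) (hsmall : SmallnessCondition engC ε g₀ Θ) :
    ∃ (θ : ℝ → L2) (M : ℝ), IsGlobalSolution μ α (Θ₀ + g₀) θ ∧ (∀ t, 0 ≤ t → ‖J3 (θ t)‖ ≤ M) ∧
      ∀ t, 0 ≤ t → hNorm 3 (θ t - Θ t : L2) ^ 2 ≤ ENNReal.ofReal ε ∧
        ∫⁻ τ in Ioc 0 t, dissip α (θ τ - Θ τ) ≤ ENNReal.ofReal (ε / μ) := by
  have hheat : ∀ t, 0 ≤ t → Θ t = heat μ α t Θ₀ := fun t ht => hΘ.eq_heat hμ h0 ht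
  have hB1 : ∀ t, 0 ≤ t → BL 1 (Θ t) := fun t ht => by rw [hheat t ht]; exact hΘ₀.heat hμ ht
  have hJΘ : ∀ t, 0 ≤ t → ‖J3 (Θ t)‖ ≤ ‖J3 Θ₀‖ := fun t ht => by
    rw [hheat t ht]; exact norm_J3_heat_le hμ ht hΘ₀
  obtain ⟨hg₀, hreal⟩ := hsmall.real (zero_le_one.trans one_lt_engC.le) hε hΘ.continuousOn hB1
  have hθ₀ : H3 (Θ₀ + g₀) := hΘ₀.h3.add hg₀
  -- Cutting at n + 2 leaves Θ₀ untouched, so the truncated perturbation starts from a projection of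
  -- g₀ and inherits its smallness.
  choose x hx0 hxc hxB hxd using fun n : ℕ =>
    exists_galerkin hμ h0 (n + 2) (BL.proj ((n : ℝ) + 2) (Θ₀ + g₀))
  have hn2 : ∀ n : ℕ, (2 : ℝ) ≤ n + 2 := fun n => by linarith [(Nat.cast_nonneg n : (0 : ℝ) ≤ n)]
  have hbound : ∀ (n : ℕ) (T : ℝ), 0 ≤ T → ‖J3 (x n T - Θ T)‖ ^ 2 +
      μ * ∫ t in (0 : ℝ)..T, ‖fourierMul (fun ξ => (dw α ξ : ℂ)) (x n t - Θ t)‖ ^ 2 ≤ ε := by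
    intro n T hT
    refine galerkin_bound hμ h0 h1 (hn2 n) (hxc n) (hxB n) (hxd n) hΘ.continuousOn hB1
      hΘ.equation hε hsm (fun T hT => le_trans ?_ (hreal T hT)) hT
    have e : x n 0 - Θ 0 = proj ((n : ℝ) + 2) g₀ := by
      rw [hx0, hΘ.initial, map_add, (hΘ₀.mono (by linarith [hn2 n])).proj_eq, add_sub_cancel_left]
    rw [e]
    gcongr
    exact norm_J3_proj_le_J3 _ hg₀
  have hgB : ∀ (n : ℕ) t, 0 ≤ t → BL (n + 2) (x n t - Θ t) := fun n t ht =>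
    (hxB n t ht).sub ((hB1 t ht).mono (by linarith [hn2 n]))
  have hJg : ∀ (n : ℕ) t, 0 ≤ t → ‖J3 (x n t - Θ t)‖ ≤ Real.sqrt ε := fun n t ht => by
    refine Real.le_sqrt_of_sq_le (le_trans ?_ (hbound n t ht))
    exact le_add_of_nonneg_right (mul_nonneg hμ.le
      (intervalIntegral.integral_nonneg ht fun _ _ => sq_nonneg _))
  have hxM : ∀ (n : ℕ) t, 0 ≤ t → ‖J3 (x n t)‖ ≤ Real.sqrt ε + ‖J3 Θ₀‖ := fun n t ht => by
    have h2 := hJg n t ht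
    rw [J3_sub (hxB n t ht).h3 (hB1 t ht).h3] at h2
    have h3 := norm_le_norm_sub_add (J3 (x n t)) (J3 (Θ t))
    have h4 := hJΘ t ht
    linarith
  obtain ⟨θ, hθi, hu, hc, h3, hM, hd⟩ := exists_limit hμ h0 h1 hθ₀ hx0 hxc hxB hxM hxd
  have hlim : ∀ t, 0 ≤ t → Tendsto (fun n => x n t - Θ t) atTop (𝓝 (θ t - Θ t)) := fun t ht =>
    ((hu t ht).tendsto_at ⟨ht, le_rfl⟩).sub_const _
  have hdis : ∀ T, 0 ≤ T → ∫⁻ τ in Ioc 0 T, dissip α (θ τ - Θ τ) ≤ ENNReal.ofReal (ε / μ) := by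
    intro T hT
    refine lintegral_dissip_le h0 hT (hc.sub hΘ.continuousOn)
      (fun n => (hxc n).sub hΘ.continuousOn) hgB hlim fun n => ?_
    rw [le_div_iff₀' hμ]
    exact le_trans (le_add_of_nonneg_left (sq_nonneg _)) (hbound n T hT)
  -- H³ continuity requires locally integrable dissipation of θ itself; the part due to Θ is finite
  -- on bounded intervals because Θ is band-limited.
  have hdisθ : ∀ T, 0 ≤ T → ∫⁻ τ in Ioc 0 T, dissip α (θ τ) < ⊤ := by
    intro T hT
    have h5 : AEMeasurable (fun t => 2 * dissip α (Θ t)) (volume.restrict (Ioc 0 T)) := by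
      have h6 : ContinuousOn (fun t => 2 * ‖dwR α h0 1 (Θ t)‖ₑ ^ 2) (Ioc 0 T) :=
        ((ENNReal.continuous_const_mul (by norm_num)).comp
          ((ENNReal.continuous_pow 2).comp continuous_enorm)).comp_continuousOn
          ((dwR α h0 1).continuous.comp_continuousOn
            (hΘ.continuousOn.mono (Ioc_subset_Icc_self.trans Icc_subset_Ici_self)))
      refine (h6.aemeasurable measurableSet_Ioc).congr ?_
      refine (ae_restrict_iff' measurableSet_Ioc).2 (Eventually.of_forall fun t ht => ?_)
      simp only [(hB1 t ht.1.le).dissip_eq h0]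
    calc ∫⁻ τ in Ioc 0 T, dissip α (θ τ)
        ≤ ∫⁻ τ in Ioc 0 T, (2 * dissip α (θ τ - Θ τ) + 2 * dissip α (Θ τ)) :=
          lintegral_mono fun τ => by
            have := dissip_add_le (α := α) (θ τ - Θ τ) (Θ τ)
            rwa [sub_add_cancel] at this
      _ = 2 * (∫⁻ τ in Ioc 0 T, dissip α (θ τ - Θ τ)) + 2 * ∫⁻ τ in Ioc 0 T, dissip α (Θ τ) := by
          rw [lintegral_add_right' _ h5, lintegral_const_mul' _ _ (by norm_num),
            lintegral_const_mul' _ _ (by norm_num)]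
      _ < ⊤ := by
          refine ENNReal.add_lt_top.2 ⟨ENNReal.mul_lt_top (by norm_num)
            ((hdis T hT).trans_lt ENNReal.ofReal_lt_top), ENNReal.mul_lt_top (by norm_num)
            (lintegral_dissip_lt_top h0 hΘ.continuousOn hB1)⟩
  refine ⟨θ, _, IsGlobalSolution.of_bounded hμ h0 h1 hθi hc h3 hM hd hdisθ, hM, fun t ht =>
    ⟨?_, hdis t ht⟩⟩
  obtain ⟨i1, i2⟩ := h3_of_tendsto (hlim t ht) (Eventually.of_forall fun n => (hgB n t ht).h3)
    (Eventually.of_forall fun n => hJg n t ht)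
  rw [hNorm_eq_enorm_J3 i1, ← ofReal_norm, ← ENNReal.ofReal_pow (norm_nonneg _)]
  refine ENNReal.ofReal_le_ofReal ?_
  calc ‖J3 (θ t - Θ t)‖ ^ 2 ≤ Real.sqrt ε ^ 2 := by gcongr
    _ = ε := Real.sq_sqrt hε.le

end SQG

end

theorem theorem1p1 :
    ∃ C : ℝ, 1 < C ∧ ∀ μ : ℝ, 0 < μ → ∃ ε₀ : ℝ, 0 < ε₀ ∧ ε₀ ≤ Real.exp (-100) ∧
      ∀ (α ε : ℝ) (Θ₀ g₀ : SQG.L2) (Θ : ℝ → SQG.L2),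
        0 ≤ α → α < 1 / 2 → 0 < ε → ε ≤ ε₀ →
        SQG.IsLinearSolution μ α Θ₀ Θ →
        SQG.AnnulusSupported Θ₀ →
        SQG.SmallnessCondition C ε g₀ Θ →
        (∀ t : ℝ, 0 ≤ t → Θ t = SQG.heat μ α t Θ₀) ∧
        ∃ θ : ℝ → SQG.L2,
          SQG.IsGlobalSolution μ α (Θ₀ + g₀) θ ∧
          (∀ θ' : ℝ → SQG.L2, SQG.IsGlobalSolution μ α (Θ₀ + g₀) θ' →
            ∀ t : ℝ, 0 ≤ t → θ' t = θ t) ∧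
          ∀ t : ℝ, 0 ≤ t →
            SQG.hNorm 3 (θ t - Θ t : SQG.L2) ^ 2 +
              ENNReal.ofReal (μ / 2) *
                ∫⁻ τ in Set.Ioc 0 t, SQG.hNorm 3 (SQG.fracLap (α / 2) (θ τ - Θ τ)) ^ 2
              ≤ ENNReal.ofReal (C * ε) := by
  refine ⟨SQG.engC, SQG.one_lt_engC, fun μ hμ => ?_⟩
  have hw := SQG.wC_nonneg
  have hq : 0 < μ / (126 * SQG.wC + 1) := by positivity
  -- The second entry of the minimum gives √(2ε) ≤ μ / (126 wC + 1), hence the absorption condition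
  -- `hsm`. The added 1 keeps the denominator positive, since only wC ≥ 0 is recorded.
  refine ⟨min (Real.exp (-100)) ((μ / (126 * SQG.wC + 1)) ^ 2 / 2), lt_min (Real.exp_pos _)
    (by positivity), min_le_left _ _, fun α ε Θ₀ g₀ Θ h0 h1 hε hε₀ hΘ hA hS => ?_⟩
  have hsm : 126 * SQG.wC * Real.sqrt (2 * ε) ≤ μ := by
    have h2 : 2 * ε ≤ (μ / (126 * SQG.wC + 1)) ^ 2 := by
      have := hε₀.trans (min_le_right _ _)
      linarith
    have h3 : Real.sqrt (2 * ε) ≤ μ / (126 * SQG.wC + 1) := Real.sqrt_le_iff.2 ⟨hq.le, h2⟩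
    calc 126 * SQG.wC * Real.sqrt (2 * ε) ≤ (126 * SQG.wC + 1) * (μ / (126 * SQG.wC + 1)) := by
          gcongr; linarith
      _ = μ := by field_simp
  obtain ⟨θ, M, hθ, hM, hb⟩ :=
    SQG.exists_solution_near_linear hμ h0 h1.le hε hsm hΘ hA.bl hS
  refine ⟨fun t ht => hΘ.eq_heat hμ h0 ht, θ, hθ, fun θ' h' t ht => hθ.unique hμ h0 h1.le hM h' ht,
    fun t ht => ?_⟩
  obtain ⟨b1, b2⟩ := hb t ht
  have hΘ3 : ∀ s, 0 ≤ s → SQG.H3 (Θ s) := fun s hs => by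
    rw [hΘ.eq_heat hμ h0 hs]; exact (hA.bl.heat hμ hs).h3
  have e : ∫⁻ τ in Set.Ioc 0 t, SQG.hNorm 3 (SQG.fracLap (α / 2) (θ τ - Θ τ)) ^ 2
      = ∫⁻ τ in Set.Ioc 0 t, SQG.dissip α (θ τ - Θ τ) :=
    setLIntegral_congr_fun measurableSet_Ioc fun τ hτ =>
      SQG.hNorm_fracLap_sq h0 h1.le ((hθ.h3 hτ.1.le).sub (hΘ3 τ hτ.1.le))
  rw [e]
  calc SQG.hNorm 3 (θ t - Θ t : SQG.L2) ^ 2 +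
        ENNReal.ofReal (μ / 2) * ∫⁻ τ in Set.Ioc 0 t, SQG.dissip α (θ τ - Θ τ)
      ≤ ENNReal.ofReal ε + ENNReal.ofReal (μ / 2) * ENNReal.ofReal (ε / μ) := by gcongr
    _ = ENNReal.ofReal (ε + μ / 2 * (ε / μ)) := by
        rw [ENNReal.ofReal_add hε.le (by positivity), ENNReal.ofReal_mul (by positivity)]
    -- The two contributions add up to 3ε/2, and `engC` is at least 2.
    _ ≤ ENNReal.ofReal (SQG.engC * ε) := by
        refine ENNReal.ofReal_le_ofReal ?_
        have h5 : μ / 2 * (ε / μ) = ε / 2 := by field_simp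
        have h6 : 2 ≤ SQG.engC := by
          have := SQG.one_le_bernC
          have h7 : 1 ≤ SQG.bernC ^ 4 := one_le_pow₀ this
          unfold SQG.engC
          linarith
        rw [h5]
        nlinarith
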